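/- **Model.** $n\ge 2$ nodes are placed at distinct points of the Euclidean plane and have distinct names in $\{1,\dots,N\}$. All transmit with the same power $P>0$; let $\alpha>2$ (path loss), $\mathcal N>0$ (noise), $\beta\ge1$ (threshold), $0<\varepsilon<1$, and $r=(P/(\mathcal N\beta))^{1/\alpha}$. Time is divided into synchronous rounds. When exactly the nodes of $\mathcal T$ transmit in a round, $u\notin\mathcal T$ receives the message of $v\in\mathcal T$ iff $\mathrm{dist}(v,u)\le(1-\varepsilon)r$ and $\dfrac{P\,\mathrm{dist}(v,u)^{-\alpha}}{\mathcal N+\sum_{w\in\mathcal T\setminus\{v\}}P\,\mathrm{dist}(w,u)^{-\alpha}}\ge\beta$. In the communication graph $G$, assumed connected, two nodes are adjacent iff their distance is at most $(1-\varepsilon)r$; $\Delta$ is its maximum degree. Each node knows only its name, $N$, $\Delta$, and whether it belongs to a given maximal independent set (MIS) $I$ of $G$; the members of $I$ are called MIS-leaders. All nodes start simultaneously. An $(N,x)$-ssf is a sequence $(S_0,\dots,S_{s-1})$ of subsets of $\{1,\dots,N\}$ such that for all $Z$ with $1\le|Z|\le x$ and all $z\in Z$ some $S_i$ has $S_i\cap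 Z=\{z\}$. A set of nodes *executes* it if each node $v$ of the set transmits in the $i$-th round iff $v\in S_i$. Let $F_0$ be a shortest $(N,c_0)$-ssf, of length $z$, and $F_1$ a shortest $(N,c_1\lceil\log_2N\rceil^3)$-ssf, of length $x$. **Algorithm ConnectBB** (constants $c_0,c_1,\kappa$). Each node draws independent uniform numbers $t,t'\in\{0,\dots,\kappa\Delta-1\}$. 1. The MIS-leaders execute $F_0$, transmitting their names; each other node records up to $25$ names heard. 2. (a) In $\kappa\Delta$ consecutive groups of $25$ blocks of $x$ rounds, each node $v\notin I$ executes $F_1$ in each block of group $t_v$, transmitting in the $j$-th block its own name and its $j$-th recorded MIS-leader. Each node records, for each MIS-leader's name newly heard, the sender and the round. (b) The same with groups of $49$ blocks, transmitting the (at most $49$) MIS-leaders recorded in 1 and 2(a), the latter with the recorded sender and round. Each MIS-leader $w$ records the (at most $121$) other MIS-leaders $u$ heard of, and for each of them the one intermediate node, or the two intermediate nodes, of the first report heard, with the rounds. 3. (a) In the $j$-th of $121$ executions of $F_0$, each MIS-leader transmits its name and its $j$-th record; the first intermediate node named in it becomes a connector when it receives this. (b) In the $j$-th of $121$ executions of $F_0$,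 each first intermediate node transmits its $j$-th record naming a second intermediate node, which becomes a connector when it receives this. Let $H$ be the set of MIS-leaders and connectors. 4. The nodes of $H$ execute $F_0$, transmitting their names; each node of $H$ records the names heard as its neighbours in $H$. 5. The nodes of $H$ again execute $F_0$, transmitting their names, and confirm their neighbours; each node outside $H$ takes the smallest name heard as its leader (master). 6. In $\kappa\Delta$ blocks of $x$ rounds, each $v\notin H$ executes $F_1$ in block $t'_v$, transmitting its name and that of its master. Each node of $H$ orders the nodes that it heard naming it as their master. 7. In the $j$-th of $\Delta$ executions of $F_0$, each node of $H$ transmits the $j$-th name on its list; a node $v\notin H$ that hears its name in the $j$-th execution sets $\sigma_v=j$. $\textsc{Inter}_H$ consists of one execution of $F_0$ by $H$. $\textsc{Intra}_H$ consists of $\Delta$ consecutive executions of $F_0$, where each $v\notin H$ takes part in the $\sigma_v$-th. **Theorem.** There is an absolute constant $B$ such that for all $P,\alpha,\mathcal N,\beta,\varepsilon$ as above there are $c_0$ and $A$ such that for every $d\in\mathbb N$ there are $c_1,\kappa$ and $C$ with the following properties, for all networks as above and every MIS $I$ of $G$. * ConnectBB takes at most $C\,\Delta\log^7N$ rounds,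 and every message has at most $C\log N$ bits. * $\textsc{Inter}_H$ and $\textsc{Intra}_H$ have lengths $a_1\le A\log N$ and $a_2\le A\,\Delta\log N$. * With probability at least $1-n^{-d}$, ConnectBB computes a backbone $H\supseteq I$ and its protocols, that is: * $H$ is a connected dominating set of $G$; every node of $G$ has at most $B$ neighbours in $H$; $|H|\le B\,|S|$ for every connected dominating set $S$ of $G$; $\mathrm{diam}(G[H])\le B\,\mathrm{diam}(G)$; * each node outside $H$ has been associated with exactly one leader, which is a neighbour of it in $H$ and which it knows, and each node of $H$ knows exactly its neighbours in $H$; * in one run of $\textsc{Inter}_H$ the message of each $v\in H$ is received by all neighbours of $v$ in $H$ and by all nodes outside $H$ whose leader is $v$; * in one run of $\textsc{Intra}_H$ the message of each node outside $H$ is received by its leader. -/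

import Mathlib

namespace BareBones

/-! ### The SINR model of wireless networks (weak sensitivity and weak connectivity) -/

/-- Physical parameters: path loss `α`, ambient noise `ν`, threshold `β`, uniform transmission
power `P`, and the common value `ε` of the sensitivity and the connectivity parameter. -/
structure SINRParams where
  α : ℝ
  ν : ℝ
  β : ℝ
  P : ℝ
  ε : ℝ
  two_lt_α : 2 < α
  ν_pos : 0 < ν
  one_le_β : 1 ≤ β
  P_pos : 0 < P
  ε_pos : 0 < ε
  ε_lt_one : ε < 1

/-- The largest distance at which a lone transmitter reaches the threshold. -/
noncomputable def SINRParams.range (p : SINRParams) : ℝ := (p.P / (p.ν * p.β)) ^ (1 / p.α)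

/-- A network of `n` nodes at distinct points of the Euclidean plane, with distinct names taken
from a set of `N` linearly ordered names. -/
structure Network (N n : ℕ) where
  pos : Fin n → EuclideanSpace ℝ (Fin 2)
  pos_injective : Function.Injective pos
  name : Fin n ↪ Fin N

namespace Network

variable {N n : ℕ}

/-- The signal-to-interference-plus-noise ratio of the transmission from `v` at `u`, when `T` is
the set of transmitters. -/
noncomputable def sinr (p : SINRParams) (net : Network N n) (T : Finset (Fin n))
    (v u : Fin n) : ℝ :=
  (p.P * dist (net.pos v) (net.pos u) ^ (-p.α)) /
    (p.ν + ∑ w ∈ T.erase v, p.P * dist (net.pos w) (net.pos u) ^ (-p.α))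

/-- When exactly the nodes of `T` transmit, node `u` successfully receives the message of `v`. -/
def Hears (p : SINRParams) (net : Network N n) (T : Finset (Fin n)) (v u : Fin n) : Prop :=
  v ∈ T ∧ u ∉ T ∧ p.β ≤ net.sinr p T v u ∧
    dist (net.pos v) (net.pos u) ≤ (1 - p.ε) * p.range

/-- The communication graph. -/
def commGraph (p : SINRParams) (net : Network N n) : SimpleGraph (Fin n) where
  Adj u v := u ≠ v ∧ dist (net.pos u) (net.pos v) ≤ (1 - p.ε) * p.range
  symm := ⟨fun u v h => ⟨h.1.symm, by rw [dist_comm]; exact h.2⟩⟩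
  loopless := ⟨fun _ h => h.1 rfl⟩

open Classical in
/-- The maximum degree of the communication graph. -/
noncomputable def maxDeg (p : SINRParams) (net : Network N n) : ℕ := (net.commGraph p).maxDegree

open Classical in
/-- What each node receives in one round, if `tx v` is the message transmitted by `v`, with `none`
for a node that listens. As `1 ≤ β`, a node receives from at most one transmitter, so that
the choice below is no choice. -/
noncomputable def receive (p : SINRParams) (net : Network N n) {μ : Type}
    (tx : Fin n → Option μ) (u : Fin n) : Option μ :=
  if h : ∃ v, net.Hears p (Finset.univ.filter fun w => (tx w).isSome) v u then tx h.choose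
  else none

end Network

/-! ### Synchronous distributed algorithms -/

/-- A phase of a synchronous distributed algorithm, as executed by one node: it lasts `len`
rounds, the local state at its start determines in which rounds the node transmits (and what), and
at its end the node updates its state from what it received. -/
structure Phase (σ μ : Type) where
  len : ℕ
  send : σ → Fin len → Option μ
  update : σ → (Fin len → Option μ) → σ

section Execution

variable {N n : ℕ} {σ μ : Type}

/-- All nodes execute one phase simultaneously. -/
noncomputable def Phase.exec (p : SINRParams) (net : Network N n) (ph : Phase σ μ)
    (s : Fin n → σ) : Fin n → σ :=
  fun u => ph.update (s u) fun i => net.receive p (fun v => ph.send (s v) i) u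

/-- All nodes execute the phases of `A` one after another, from a synchronized start. -/
noncomputable def run (p : SINRParams) (net : Network N n) :
    List (Phase σ μ) → (Fin n → σ) → (Fin n → σ)
  | [], s => s
  | ph :: A, s => run p net A (ph.exec p net s)

/-- The number of rounds of an algorithm. -/
def rounds (A : List (Phase σ μ)) : ℕ := (A.map Phase.len).sum

/-- Every message transmitted in the execution satisfies `Q`. -/
def AllSent (p : SINRParams) (net : Network N n) (Q : μ → Prop) :
    List (Phase σ μ) → (Fin n → σ) → Prop
  | [], _ => True
  | ph :: A, s =>
      (∀ v i m, ph.send (s v) i = some m → Q m) ∧ AllSent p net Q A (ph.exec p net s)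

end Execution

/-! ### Strongly selective families -/

/-- `F` is an `(N, x)`-strongly-selective family. -/
def IsSSF {N : ℕ} (F : List (Finset (Fin N))) (x : ℕ) : Prop :=
  ∀ Z : Finset (Fin N), Z.Nonempty → Z.card ≤ x → ∀ z ∈ Z, ∃ S ∈ F, S ∩ Z = {z}

theorem exists_isSSF (N x : ℕ) :
    ∃ s : ℕ, ∃ F : List (Finset (Fin N)), F.length = s ∧ IsSSF F x := by
  refine ⟨_, (List.finRange N).map fun v => {v}, rfl, fun Z _ _ z hz => ⟨{z}, ?_, ?_⟩⟩
  · simp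
  · simpa using hz

open Classical in
theorem exists_shortest_isSSF (N x : ℕ) :
    ∃ F : List (Finset (Fin N)), IsSSF F x ∧
      ∀ F' : List (Finset (Fin N)), IsSSF F' x → F.length ≤ F'.length := by
  obtain ⟨F, hF, h⟩ := Nat.find_spec (exists_isSSF N x)
  exact ⟨F, h, fun F' h' => hF ▸ Nat.find_min' (exists_isSSF N x) ⟨F', rfl, h'⟩⟩

/-- A fixed shortest `(N, x)`-strongly-selective family, known to all nodes. -/
noncomputable def ssf (N x : ℕ) : List (Finset (Fin N)) := (exists_shortest_isSSF N x).choose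

theorem ssf_isSSF (N x : ℕ) : IsSSF (ssf N x) x := (exists_shortest_isSSF N x).choose_spec.1

theorem ssf_length_le {N x : ℕ} {F : List (Finset (Fin N))} (hF : IsSSF F x) :
    (ssf N x).length ≤ F.length := (exists_shortest_isSSF N x).choose_spec.2 F hF

/-- In repeated executions of the family `F`, counted from round `0`, node `v` is scheduled to
transmit in round `i`. -/
def fires {N : ℕ} (F : List (Finset (Fin N))) (v : Fin N) (i : ℕ) : Prop :=
  v ∈ F.getD (i % F.length) ∅

instance {N : ℕ} (F : List (Finset (Fin N))) (v : Fin N) (i : ℕ) : Decidable (fires F v i) :=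
  inferInstanceAs (Decidable (v ∈ F.getD (i % F.length) ∅))

/-! ### Messages and local states -/

/-- How a leader `w` reaches another leader `u`: through a common neighbour `g` that was heard in
round `f`, or through a neighbour `g₁`, heard in round `f₁`, which in turn heard the neighbour `g₂`
of `u` in round `f₂`. -/
inductive Route (N : ℕ) where
  | one (g : Fin N) (f : ℕ)
  | two (g₁ g₂ : Fin N) (f₁ f₂ : ℕ)

/-- Messages of `connectBB`. -/
inductive Msg (N : ℕ) where
  /-- the sender's name -/
  | hello (v : Fin N)
  /-- the sender `v` has the leader `u` as a neighbour -/
  | near (v u : Fin N)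
  /-- the sender `v` knows of the leader `u`, two hops away, through `g` heard in round `f` -/
  | far (v u g : Fin N) (f : ℕ)
  /-- the leader `w` reaches the leader `u` through the connectors in the route `r` -/
  | assign (w u : Fin N) (r : Route N)
  /-- `g₁` tells `g₂` that they connect the leaders `u` and `w`; `f` is the round in which
  `g₁` heard `g₂` -/
  | relay (g₁ g₂ u w : Fin N) (f : ℕ)
  /-- the sender `v` has the master `m` -/
  | slave (v m : Fin N)
  /-- acknowledgement addressed to the slave `v` -/
  | ack (v : Fin N)

/-- The number of bits of a message: a constant number for its kind, then names and round
numbers in binary. -/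
def Msg.bits {N : ℕ} : Msg N → ℕ
  | .hello _ => 4 + Nat.clog 2 N
  | .near _ _ => 4 + 2 * Nat.clog 2 N
  | .far _ _ _ f => 4 + 3 * Nat.clog 2 N + Nat.size f
  | .assign _ _ (.one _ f) => 4 + 3 * Nat.clog 2 N + Nat.size f
  | .assign _ _ (.two _ _ f₁ f₂) => 4 + 4 * Nat.clog 2 N + Nat.size f₁ + Nat.size f₂
  | .relay _ _ _ _ f => 4 + 4 * Nat.clog 2 N + Nat.size f
  | .slave _ _ => 4 + 2 * Nat.clog 2 N
  | .ack _ => 4 + Nat.clog 2 N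

/-- The local state of a node. At the start a node knows its name, whether it is a leader (belongs
to the given maximal independent set), and its two random numbers. -/
structure NodeState (N : ℕ) where
  name : Fin N
  leader : Bool
  t₁ : ℕ
  t₂ : ℕ
  /-- neighbouring leaders -/
  oneHop : List (Fin N) := []
  /-- leaders `u` two hops away, with the node through which and the round in which `u` was heard -/
  twoHop : List (Fin N × Fin N × ℕ) := []
  /-- for a leader: other leaders and the chosen routes to them -/
  routes : List (Fin N × Route N) := []
  /-- for a connector `g₁`: tuples `(u, w, g₂, f)`, meaning that it connects the leaders `u` and `w`
  together with `g₂`, which it heard in round `f` -/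
  relays : List (Fin N × Fin N × Fin N × ℕ) := []
  /-- pairs of leaders `(u, w)` for which the node is a connector, with the other connector of the
  pair, if any, and the round in which the node was heard -/
  conns : List (Fin N × Fin N × Option (Fin N) × ℕ) := []
  /-- neighbours in the backbone -/
  nbrs : List (Fin N) := []
  /-- for a node outside the backbone: its associated backbone node -/
  master : Option (Fin N) := none
  /-- for a backbone node: the nodes associated with it -/
  slaves : List (Fin N) := []
  /-- for a node outside the backbone: its position on the list of its master -/
  position : Option ℕ := none

namespace NodeState

variable {N : ℕ}

/-- A node belongs to the backbone if it is a leader or a connector of some pair of leaders. -/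
def inBackbone (s : NodeState N) : Prop := s.leader = true ∨ s.conns ≠ []

instance (s : NodeState N) : Decidable s.inBackbone :=
  inferInstanceAs (Decidable (s.leader = true ∨ s.conns ≠ []))

/-- What a node that is no leader announces about the (at most `49`) leaders at one or two hops. -/
def known (s : NodeState N) : List (Msg N) :=
  (s.oneHop.map (fun u => Msg.near s.name u) ++
    s.twoHop.map (fun e => Msg.far s.name e.1 e.2.1 e.2.2)).take 49

end NodeState

/-- The items extracted by `f` from the messages received in a phase, in the order of reception. -/
def heard {N len : ℕ} {γ : Type} (rcv : Fin len → Option (Msg N))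
    (f : ℕ → Msg N → Option γ) : List γ :=
  (List.finRange len).filterMap fun i => (rcv i).bind (f i)

/-- For every key, keep only the first item with that key. -/
def firstBy {γ κ : Type} [DecidableEq κ] (key : γ → κ) (l : List γ) : List γ :=
  (l.reverse.pwFilter fun a b => key a ≠ key b).reverse

/-- The sender's name in a `hello` message. -/
def helloName {N : ℕ} (_ : ℕ) : Msg N → Option (Fin N)
  | .hello v => some v
  | _ => none

/-! ### The algorithm `connectBB`

Below, `F₀` is an `(N, c)`-strongly-selective family with `c` constant, `F₁` is an
`(N, Θ(log³ N))`-strongly-selective family, and `R = Θ(Δ)` is the number of values of each of the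
random numbers. Rounds are counted from `0` within each phase. -/

section Algorithm

variable {N : ℕ}

/-- Stage 1, part 1: leaders transmit their names, and the other nodes record them. -/
def learnLeaders (F₀ : List (Finset (Fin N))) : Phase (NodeState N) (Msg N) where
  len := F₀.length
  send s i := if s.leader ∧ fires F₀ s.name i then some (.hello s.name) else none
  update s rcv :=
    if s.leader then s
    else { s with oneHop := (firstBy id (heard rcv helloName)).take 25 }

/-- Stage 1, part 2, first sub-part: in group `t₁` of `25` blocks, in the `j`-th block, a node that
is no leader transmits its `j`-th leader. -/
def exchangeLeaders (F₁ : List (Finset (Fin N))) (R : ℕ) : Phase (NodeState N) (Msg N) where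
  len := 25 * F₁.length * R
  send s i :=
    if ¬ s.leader ∧ i.val / (25 * F₁.length) = s.t₁ ∧ fires F₁ s.name i then
      (s.oneHop[(i.val / F₁.length) % 25]?).map fun u => .near s.name u
    else none
  update s rcv :=
    { s with
      twoHop := firstBy (fun e => e.1) (heard rcv fun i m =>
        match m with
        | .near g u => if u ∈ s.oneHop then none else some (u, g, i)
        | _ => none) }

/-- Stage 1, part 2, second sub-part: the same with groups of `49` blocks and with all leaders at
one or two hops; each leader selects one route to every other leader that it hears of. -/
def collectRoutes (F₁ : List (Finset (Fin N))) (R : ℕ) : Phase (NodeState N) (Msg N) where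
  len := 49 * F₁.length * R
  send s i :=
    if ¬ s.leader ∧ i.val / (49 * F₁.length) = s.t₁ ∧ fires F₁ s.name i then
      s.known[(i.val / F₁.length) % 49]?
    else none
  update s rcv :=
    if s.leader then
      { s with
        routes := (firstBy (fun e => e.1) (heard rcv fun i m =>
          match m with
          | .near g u => if u = s.name then none else some (u, Route.one g i)
          | .far g₁ u g₂ f => if u = s.name then none else some (u, Route.two g₁ g₂ i f)
          | _ => none)).take 121 }
    else s

/-- Stage 1, part 3, first sub-part: every leader informs the adjacent connectors that it chose. -/
def informFirst (F₀ : List (Finset (Fin N))) : Phase (NodeState N) (Msg N) where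
  len := 121 * F₀.length
  send s i :=
    if s.leader ∧ fires F₀ s.name i then
      (s.routes[i.val / F₀.length]?).map fun e => .assign s.name e.1 e.2
    else none
  update s rcv :=
    { s with
      conns := s.conns ++ firstBy id (heard rcv fun _ m =>
        match m with
        | .assign w u (.one g f) => if g = s.name then some (u, w, none, f) else none
        | .assign w u (.two g₁ g₂ f₁ _) =>
            if g₁ = s.name then some (u, w, some g₂, f₁) else none
        | _ => none)
      relays := firstBy id (heard rcv fun _ m =>
        match m with
        | .assign w u (.two g₁ g₂ _ f₂) => if g₁ = s.name then some (u, w, g₂, f₂) else none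
        | _ => none) }

/-- Stage 1, part 3, second sub-part: these connectors inform the second connectors. -/
def informSecond (F₀ : List (Finset (Fin N))) : Phase (NodeState N) (Msg N) where
  len := 121 * F₀.length
  send s i :=
    if fires F₀ s.name i then
      (s.relays[i.val / F₀.length]?).map fun e => .relay s.name e.2.2.1 e.1 e.2.1 e.2.2.2
    else none
  update s rcv :=
    { s with
      conns := s.conns ++ firstBy id (heard rcv fun _ m =>
        match m with
        | .relay g₁ g₂ u w f => if g₂ = s.name then some (u, w, some g₁, f) else none
        | _ => none) }

/-- Stage 1, part 4: the backbone nodes learn their neighbours in the backbone. -/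
def learnNeighbours (F₀ : List (Finset (Fin N))) : Phase (NodeState N) (Msg N) where
  len := F₀.length
  send s i := if s.inBackbone ∧ fires F₀ s.name i then some (.hello s.name) else none
  update s rcv :=
    if s.inBackbone then { s with nbrs := firstBy id (heard rcv helloName) } else s

/-- Stage 2: one run of the inter-cluster protocol. The backbone nodes confirm their neighbours, and
each other node selects the smallest name heard as its master. -/
def chooseMaster (F₀ : List (Finset (Fin N))) : Phase (NodeState N) (Msg N) where
  len := F₀.length
  send s i := if s.inBackbone ∧ fires F₀ s.name i then some (.hello s.name) else none
  update s rcv :=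
    if s.inBackbone then
      { s with nbrs := s.nbrs.filter fun v => v ∈ heard rcv helloName }
    else { s with master := (heard rcv helloName).min? }

/-- Stage 2: in block `t₂`, each node outside the backbone transmits its name and its master;
every backbone node makes the ordered list of its slaves. -/
def collectSlaves (F₁ : List (Finset (Fin N))) (R : ℕ) : Phase (NodeState N) (Msg N) where
  len := F₁.length * R
  send s i :=
    if ¬ s.inBackbone ∧ i.val / F₁.length = s.t₂ ∧ fires F₁ s.name i then
      s.master.map fun m => .slave s.name m
    else none
  update s rcv :=
    if s.inBackbone then
      { s with
        slaves := (heard rcv fun _ m =>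
          match m with
          | .slave v m => if m = s.name then some v else none
          | _ => none).toFinset.sort }
    else s

/-- Stage 2: for each position on its list in turn, every backbone node acknowledges the slave at
this position, which so learns its position. -/
def acknowledge (F₀ : List (Finset (Fin N))) (Δ : ℕ) : Phase (NodeState N) (Msg N) where
  len := Δ * F₀.length
  send s i :=
    if s.inBackbone ∧ fires F₀ s.name i then
      (s.slaves[i.val / F₀.length]?).map fun v => .ack v
    else none
  update s rcv :=
    if s.inBackbone then s
    else
      { s with
        position := (heard rcv fun i m =>
          match m with
          | .ack v => if v = s.name then some (i / F₀.length) else none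
          | _ => none).head? }

/-- The constants of the algorithm: the parameter `c₀` of the family `F₀`, the factor `c₁` in the
parameter of `F₁`, and the factor `κ` in the range of the random numbers. -/
structure Consts where
  c₀ : ℕ
  c₁ : ℕ
  κ : ℕ

/-- The `(N, c₀)`-strongly-selective family. -/
noncomputable def Consts.F₀ (c : Consts) (N : ℕ) : List (Finset (Fin N)) := ssf N c.c₀

/-- The `(N, Θ(log³ N))`-strongly-selective family. -/
noncomputable def Consts.F₁ (c : Consts) (N : ℕ) : List (Finset (Fin N)) :=
  ssf N (c.c₁ * Nat.clog 2 N ^ 3)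

/-- The algorithm: its code depends only on `N` and `Δ` (and on the constants). -/
noncomputable def connectBB (c : Consts) (N Δ : ℕ) : List (Phase (NodeState N) (Msg N)) :=
  [learnLeaders (c.F₀ N),
   exchangeLeaders (c.F₁ N) (c.κ * Δ),
   collectRoutes (c.F₁ N) (c.κ * Δ),
   informFirst (c.F₀ N),
   informSecond (c.F₀ N),
   learnNeighbours (c.F₀ N),
   chooseMaster (c.F₀ N),
   collectSlaves (c.F₁ N) (c.κ * Δ),
   acknowledge (c.F₀ N) Δ]

end Algorithm

section Outcome

variable {N n : ℕ}

/-- The outcomes of the random choices: two numbers in `[0, κ Δ)` for every node. -/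
abbrev Seeds (c : Consts) (n Δ : ℕ) : Type := Fin n → Fin (c.κ * Δ) × Fin (c.κ * Δ)

/-- The probability of an event under the uniform distribution, i.e. with all random numbers of all
nodes independent and uniform. -/
noncomputable def prob {Ω : Type} [Fintype Ω] (E : Ω → Prop) : ℝ :=
  (Nat.card {ω // E ω} : ℝ) / (Fintype.card Ω : ℝ)

open Classical in
/-- The initial local states, for a given set `I` of leaders. -/
noncomputable def initialStates (net : Network N n) (I : Set (Fin n)) {c : Consts} {Δ : ℕ}
    (ω : Seeds c n Δ) : Fin n → NodeState N :=
  fun v => { name := net.name v, leader := decide (v ∈ I), t₁ := (ω v).1, t₂ := (ω v).2 }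

/-- The final local states of `connectBB`. -/
noncomputable def finalStates (p : SINRParams) (net : Network N n) (I : Set (Fin n)) (c : Consts)
    (ω : Seeds c n (net.maxDeg p)) : Fin n → NodeState N :=
  run p net (connectBB c N (net.maxDeg p)) (initialStates net I ω)

/-- The set of nodes of the computed backbone. -/
def backboneNodes (s : Fin n → NodeState N) : Finset (Fin n) :=
  Finset.univ.filter fun v => (s v).inBackbone

/-- The inter-cluster schedule: the set of nodes that transmit in round `i`, for
`i < F₀.length`. -/
def interSchedule (F₀ : List (Finset (Fin N))) (s : Fin n → NodeState N) (i : ℕ) :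
    Finset (Fin n) :=
  Finset.univ.filter fun v => (s v).inBackbone ∧ fires F₀ (s v).name i

/-- The intra-cluster schedule: the set of nodes that transmit in round `i`, for
`i < Δ * F₀.length`. -/
def intraSchedule (F₀ : List (Finset (Fin N))) (s : Fin n → NodeState N) (i : ℕ) :
    Finset (Fin n) :=
  Finset.univ.filter fun v =>
    ¬ (s v).inBackbone ∧ (s v).position = some (i / F₀.length) ∧ fires F₀ (s v).name i

end Outcome

/-! ### Backbones and their protocols -/

/-- `S` is a connected dominating set of `G`. -/
def IsCDS {V : Type} (G : SimpleGraph V) (S : Finset V) : Prop :=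
  (G.induce (S : Set V)).Connected ∧ ∀ v ∉ S, ∃ u ∈ S, G.Adj v u

/-- `H` is the set of nodes of a backbone of `G`, with the constant `B`, where `lead v` is the
leader associated with a node `v` outside `H`. -/
structure IsBackbone {V : Type} (G : SimpleGraph V) (H : Finset V) (lead : V → V) (B : ℕ) :
    Prop where
  isCDS : IsCDS G H
  degree_le : ∀ v, {u | u ∈ H ∧ G.Adj v u}.ncard ≤ B
  card_le : ∀ S : Finset V, IsCDS G S → H.card ≤ B * S.card
  diam_le : (G.induce (H : Set V)).diam ≤ B * G.diam
  lead_mem : ∀ v ∉ H, lead v ∈ H ∧ G.Adj v (lead v)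

section Protocols

variable {N n : ℕ}

/-- In `a` rounds of the schedule, `u` receives the message of `v`. -/
def Delivers (p : SINRParams) (net : Network N n) (sched : ℕ → Finset (Fin n)) (a : ℕ)
    (v u : Fin n) : Prop :=
  ∃ i < a, net.Hears p (sched i) v u

/-- The schedule of `a₁` rounds implements inter-cluster communication: in one multi-round the
message of each `v ∈ H` reaches all neighbours of `v` in `H`, and all nodes whose leader is `v`. -/
def IsInter (p : SINRParams) (net : Network N n) (H : Finset (Fin n)) (lead : Fin n → Fin n)
    (sched : ℕ → Finset (Fin n)) (a₁ : ℕ) : Prop :=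
  (∀ v ∈ H, ∀ u ∈ H, (net.commGraph p).Adj v u → Delivers p net sched a₁ v u) ∧
    ∀ u ∉ H, Delivers p net sched a₁ (lead u) u

/-- The schedule of `a₂` rounds implements intra-cluster communication: the message of each node
outside `H` reaches its leader. -/
def IsIntra (p : SINRParams) (net : Network N n) (H : Finset (Fin n)) (lead : Fin n → Fin n)
    (sched : ℕ → Finset (Fin n)) (a₂ : ℕ) : Prop :=
  ∀ v ∉ H, Delivers p net sched a₂ v (lead v)

/-- From the final states `s`, the algorithm has computed a backbone (with constant `B`) that
contains `I`, its associated protocols, and the local knowledge of them: every backbone node knows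
its neighbours in the backbone, and every other node knows its leader. -/
def ComputesBackbone (p : SINRParams) (net : Network N n) (I : Set (Fin n)) (B : ℕ)
    (F₀ : List (Finset (Fin N))) (s : Fin n → NodeState N) : Prop :=
  ∃ lead : Fin n → Fin n,
    I ⊆ backboneNodes s ∧
    IsBackbone (net.commGraph p) (backboneNodes s) lead B ∧
    (∀ v ∉ backboneNodes s, (s v).master = some (net.name (lead v))) ∧
    (∀ v ∈ backboneNodes s, ∀ x, x ∈ (s v).nbrs ↔
      ∃ u ∈ backboneNodes s, (net.commGraph p).Adj v u ∧ net.name u = x) ∧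
    IsInter p net (backboneNodes s) lead (interSchedule F₀ s) F₀.length ∧
    IsIntra p net (backboneNodes s) lead (intraSchedule F₀ s) (net.maxDeg p * F₀.length)

end Protocols

end BareBones

namespace BareBones

/-! ### Short strongly selective families -/

/-! The proof separates radio communication from the algorithm. The interface between them is
`Network.Selects`: in some round of an execution of a selective family by nodes of `X`, the receiver
`u` gets the message of `v`, whichever other nodes of `X` take part. Once this is available for
every execution inside `connectBB`, each phase is a deterministic exchange between neighbours, and
its outcome is read off from lists.

Selection is controlled by one number (`Network.selects_of_sum_wt_le`). A node at distance `d` from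
`u` gets weight 1 inside the disk of radius `D * radius` and `(d / (D * radius)) ^ (-α)` outside. If
the weights of `X` add up to at most `M`, then at most `M` nodes of `X` lie in the disk, so a family
with parameter `M + 2` can silence all of them except `v`; and the interference from outside is at
most `M * D ^ (-α)` times the signal at the connectivity radius. Because of `ε`, a fixed amount
`tolerance` of such interference is harmless.

If every disk of radius `a` contains `O(a ^ 2)` nodes of `X` (`Network.Spread`), dyadic summation
gives `M = O(D ^ 2)`, and `D ^ (2 - α)` is small for a constant `D` because `α > 2`. Leaders are
pairwise farther apart than the connectivity radius, so by packing this growth holds for every set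
that can be charged boundedly to nearby leaders: the leaders, the backbone, and the nodes sharing a
slot of the intra-cluster protocol, whose leaders are distinct. A single constant `c₀` serves them
all.

The set of all nodes grows proportionally to `Δ`, and a class of nodes with a common random number
carries an expected fraction `1 / Δ` of the total weight. For `D` of order `√(log N)` a Chernoff
bound shows that, with high probability, all classes have weight `O(D ^ 2) = O(log N)` at all
receivers (`SINRParams.exists_selects_random`).

Each leader selects one route with at most two connectors to every leader within three hops, so
boundedly many backbone nodes are charged to each leader. This bounds the degree, and also the size,
since a node dominates boundedly many leaders. A walk in `G` is followed by leaders dominating its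
vertices; consecutive ones are joined in the backbone by at most three edges, which gives
connectedness and the diameter. The running time comes from families of length `O(x ^ 2 log N)`
built from hash functions (`length_ssf_le`). -/

theorem card_collisions_le {N m : ℕ} {y z : Fin N} (hyz : y ≠ z) :
    m * (Finset.univ.filter fun h : Fin N → Fin m => h y = h z).card ≤ m ^ N := by
  -- Overwriting the value of a colliding `h` at `y` by an arbitrary `c` is injective in `(c, h)`:
  -- the old value at `y` can still be read off at `z`.
  have h := Finset.card_le_card_of_injOn (s := (Finset.univ : Finset (Fin m)) ×ˢ
    (Finset.univ.filter fun h : Fin N → Fin m => h y = h z))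
    (t := (Finset.univ : Finset (Fin N → Fin m))) (fun q => Function.update q.2 y q.1)
    (fun _ _ => Finset.mem_coe.2 (Finset.mem_univ _)) ?_
  · simpa using h
  · rintro ⟨c, h⟩ hh ⟨c', h'⟩ hh' heq
    simp only [Finset.coe_product, Set.mem_prod, Finset.mem_coe, Finset.mem_filter,
      Finset.mem_univ, true_and] at hh hh'
    have hc : c = c' := by simpa using congrFun heq y
    have hw : ∀ w, w ≠ y → h w = h' w := fun w hw => by
      simpa [Function.update_of_ne hw] using congrFun heq w
    refine Prod.ext hc (funext fun w => ?_)
    by_cases hwy : w = y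
    · subst hwy
      simp only [hh, hh']
      exact hw z hyz.symm
    · exact hw w hwy

/-- `h` isolates `z` in `Z`. -/
def Isolates {N m : ℕ} (h : Fin N → Fin m) (q : Fin N × Finset (Fin N)) : Prop :=
  ∀ y ∈ q.2.erase q.1, h y ≠ h q.1

instance {N m : ℕ} (h : Fin N → Fin m) : DecidablePred (Isolates h) := fun q =>
  inferInstanceAs (Decidable (∀ y ∈ q.2.erase q.1, h y ≠ h q.1))

/-- Union bound: each of the at most `x` other elements collides with `q.1` under a fraction at most
`1 / (2 * x)` of the functions. -/
theorem card_not_isolates_le {N x : ℕ} (q : Fin N × Finset (Fin N)) (hq : q.2.card ≤ x) :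
    2 * (Finset.univ.filter fun h : Fin N → Fin (2 * x) => ¬ Isolates h q).card ≤
      (2 * x) ^ N := by
  rcases Nat.eq_zero_or_pos x with rfl | hx
  · have : q.2 = ∅ := Finset.card_eq_zero.1 (Nat.le_zero.1 hq)
    simp [Isolates, this]
  have hsub : (Finset.univ.filter fun h : Fin N → Fin (2 * x) => ¬ Isolates h q) ⊆
      (q.2.erase q.1).biUnion fun y => Finset.univ.filter fun h => h y = h q.1 := by
    intro h hh
    simp only [Isolates, Finset.mem_filter, Finset.mem_univ, true_and, not_forall,
      not_not] at hh
    obtain ⟨y, hy, e⟩ := hh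
    exact Finset.mem_biUnion.2 ⟨y, hy, by simpa using e⟩
  have h1 := (Finset.card_le_card hsub).trans Finset.card_biUnion_le
  have h2 : (2 * x) * ∑ y ∈ q.2.erase q.1,
      (Finset.univ.filter fun h : Fin N → Fin (2 * x) => h y = h q.1).card ≤
      x * (2 * x) ^ N := by
    rw [Finset.mul_sum]
    refine (Finset.sum_le_card_nsmul _ _ ((2 * x) ^ N) fun y hy =>
      card_collisions_le (Finset.ne_of_mem_erase hy)).trans ?_
    rw [smul_eq_mul]
    exact Nat.mul_le_mul_right _ ((Finset.card_erase_le).trans hq)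
  refine le_of_mul_le_mul_left (a := x) ?_ hx
  calc x * (2 * _) = (2 * x) * _ := by ring
    _ ≤ _ := Nat.mul_le_mul_left _ h1
    _ ≤ _ := h2

/-- Greedy choice. Every pair is isolated by at least half of the functions, so by double counting
some function isolates at least half of the pairs; each further function halves what is left. -/
theorem exists_isolating {N x : ℕ} (hx : 0 < x) :
    ∀ (t : ℕ) (Q : Finset (Fin N × Finset (Fin N))), (∀ q ∈ Q, q.2.card ≤ x) → Q.card < 2 ^ t →
      ∃ L : List (Fin N → Fin (2 * x)), L.length = t ∧ ∀ q ∈ Q, ∃ h ∈ L, Isolates h q := by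
  intro t
  induction t with
  | zero =>
    intro Q _ hQ
    have : Q = ∅ := Finset.card_eq_zero.1 (by simpa using hQ)
    exact ⟨[], rfl, by simp [this]⟩
  | succ t ih =>
    intro Q hQx hQ
    obtain ⟨h, hh⟩ : ∃ h : Fin N → Fin (2 * x),
        2 * (Q.filter fun q => ¬ Isolates h q).card ≤ Q.card := by
      by_contra! hcon
      have hpos : 0 < (2 * x) ^ N := by positivity
      have h1 : ∑ _h : Fin N → Fin (2 * x), Q.card <
          ∑ h : Fin N → Fin (2 * x), 2 * (Q.filter fun q => ¬ Isolates h q).card := by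
        refine Finset.sum_lt_sum_of_nonempty ?_ fun h _ => hcon h
        have : NeZero (2 * x) := ⟨by omega⟩
        exact ⟨fun _ => 0, Finset.mem_univ _⟩
      have h2 : ∑ h : Fin N → Fin (2 * x), 2 * (Q.filter fun q => ¬ Isolates h q).card ≤
          Q.card * (2 * x) ^ N := by
        rw [← Finset.mul_sum]
        simp_rw [Finset.card_filter]
        rw [Finset.sum_comm, Finset.mul_sum]
        simp_rw [← Finset.card_filter]
        exact Finset.sum_le_card_nsmul _ _ _ fun q hq => card_not_isolates_le q (hQx q hq)
      simp only [Finset.sum_const, Finset.card_univ, Fintype.card_fun, Fintype.card_fin,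
        smul_eq_mul] at h1
      nlinarith
    obtain ⟨L, hL, hLQ⟩ := ih (Q.filter fun q => ¬ Isolates h q)
      (fun q hq => hQx q (Finset.mem_of_mem_filter q hq)) (by rw [pow_succ] at hQ; omega)
    refine ⟨h :: L, by simp [hL], fun q hq => ?_⟩
    by_cases hi : Isolates h q
    · exact ⟨h, by simp, hi⟩
    · obtain ⟨h', hh', hi'⟩ := hLQ q (Finset.mem_filter.2 ⟨hq, hi⟩)
      exact ⟨h', List.mem_cons_of_mem _ hh', hi'⟩

/-- The family consists of all fibres of `O(x * log N)` hash functions into `2 * x` values: a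
function isolating `z` in `Z` has a fibre that meets `Z` only in `z`. -/
theorem length_ssf_le {N x : ℕ} (hx : 0 < x) (hN : 2 ≤ N) :
    (ssf N x).length ≤ 6 * x ^ 2 * Nat.clog 2 N := by
  have hl : 1 ≤ Nat.clog 2 N := Nat.clog_pos (by norm_num) hN
  have hNl : N ≤ 2 ^ Nat.clog 2 N := Nat.le_pow_clog (by norm_num) N
  generalize Nat.clog 2 N = l at hl hNl ⊢
  -- Sets of the exact size `k` suffice, since a smaller set can be enlarged and isolation passes to
  -- subsets. The minimum ensures that sets of size `k` exist.
  set k := min x N with hk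
  have hkx : k ≤ x := min_le_left _ _
  set Q : Finset (Fin N × Finset (Fin N)) :=
    Finset.univ ×ˢ Finset.powersetCard k Finset.univ with hQ
  have hQc : Q.card < 2 ^ (l * (x + 1) + 1) := by
    have h1 : Q.card ≤ N * N ^ x := by
      rw [hQ, Finset.card_product, Finset.card_powersetCard, Finset.card_univ, Fintype.card_fin]
      exact Nat.mul_le_mul_left _ ((Nat.choose_le_pow _ _).trans
        (Nat.pow_le_pow_right (by omega) hkx))
    calc Q.card ≤ N ^ (x + 1) := by rw [pow_succ, mul_comm]; exact h1
      _ ≤ (2 ^ l) ^ (x + 1) := Nat.pow_le_pow_left hNl _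
      _ = 2 ^ (l * (x + 1)) := by rw [pow_mul]
      _ < _ := Nat.pow_lt_pow_right (by norm_num) (by omega)
  obtain ⟨L, hL, hLQ⟩ := exists_isolating hx _ Q (fun q hq => by
    have := (Finset.mem_powersetCard.1 (Finset.mem_product.1 hq).2).2
    omega) hQc
  set F : List (Finset (Fin N)) := L.flatMap fun h =>
    (List.finRange (2 * x)).map fun c => Finset.univ.filter fun v => h v = c with hF
  have hFl : F.length = (l * (x + 1) + 1) * (2 * x) := by
    simp [hF, List.length_flatMap, hL]
  have hssf : IsSSF F x := by
    intro Z _ hZ z hz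
    have hZN : Z.card ≤ N := by simpa using Finset.card_le_univ Z
    obtain ⟨Z', hZZ', -, hZ'⟩ := Finset.exists_subsuperset_card_eq (Finset.subset_univ Z)
      (le_min hZ hZN) (by simp)
    obtain ⟨h, hh, hi⟩ := hLQ (z, Z') (Finset.mem_product.2 ⟨Finset.mem_univ _,
      Finset.mem_powersetCard.2 ⟨Finset.subset_univ _, hZ'⟩⟩)
    refine ⟨Finset.univ.filter fun v => h v = h z, ?_, ?_⟩
    · exact List.mem_flatMap.2 ⟨h, hh, List.mem_map.2 ⟨h z, List.mem_finRange _, rfl⟩⟩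
    · ext y
      simp only [Finset.mem_inter, Finset.mem_filter, Finset.mem_univ, true_and,
        Finset.mem_singleton]
      constructor
      · rintro ⟨hy, hyZ⟩
        by_contra hne
        exact hi y (Finset.mem_erase.2 ⟨hne, hZZ' hyZ⟩) hy
      · rintro rfl
        exact ⟨rfl, hz⟩
  refine (ssf_length_le hssf).trans ?_
  rw [hFl]
  have : l * (x + 1) + 1 ≤ 3 * x * l := by nlinarith
  calc (l * (x + 1) + 1) * (2 * x) ≤ (3 * x * l) * (2 * x) := Nat.mul_le_mul_right _ this
    _ = _ := by ring

/-- Rounding up costs at most 1, which is at most `log N / log 2`, and `2 / log 2 < 3`. -/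
theorem clog_two_le_log {N : ℕ} (hN : 2 ≤ N) : (Nat.clog 2 N : ℝ) ≤ 3 * Real.log N := by
  have h2 : (0 : ℝ) < Real.log 2 := Real.log_pos (by norm_num)
  have hlog : Real.log 2 ≤ Real.log N := Real.log_le_log (by norm_num) (by exact_mod_cast hN)
  have h1 : 2 ^ (Nat.clog 2 N - 1) < N := Nat.pow_pred_clog_lt_self (by norm_num) hN
  have h3 : ((Nat.clog 2 N - 1 : ℕ) : ℝ) * Real.log 2 ≤ Real.log N := by
    rw [← Real.log_pow]
    exact Real.log_le_log (by positivity) (by exact_mod_cast h1.le)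
  have h4 : (Nat.clog 2 N : ℝ) ≤ ((Nat.clog 2 N - 1 : ℕ) : ℝ) + 1 := by
    exact_mod_cast (by omega : Nat.clog 2 N ≤ Nat.clog 2 N - 1 + 1)
  have h5 := Real.log_two_gt_d9
  nlinarith

/-! ### Packing in the plane -/

/-- The Euclidean plane. -/
abbrev Plane : Type := EuclideanSpace ℝ (Fin 2)

open MeasureTheory Metric Module in
-- Area comparison: the disks of radius `r / 2` around the points are disjoint and lie in a disk of
-- radius `(R + 1 / 2) * r`.
theorem card_le_of_separated (s : Finset Plane) (x : Plane) {r R : ℝ} (hr : 0 < r) (hR : 0 ≤ R)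
    (hs : ∀ c ∈ s, dist c x ≤ R * r) (h : ∀ c ∈ s, ∀ d ∈ s, c ≠ d → r ≤ dist c d) :
    (s.card : ℝ) ≤ (2 * R + 1) ^ 2 := by
  let μ : Measure Plane := Measure.addHaar
  set δ : ℝ := r / 2
  set T : ℝ := (R + 1 / 2) * r
  have δpos : 0 < δ := by positivity
  have Tpos : 0 < T := by positivity
  have D : Set.Pairwise (s : Set Plane) (Function.onFun Disjoint fun c => ball (c : Plane) δ) := by
    rintro c hc d hd hcd
    apply ball_disjoint_ball
    have := h c hc d hd hcd
    simp only [δ]; linarith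
  have hsub : (⋃ c ∈ s, ball (c : Plane) δ) ⊆ ball x T := by
    refine Set.iUnion₂_subset fun c hc => ?_
    apply ball_subset_ball'
    have := hs c hc
    simp only [δ, T]; linarith
  have I : (s.card : ENNReal) * ENNReal.ofReal (δ ^ finrank ℝ Plane) * μ (ball 0 1) ≤
      ENNReal.ofReal (T ^ finrank ℝ Plane) * μ (ball 0 1) :=
    calc
      (s.card : ENNReal) * ENNReal.ofReal (δ ^ finrank ℝ Plane) * μ (ball 0 1) =
          μ (⋃ c ∈ s, ball (c : Plane) δ) := by
        rw [measure_biUnion_finset D fun c _ => measurableSet_ball]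
        simp only [μ.addHaar_ball_of_pos _ δpos]
        simp only [Finset.sum_const, nsmul_eq_mul, mul_assoc]
      _ ≤ μ (ball x T) := measure_mono hsub
      _ = ENNReal.ofReal (T ^ finrank ℝ Plane) * μ (ball 0 1) := by
        simp only [μ.addHaar_ball_of_pos _ Tpos]
  have J : (s.card : ENNReal) * ENNReal.ofReal (δ ^ finrank ℝ Plane) ≤
      ENNReal.ofReal (T ^ finrank ℝ Plane) :=
    (ENNReal.mul_le_mul_iff_left (measure_ball_pos _ _ zero_lt_one).ne'
      measure_ball_lt_top.ne).1 I
  have K := ENNReal.toReal_le_of_le_ofReal (pow_nonneg Tpos.le _) J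
  rw [ENNReal.toReal_mul, ENNReal.toReal_ofReal (by positivity), ENNReal.toReal_natCast,
    finrank_euclideanSpace_fin] at K
  have e : T ^ 2 = (2 * R + 1) ^ 2 * δ ^ 2 := by simp only [δ, T]; ring
  rw [e] at K
  exact le_of_mul_le_mul_right K (by positivity)

/-- Law of cosines: for an angle below 60 degrees the squared distance is at most `‖z‖ ^ 2 + ‖w‖ ^ 2
- ‖z‖ * ‖w‖`, hence at most the square of the larger norm. -/
theorem Complex.norm_sub_le_of_arg_sub_lt {z w : ℂ} {r : ℝ} (hz : ‖z‖ ≤ r) (hw : ‖w‖ ≤ r)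
    (h : |z.arg - w.arg| < Real.pi / 3) : ‖z - w‖ ≤ r := by
  have hr : 0 ≤ r := (norm_nonneg z).trans hz
  have hcos : 1 / 2 ≤ Real.cos (z.arg - w.arg) := by
    rw [← Real.cos_abs, ← Real.cos_pi_div_three]
    exact Real.cos_le_cos_of_nonneg_of_le_pi (abs_nonneg _) (by linarith [Real.pi_pos]) h.le
  refine abs_le_of_sq_le_sq' ?_ hr |>.2
  have e : ‖z - w‖ ^ 2 = ‖z‖ ^ 2 + ‖w‖ ^ 2 - 2 * (‖z‖ * ‖w‖) * Real.cos (z.arg - w.arg) := by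
    rw [Complex.sq_norm, Complex.normSq_apply, Complex.sub_re, Complex.sub_im,
      ← Complex.norm_mul_cos_arg z, ← Complex.norm_mul_cos_arg w, ← Complex.norm_mul_sin_arg z,
      ← Complex.norm_mul_sin_arg w, Real.cos_sub]
    have h1 := Real.sin_sq_add_cos_sq z.arg
    have h2 := Real.sin_sq_add_cos_sq w.arg
    linear_combination ‖z‖ ^ 2 * h1 + ‖w‖ ^ 2 * h2
  rw [e]
  have h3 : (‖z‖ * ‖w‖) * (1 / 2) ≤ (‖z‖ * ‖w‖) * Real.cos (z.arg - w.arg) :=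
    mul_le_mul_of_nonneg_left hcos (by positivity)
  rcases le_total ‖z‖ ‖w‖ with hzw | hzw
  · nlinarith [norm_nonneg z, norm_nonneg w]
  · nlinarith [norm_nonneg z, norm_nonneg w]

/-- Each of the six sectors of angle `π / 3` around `x` contains at most one point. The area bound
would only give 9, which is too weak for `FirstInformed.length_relays_le`. -/
theorem card_le_six_of_separated (s : Finset Plane) (x : Plane) {r : ℝ}
    (hs : ∀ c ∈ s, dist c x ≤ r) (h : ∀ c ∈ s, ∀ d ∈ s, c ≠ d → r < dist c d) :
    s.card ≤ 6 := by
  set φ : Plane → ℂ := fun c => Complex.orthonormalBasisOneI.repr.symm (c - x)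
  have hφ : ∀ c d, ‖φ c - φ d‖ = dist c d := fun c d => by
    simp only [φ, ← map_sub, LinearIsometryEquiv.norm_map, sub_sub_sub_cancel_right, dist_eq_norm]
  have hφ' : ∀ c, ‖φ c‖ = dist c x := fun c => by
    simp only [φ, LinearIsometryEquiv.norm_map, dist_eq_norm]
  have hp : 0 < Real.pi / 3 := by positivity
  have hcard := Finset.card_le_card_of_injOn (s := s) (t := Finset.Icc (-2 : ℤ) 3)
    (fun c => ⌈(φ c).arg / (Real.pi / 3)⌉) ?_ ?_
  · simpa using hcard
  · intro c _
    have h1 := Complex.neg_pi_lt_arg (φ c)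
    have h2 := Complex.arg_le_pi (φ c)
    simp only [Finset.coe_Icc, Set.mem_Icc]
    constructor
    · have : (-3 : ℤ) < ⌈(φ c).arg / (Real.pi / 3)⌉ := by
        rw [Int.lt_ceil, lt_div_iff₀ hp]; push_cast; linarith
      omega
    · rw [Int.ceil_le, div_le_iff₀ hp]; push_cast; linarith
  · intro c hc d hd hcd
    by_contra hne
    have hlt := h c hc d hd hne
    rw [← hφ] at hlt
    refine absurd (Complex.norm_sub_le_of_arg_sub_lt ((hφ' c).trans_le (hs c hc))
      ((hφ' d).trans_le (hs d hd)) ?_) (not_le.2 hlt)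
    have h1 := Int.ceil_lt_add_one ((φ c).arg / (Real.pi / 3))
    have h2 := Int.le_ceil ((φ c).arg / (Real.pi / 3))
    have h3 := Int.ceil_lt_add_one ((φ d).arg / (Real.pi / 3))
    have h4 := Int.le_ceil ((φ d).arg / (Real.pi / 3))
    simp only at hcd
    rw [hcd] at h1 h2
    have h5 : |(φ c).arg / (Real.pi / 3) - (φ d).arg / (Real.pi / 3)| < 1 := by
      rw [abs_lt]; constructor <;> linarith
    rwa [← sub_div, abs_div, abs_of_pos hp, div_lt_one hp] at h5

/-! ### Sets of nodes of quadratic growth -/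

/-- The connectivity radius. -/
noncomputable def SINRParams.radius (p : SINRParams) : ℝ := (1 - p.ε) * p.range

theorem SINRParams.range_pos (p : SINRParams) : 0 < p.range :=
  Real.rpow_pos_of_pos (div_pos p.P_pos
    (mul_pos p.ν_pos (zero_lt_one.trans_le p.one_le_β))) _

theorem SINRParams.radius_pos (p : SINRParams) : 0 < p.radius :=
  mul_pos (sub_pos.2 p.ε_lt_one) p.range_pos

namespace Network

variable {N n : ℕ} {p : SINRParams} {net : Network N n}

theorem dist_le_of_adj {u v : Fin n} (h : (net.commGraph p).Adj u v) :
    dist (net.pos u) (net.pos v) ≤ p.radius := h.2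

theorem dist_le_two_of_adj {u v w : Fin n} (h : (net.commGraph p).Adj u v)
    (h' : (net.commGraph p).Adj v w) : dist (net.pos u) (net.pos w) ≤ 2 * p.radius := by
  linarith [dist_triangle (net.pos u) (net.pos v) (net.pos w), dist_le_of_adj h,
    dist_le_of_adj h']

theorem dist_le_three_of_adj {u v w x : Fin n} (h : (net.commGraph p).Adj u v)
    (h' : (net.commGraph p).Adj v w) (h'' : (net.commGraph p).Adj w x) :
    dist (net.pos u) (net.pos x) ≤ 3 * p.radius := by
  linarith [dist_triangle (net.pos u) (net.pos v) (net.pos x), dist_le_of_adj h,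
    dist_le_two_of_adj h' h'']

theorem lt_dist_of_isIndepSet {I : Set (Fin n)} (hI : (net.commGraph p).IsIndepSet I)
    {u v : Fin n} (hu : u ∈ I) (hv : v ∈ I) (huv : u ≠ v) :
    p.radius < dist (net.pos u) (net.pos v) := by
  by_contra! h
  exact hI hu hv huv ⟨huv, h⟩

theorem card_leaders_le {I : Set (Fin n)} (hI : (net.commGraph p).IsIndepSet I)
    (x : Plane) {R : ℝ} (hR : 0 ≤ R) (X : Finset (Fin n))
    (hX : ∀ v ∈ X, v ∈ I ∧ dist (net.pos v) x ≤ R * p.radius) :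
    (X.card : ℝ) ≤ (2 * R + 1) ^ 2 := by
  rw [← Finset.card_map ⟨net.pos, net.pos_injective⟩]
  refine card_le_of_separated _ x p.radius_pos hR ?_ ?_
  · simp only [Finset.mem_map, Function.Embedding.coeFn_mk, forall_exists_index, and_imp]
    rintro _ v hv rfl
    exact (hX v hv).2
  · simp only [Finset.mem_map, Function.Embedding.coeFn_mk, forall_exists_index, and_imp]
    rintro _ v hv rfl _ w hw rfl hne
    exact (lt_dist_of_isIndepSet hI (hX v hv).1 (hX w hw).1 fun e => hne (e ▸ rfl)).le

theorem card_adjacent_leaders_le {I : Set (Fin n)} (hI : (net.commGraph p).IsIndepSet I)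
    (u : Fin n) (X : Finset (Fin n)) (hX : ∀ v ∈ X, v ∈ I ∧ (net.commGraph p).Adj u v) :
    X.card ≤ 6 := by
  rw [← Finset.card_map ⟨net.pos, net.pos_injective⟩]
  refine card_le_six_of_separated _ (net.pos u) (r := p.radius) ?_ ?_
  · simp only [Finset.mem_map, Function.Embedding.coeFn_mk, forall_exists_index, and_imp]
    rintro _ v hv rfl
    exact dist_le_of_adj (hX v hv).2.symm
  · simp only [Finset.mem_map, Function.Embedding.coeFn_mk, forall_exists_index, and_imp]
    rintro _ v hv rfl _ w hw rfl hne
    exact lt_dist_of_isIndepSet hI (hX v hv).1 (hX w hw).1 fun e => hne (e ▸ rfl)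

variable (p net) in
/-- Every disk of radius `a ≥ 1` (in units of the connectivity radius) contains at most `K a ^ 2`
nodes of `X`. -/
def Spread (K : ℝ) (X : Finset (Fin n)) : Prop :=
  ∀ (x : Plane) (a : ℝ), 1 ≤ a →
    ((X.filter fun w => dist (net.pos w) x ≤ a * p.radius).card : ℝ) ≤ K * a ^ 2

/-- Each node of `X` is charged to a leader within three radii, and a leader receives at most `K`
charges. The leaders concerned lie in a disk of radius `a + 3`, and `2 * (a + 3) + 1 ≤ 9 * a` for `a
≥ 1`. -/
theorem spread_of_leaders {I : Set (Fin n)} (hI : (net.commGraph p).IsIndepSet I)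
    {X : Finset (Fin n)} {K : ℕ} (Y : Fin n → Finset (Fin n))
    (hX : ∀ v ∈ X, ∃ w ∈ I, v ∈ Y w ∧ dist (net.pos w) (net.pos v) ≤ 3 * p.radius)
    (hY : ∀ w ∈ I, (Y w).card ≤ K) : Spread p net (81 * K) X := by
  classical
  intro x a ha
  set J : Finset (Fin n) :=
    Finset.univ.filter fun w => w ∈ I ∧ dist (net.pos w) x ≤ (a + 3) * p.radius
  have hJ : (J.card : ℝ) ≤ (2 * (a + 3) + 1) ^ 2 :=
    card_leaders_le hI x (by linarith) J fun v hv => (Finset.mem_filter.1 hv).2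
  have hsub : (X.filter fun w => dist (net.pos w) x ≤ a * p.radius) ⊆ J.biUnion Y := by
    intro v hv
    obtain ⟨hvX, hvx⟩ := Finset.mem_filter.1 hv
    obtain ⟨w, hw, hvw, hd⟩ := hX v hvX
    refine Finset.mem_biUnion.2 ⟨w, Finset.mem_filter.2 ⟨Finset.mem_univ _, hw, ?_⟩, hvw⟩
    linarith [dist_triangle (net.pos w) (net.pos v) x]
  have h1 : (X.filter fun w => dist (net.pos w) x ≤ a * p.radius).card ≤ J.card * K :=
    (Finset.card_le_card hsub).trans (Finset.card_biUnion_le_card_mul _ _ _ fun w hw =>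
      hY w (Finset.mem_filter.1 hw).2.1)
  have hK : (0 : ℝ) ≤ K := Nat.cast_nonneg K
  calc ((X.filter fun w => dist (net.pos w) x ≤ a * p.radius).card : ℝ) ≤ J.card * K := by
        exact_mod_cast h1
    _ ≤ (2 * (a + 3) + 1) ^ 2 * K := mul_le_mul_of_nonneg_right hJ hK
    _ ≤ (9 * a) ^ 2 * K := by
        refine mul_le_mul_of_nonneg_right (pow_le_pow_left₀ (by linarith) (by linarith) 2) hK
    _ = 81 * K * a ^ 2 := by ring

end Network

/-! ### Sums of path losses -/

/-- The path loss at distance `d`, normalized to `1` on the disk of radius `s`. -/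
noncomputable def wt (α s d : ℝ) : ℝ := if d ≤ s then 1 else (d / s) ^ (-α)

theorem wt_nonneg {α s d : ℝ} (hs : 0 < s) : 0 ≤ wt α s d := by
  unfold wt
  split_ifs with h
  · exact zero_le_one
  · exact Real.rpow_nonneg (div_nonneg (hs.le.trans (not_le.1 h).le) hs.le) _

theorem wt_le_one {α s d : ℝ} (hα : 0 ≤ α) (hs : 0 < s) : wt α s d ≤ 1 := by
  unfold wt
  split_ifs with h
  · exact le_rfl
  · exact Real.rpow_le_one_of_one_le_of_nonpos ((one_le_div hs).2 (not_le.1 h).le) (by linarith)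

/-- The weight is dominated by a step function over dyadic disks, so that sums of weights become
counts of nodes in disks. The smallest `k` with `d ≤ 2 ^ k * s` alone suffices: for `k ≥ 1` its term
is `(2 ^ (k - 1)) ^ (-α)`, while `d > 2 ^ (k - 1) * s`. -/
theorem wt_le_sum {α s d : ℝ} (hα : 0 ≤ α) (hs : 0 < s) {m : ℕ} (hm : d ≤ 2 ^ m * s) :
    wt α s d ≤ ∑ k ∈ Finset.range (m + 1),
      if d ≤ 2 ^ k * s then (2 : ℝ) ^ α * ((2 : ℝ) ^ (-α)) ^ k else 0 := by
  classical
  have hex : ∃ k : ℕ, d ≤ 2 ^ k * s := ⟨m, hm⟩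
  set k := Nat.find hex with hk
  have hkd : d ≤ 2 ^ k * s := Nat.find_spec hex
  have hkm : k ≤ m := Nat.find_min' hex hm
  have hle : (if d ≤ 2 ^ k * s then (2 : ℝ) ^ α * ((2 : ℝ) ^ (-α)) ^ k else 0) ≤
      ∑ k ∈ Finset.range (m + 1),
        if d ≤ 2 ^ k * s then (2 : ℝ) ^ α * ((2 : ℝ) ^ (-α)) ^ k else 0 :=
    Finset.single_le_sum
      (f := fun k : ℕ => if d ≤ 2 ^ k * s then (2 : ℝ) ^ α * ((2 : ℝ) ^ (-α)) ^ k else 0)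
      (fun k _ => by split_ifs <;> positivity) (Finset.mem_range.2 (by omega))
  refine le_trans ?_ hle
  rw [if_pos hkd]
  rcases Nat.eq_zero_or_pos k with h0 | hpos
  · rw [h0, pow_zero, mul_one]
    exact (wt_le_one hα hs).trans (Real.one_le_rpow (by norm_num) hα)
  · have hlt : 2 ^ (k - 1) * s < d := by
      have := Nat.find_min hex (m := k - 1) (by omega)
      exact not_le.1 this
    have h2 : (2 : ℝ) ^ α * ((2 : ℝ) ^ (-α)) ^ k = ((2 : ℝ) ^ (k - 1)) ^ (-α) := by
      obtain ⟨j, hj⟩ : ∃ j, k = j + 1 := ⟨k - 1, by omega⟩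
      rw [hj, Nat.add_sub_cancel, pow_succ, ← mul_assoc, mul_comm ((2 : ℝ) ^ α), mul_assoc,
        ← Real.rpow_add (by norm_num), add_neg_cancel, Real.rpow_zero, mul_one,
        ← Real.rpow_natCast, ← Real.rpow_natCast, ← Real.rpow_mul (by norm_num),
        ← Real.rpow_mul (by norm_num), mul_comm]
    rw [h2]
    have hsd : s < d := lt_of_le_of_lt
      (le_mul_of_one_le_left hs.le (one_le_pow₀ (by norm_num))) hlt
    rw [wt, if_neg (not_le.2 hsd)]
    exact Real.rpow_le_rpow_of_nonpos (by positivity) ((le_div_iff₀ hs).2 hlt.le) (by linarith)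

/-- The constant in the bound on sums of path losses. -/
noncomputable def lossConst (α : ℝ) : ℝ := 2 ^ α / (1 - 2 ^ (2 - α))

theorem two_rpow_lt_one {α : ℝ} (hα : 2 < α) : (2 : ℝ) ^ (2 - α) < 1 :=
  Real.rpow_lt_one_of_one_lt_of_neg (by norm_num) (by linarith)

theorem lossConst_pos {α : ℝ} (hα : 2 < α) : 0 < lossConst α :=
  div_pos (by positivity) (sub_pos.2 (two_rpow_lt_one hα))

/-- The disk of scale `2 ^ k` contains at most `K * 4 ^ k * D ^ 2` nodes, each contributing `2 ^ α *
2 ^ (-α * k)`. The resulting geometric series has ratio `2 ^ (2 - α)`, which is where `α > 2`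
enters. -/
theorem Network.Spread.sum_wt_le {N n : ℕ} {p : SINRParams} {net : Network N n} {K : ℝ}
    {X : Finset (Fin n)} (h : Network.Spread p net K X) (hK : 0 ≤ K) (x : Plane) {D : ℝ}
    (hD : 1 ≤ D) :
    ∑ w ∈ X, wt p.α (D * p.radius) (dist (net.pos w) x) ≤ lossConst p.α * (K * D ^ 2) := by
  classical
  have hα := p.two_lt_α
  have hs : 0 < D * p.radius := mul_pos (by linarith) p.radius_pos
  -- Any scale that covers the finite set `X` will do; `m` disappears when the geometric sum is
  -- bounded by the infinite series.
  obtain ⟨m, hm⟩ : ∃ m : ℕ, ∀ w ∈ X, dist (net.pos w) x ≤ 2 ^ m * (D * p.radius) := by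
    obtain ⟨m, hm⟩ := pow_unbounded_of_one_lt
      ((∑ w ∈ X, dist (net.pos w) x) / (D * p.radius)) (one_lt_two (α := ℝ))
    refine ⟨m, fun w hw => ?_⟩
    rw [div_lt_iff₀ hs] at hm
    exact (Finset.single_le_sum (f := fun w => dist (net.pos w) x)
      (fun _ _ => dist_nonneg) hw).trans hm.le
  have hq : (2 : ℝ) ^ (-p.α) * 4 = 2 ^ (2 - p.α) := by
    rw [show (2 : ℝ) - p.α = -p.α + 2 by ring, Real.rpow_add (by norm_num)]
    norm_num
  calc ∑ w ∈ X, wt p.α (D * p.radius) (dist (net.pos w) x)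
      ≤ ∑ w ∈ X, ∑ k ∈ Finset.range (m + 1),
          (if dist (net.pos w) x ≤ 2 ^ k * (D * p.radius) then
            (2 : ℝ) ^ p.α * ((2 : ℝ) ^ (-p.α)) ^ k else 0) :=
        Finset.sum_le_sum fun w hw => wt_le_sum (by linarith) hs (hm w hw)
    _ = ∑ k ∈ Finset.range (m + 1),
          ((X.filter fun w => dist (net.pos w) x ≤ (2 ^ k * D) * p.radius).card : ℝ) *
            ((2 : ℝ) ^ p.α * ((2 : ℝ) ^ (-p.α)) ^ k) := by
        rw [Finset.sum_comm]
        refine Finset.sum_congr rfl fun k _ => ?_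
        rw [← Finset.sum_filter, Finset.sum_const, nsmul_eq_mul]
        simp only [mul_assoc]
    _ ≤ ∑ k ∈ Finset.range (m + 1), (K * (2 ^ k * D) ^ 2) *
            ((2 : ℝ) ^ p.α * ((2 : ℝ) ^ (-p.α)) ^ k) :=
        Finset.sum_le_sum fun k _ => mul_le_mul_of_nonneg_right
          (h x _ (one_le_mul_of_one_le_of_one_le (one_le_pow₀ (by norm_num)) hD)) (by positivity)
    _ = (2 ^ p.α * (K * D ^ 2)) * ∑ k ∈ Finset.range (m + 1), ((2 : ℝ) ^ (2 - p.α)) ^ k := by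
        rw [Finset.mul_sum]
        refine Finset.sum_congr rfl fun k _ => ?_
        rw [← hq, mul_pow, mul_pow, ← pow_mul, mul_comm k 2, pow_mul]
        norm_num
        ring
    _ ≤ (2 ^ p.α * (K * D ^ 2)) * (1 - 2 ^ (2 - p.α))⁻¹ := by
        refine mul_le_mul_of_nonneg_left ?_ (by positivity)
        rw [← tsum_geometric_of_lt_one (by positivity) (two_rpow_lt_one hα)]
        exact (summable_geometric_of_lt_one (by positivity) (two_rpow_lt_one hα)).sum_le_tsum _
          fun _ _ => by positivity
    _ = lossConst p.α * (K * D ^ 2) := by rw [lossConst]; ring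

/-! ### Reception -/

namespace Network

variable {N n : ℕ} {p : SINRParams} {net : Network N n}

theorem dist_pos {u v : Fin n} (h : u ≠ v) : 0 < dist (net.pos u) (net.pos v) :=
  _root_.dist_pos.2 fun e => h (net.pos_injective e)

theorem interference_nonneg (T : Finset (Fin n)) (u : Fin n) :
    0 ≤ ∑ w ∈ T, p.P * dist (net.pos w) (net.pos u) ^ (-p.α) :=
  Finset.sum_nonneg fun _ _ => mul_nonneg p.P_pos.le (Real.rpow_nonneg dist_nonneg _)

theorem Hears.add_interference_le {T : Finset (Fin n)} {v u : Fin n} (h : net.Hears p T v u) :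
    p.β * (p.ν + ∑ w ∈ T.erase v, p.P * dist (net.pos w) (net.pos u) ^ (-p.α)) ≤
      p.P * dist (net.pos v) (net.pos u) ^ (-p.α) :=
  (le_div_iff₀ (add_pos_of_pos_of_nonneg p.ν_pos (interference_nonneg _ _))).1 h.2.2.1

theorem Hears.ne {T : Finset (Fin n)} {v u : Fin n} (h : net.Hears p T v u) : v ≠ u :=
  fun e => h.2.1 (e ▸ h.1)

theorem Hears.adj {T : Finset (Fin n)} {v u : Fin n} (h : net.Hears p T v u) :
    (net.commGraph p).Adj v u := ⟨h.ne, h.2.2.2⟩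

theorem Hears.add_le {T : Finset (Fin n)} {v w u : Fin n} (h : net.Hears p T v u) (hw : w ∈ T)
    (hwv : w ≠ v) : p.ν + p.P * dist (net.pos w) (net.pos u) ^ (-p.α) ≤
      p.P * dist (net.pos v) (net.pos u) ^ (-p.α) := by
  have h1 := h.add_interference_le
  have h2 : p.P * dist (net.pos w) (net.pos u) ^ (-p.α) ≤
      ∑ w ∈ T.erase v, p.P * dist (net.pos w) (net.pos u) ^ (-p.α) :=
    Finset.single_le_sum (f := fun w => p.P * dist (net.pos w) (net.pos u) ^ (-p.α))
      (fun _ _ => mul_nonneg p.P_pos.le (Real.rpow_nonneg dist_nonneg _))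
      (Finset.mem_erase.2 ⟨hwv, hw⟩)
  have h3 := interference_nonneg (p := p) (net := net) (T.erase v) u
  nlinarith [p.one_le_β, p.ν_pos]

/-- Since `β ≥ 1`, a received signal exceeds every other signal by at least the noise, so two
transmitters cannot both be received. -/
theorem Hears.unique {T : Finset (Fin n)} {v w u : Fin n} (h : net.Hears p T v u)
    (h' : net.Hears p T w u) : v = w := by
  by_contra hne
  linarith [h.add_le h'.1 (Ne.symm hne), h'.add_le h.1 hne, p.ν_pos]

theorem receive_eq {μ : Type} {tx : Fin n → Option μ} {v u : Fin n}
    (h : net.Hears p (Finset.univ.filter fun w => (tx w).isSome) v u) :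
    net.receive p tx u = tx v := by
  have hex : ∃ v, net.Hears p (Finset.univ.filter fun w => (tx w).isSome) v u := ⟨v, h⟩
  rw [receive, dif_pos hex]
  exact congrArg tx (hex.choose_spec.unique h)

theorem exists_of_receive_eq_some {μ : Type} {tx : Fin n → Option μ} {u : Fin n} {m : μ}
    (h : net.receive p tx u = some m) : ∃ v, tx v = some m ∧ (net.commGraph p).Adj v u := by
  rw [receive] at h
  split_ifs at h with hex
  exact ⟨_, h, hex.choose_spec.adj⟩

variable (p net) in
/-- In some round of an execution of `F`, the node `u` receives from `v`, whichever other nodes of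
`X` take part in the execution. -/
def Selects (F : List (Finset (Fin N))) (X : Finset (Fin n)) (v u : Fin n) : Prop :=
  ∃ i < F.length, fires F (net.name v) i ∧ ∀ T : Finset (Fin n), T ⊆ X →
    (∀ w ∈ T, fires F (net.name w) i) → v ∈ T → net.Hears p T v u

end Network

/-- The interference tolerated at the connectivity radius, relative to the signal. -/
noncomputable def SINRParams.tolerance (p : SINRParams) : ℝ := (1 - (1 - p.ε) ^ p.α) / p.β

theorem SINRParams.tolerance_pos (p : SINRParams) : 0 < p.tolerance :=
  div_pos (sub_pos.2 (Real.rpow_lt_one (sub_pos.2 p.ε_lt_one).le (by linarith [p.ε_pos])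
    (by linarith [p.two_lt_α]))) (by linarith [p.one_le_β])

/-- The signal at distance `range` is exactly `ν * β`, so at the connectivity radius it is larger by
the factor `(1 - ε) ^ (-α)`. The tolerance is defined as what this gain leaves for interference, so
equality holds. -/
theorem SINRParams.threshold_le (p : SINRParams) :
    p.β * (p.ν + p.P * p.radius ^ (-p.α) * p.tolerance) ≤ p.P * p.radius ^ (-p.α) := by
  have hβ : 0 < p.β := by linarith [p.one_le_β]
  have hε : 0 < 1 - p.ε := sub_pos.2 p.ε_lt_one
  have hr : p.range ^ (-p.α) = p.ν * p.β / p.P := by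
    rw [range, ← Real.rpow_mul (div_pos p.P_pos (mul_pos p.ν_pos hβ)).le, one_div, mul_neg,
      inv_mul_cancel₀ (by linarith [p.two_lt_α]), Real.rpow_neg_one, inv_div]
  have hs : p.P * p.radius ^ (-p.α) = p.ν * p.β * ((1 - p.ε) ^ p.α)⁻¹ := by
    rw [radius, Real.mul_rpow hε.le p.range_pos.le, hr, Real.rpow_neg hε.le]
    field_simp [p.P_pos.ne']
  have hq : 0 < (1 - p.ε) ^ p.α := Real.rpow_pos_of_pos hε _
  rw [hs, tolerance]
  apply le_of_eq
  field_simp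
  ring

namespace Network

variable {N n : ℕ} {p : SINRParams} {net : Network N n}

theorem hears_of_interference_le {T : Finset (Fin n)} {v u : Fin n} (hv : v ∈ T) (hu : u ∉ T)
    (hvu : (net.commGraph p).Adj v u)
    (h : ∑ w ∈ T.erase v, p.P * dist (net.pos w) (net.pos u) ^ (-p.α) ≤
      p.P * p.radius ^ (-p.α) * p.tolerance) : net.Hears p T v u := by
  refine ⟨hv, hu, ?_, hvu.2⟩
  rw [sinr, le_div_iff₀ (add_pos_of_pos_of_nonneg p.ν_pos (interference_nonneg _ _))]
  calc p.β * (p.ν + ∑ w ∈ T.erase v, p.P * dist (net.pos w) (net.pos u) ^ (-p.α))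
      ≤ p.β * (p.ν + p.P * p.radius ^ (-p.α) * p.tolerance) :=
        mul_le_mul_of_nonneg_left (by linarith) (by linarith [p.one_le_β])
    _ ≤ p.P * p.radius ^ (-p.α) := p.threshold_le
    _ ≤ p.P * dist (net.pos v) (net.pos u) ^ (-p.α) :=
        mul_le_mul_of_nonneg_left (Real.rpow_le_rpow_of_nonpos (dist_pos hvu.1)
          (dist_le_of_adj hvu) (by linarith [p.two_lt_α])) p.P_pos.le

/-- The bound `M` is used twice: it limits the number of nodes of `X` in the disk of radius `D *
radius` around `u`, which the family has to silence, and it limits the interference of the nodes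
outside, which may transmit freely. -/
theorem selects_of_sum_wt_le {F : List (Finset (Fin N))} {x : ℕ} (hF : IsSSF F x)
    {X : Finset (Fin n)} {v u : Fin n} (hvu : (net.commGraph p).Adj v u)
    {D M : ℝ} (hD : 1 ≤ D)
    (hM : ∑ w ∈ X, wt p.α (D * p.radius) (dist (net.pos w) (net.pos u)) ≤ M)
    (hx : M + 2 ≤ x) (hθ : M * D ^ (-p.α) ≤ p.tolerance) : Selects p net F X v u := by
  classical
  have hs : 0 < D * p.radius := mul_pos (by linarith) p.radius_pos
  set Y : Finset (Fin n) := X.filter fun w => dist (net.pos w) (net.pos u) ≤ D * p.radius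
  have hY : (Y.card : ℝ) ≤ M := by
    refine le_trans ?_ hM
    calc (Y.card : ℝ) = ∑ w ∈ Y, wt p.α (D * p.radius) (dist (net.pos w) (net.pos u)) := by
          rw [Finset.card_eq_sum_ones, Nat.cast_sum]
          refine Finset.sum_congr rfl fun w hw => ?_
          rw [wt, if_pos (Finset.mem_filter.1 hw).2, Nat.cast_one]
      _ ≤ _ := Finset.sum_le_sum_of_subset_of_nonneg (Finset.filter_subset _ _)
          fun _ _ _ => wt_nonneg hs
  -- The receiver `u` is included so that it is silent when `v` is selected, as it may itself take
  -- part in the execution. The nodes `u` and `v` account for the `+ 2` in `hx`.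
  set Z : Finset (Fin N) := (insert u (insert v Y)).map net.name
  have hZ : Z.card ≤ x := by
    rw [Finset.card_map]
    have h1 := Finset.card_insert_le u (insert v Y)
    have h2 := Finset.card_insert_le v Y
    have h3 : Y.card + 2 ≤ x := by
      have : (Y.card : ℝ) + 2 ≤ x := by linarith
      exact_mod_cast this
    omega
  have hmem : ∀ w, net.name w ∈ Z ↔ w = u ∨ w = v ∨ w ∈ Y := fun w => by simp [Z]
  have hvZ : net.name v ∈ Z := (hmem v).2 (Or.inr (Or.inl rfl))
  obtain ⟨S, hS, hSZ⟩ := hF Z ⟨_, hvZ⟩ hZ _ hvZ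
  obtain ⟨i, hi, rfl⟩ := List.getElem_of_mem hS
  have hfire : ∀ w, fires F w i ↔ w ∈ F[i] := fun w => by
    rw [fires, Nat.mod_eq_of_lt hi, List.getD_eq_getElem _ _ hi]
  have hfv : ∀ w, fires F (net.name w) i → net.name w ∈ Z → w = v := fun w hw hwZ => by
    have : net.name w ∈ F[i] ∩ Z := Finset.mem_inter.2 ⟨(hfire _).1 hw, hwZ⟩
    rw [hSZ, Finset.mem_singleton] at this
    exact net.name.injective this
  refine ⟨i, hi, (hfire _).2 ?_, fun T hTX hT hvT => ?_⟩
  · have : net.name v ∈ F[i] ∩ Z := by rw [hSZ]; exact Finset.mem_singleton_self _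
    exact (Finset.mem_inter.1 this).1
  · refine hears_of_interference_le hvT (fun hu => ?_) hvu ?_
    · exact hvu.1 (hfv u (hT u hu) ((hmem u).2 (Or.inl rfl))).symm
    · have hfar : ∀ w ∈ T.erase v, p.P * dist (net.pos w) (net.pos u) ^ (-p.α) =
          p.P * (D * p.radius) ^ (-p.α) *
            wt p.α (D * p.radius) (dist (net.pos w) (net.pos u)) := by
        intro w hw
        obtain ⟨hwv, hwT⟩ := Finset.mem_erase.1 hw
        have hd : D * p.radius < dist (net.pos w) (net.pos u) := by
          by_contra! hle
          exact hwv (hfv w (hT w hwT) ((hmem w).2 (Or.inr (Or.inr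
            (Finset.mem_filter.2 ⟨hTX hwT, hle⟩)))))
        rw [wt, if_neg (not_le.2 hd), mul_assoc, ← Real.mul_rpow hs.le
          (div_nonneg dist_nonneg hs.le), mul_div_cancel₀ _ hs.ne']
      rw [Finset.sum_congr rfl hfar, ← Finset.mul_sum,
        Real.mul_rpow (by linarith) p.radius_pos.le]
      have hle : ∑ w ∈ T.erase v, wt p.α (D * p.radius) (dist (net.pos w) (net.pos u)) ≤ M :=
        (Finset.sum_le_sum_of_subset_of_nonneg ((Finset.erase_subset _ _).trans hTX)
          fun _ _ _ => wt_nonneg hs).trans hM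
      have hP : 0 ≤ p.P * p.radius ^ (-p.α) :=
        mul_nonneg p.P_pos.le (Real.rpow_nonneg p.radius_pos.le _)
      have hD' : 0 ≤ D ^ (-p.α) := Real.rpow_nonneg (by linarith) _
      calc p.P * (D ^ (-p.α) * p.radius ^ (-p.α)) * _
          = p.P * p.radius ^ (-p.α) * (_ * D ^ (-p.α)) := by ring
        _ ≤ p.P * p.radius ^ (-p.α) * (M * D ^ (-p.α)) :=
          mul_le_mul_of_nonneg_left (mul_le_mul_of_nonneg_right hle hD') hP
        _ ≤ _ := mul_le_mul_of_nonneg_left hθ hP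

end Network

open Filter Topology in
-- The expression is a multiple of `D ^ (2 - α)`, which tends to 0. All large `D` are covered
-- because the random classes need a `D` growing with `N`.
theorem exists_scale {α : ℝ} (hα : 2 < α) (a : ℝ) {θ : ℝ} (hθ : 0 < θ) :
    ∃ D₀ : ℝ, 1 ≤ D₀ ∧ ∀ D, D₀ ≤ D → a * D ^ 2 * D ^ (-α) ≤ θ := by
  have h : Tendsto (fun D : ℝ => a * D ^ (-(α - 2))) atTop (𝓝 (a * 0)) :=
    (tendsto_rpow_neg_atTop (by linarith)).const_mul a
  rw [mul_zero] at h
  obtain ⟨D₀, hD₀⟩ := eventually_atTop.1 (h.eventually_le_const hθ)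
  refine ⟨max 1 D₀, le_max_left _ _, fun D hD => ?_⟩
  have hD1 : 0 < D := by linarith [le_max_left 1 D₀]
  have e := hD₀ D ((le_max_right _ _).trans hD)
  rwa [show -(α - 2) = 2 + -α by ring, Real.rpow_add hD1, ← mul_assoc, Real.rpow_two] at e

/-- Selective families with a suitable constant parameter work on all sets of growth `K`. -/
theorem SINRParams.exists_selects_of_spread (p : SINRParams) {K : ℝ} (hK : 0 ≤ K) :
    ∃ c₀ : ℕ, 0 < c₀ ∧ ∀ {N n : ℕ} (net : Network N n) (F : List (Finset (Fin N))),
      IsSSF F c₀ → ∀ X : Finset (Fin n), Network.Spread p net K X →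
      ∀ v u, (net.commGraph p).Adj v u → Network.Selects p net F X v u := by
  obtain ⟨D, hD1, hD⟩ := exists_scale p.two_lt_α (lossConst p.α * K) p.tolerance_pos
  have hM : 0 ≤ lossConst p.α * (K * D ^ 2) :=
    mul_nonneg (lossConst_pos p.two_lt_α).le (by positivity)
  refine ⟨⌈lossConst p.α * (K * D ^ 2) + 2⌉₊, Nat.ceil_pos.2 (by linarith),
    fun net F hF X hX v u hvu => ?_⟩
  refine Network.selects_of_sum_wt_le hF hvu hD1 (hX.sum_wt_le hK _ hD1) (Nat.le_ceil _) ?_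
  have := hD D le_rfl
  rwa [mul_assoc (lossConst p.α)] at this

/-! ### Random choices -/

/-- Chernoff bound in counting form, by the exponential moment: `hm` says that the expected sum is
at most `m`, and the count is divided by the total number of outcomes only implicitly. -/
theorem card_large_sum_le {n : ℕ} {Ω : Type} [Fintype Ω] [Nonempty Ω] (A : Ω → Prop)
    [DecidablePred A] (a : Fin n → ℝ) (ha0 : ∀ w, 0 ≤ a w) (ha1 : ∀ w, a w ≤ 1) {m M : ℝ}
    (hm : (∑ w, a w) * (Finset.univ.filter A).card ≤ m * Fintype.card Ω) :
    ((Finset.univ.filter fun ω : Fin n → Ω =>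
      M ≤ ∑ w ∈ Finset.univ.filter fun w => A (ω w), a w).card : ℝ) ≤
      Real.exp (2 * m - M) * (Fintype.card Ω : ℝ) ^ n := by
  classical
  set q : ℝ := (Fintype.card Ω : ℝ)
  set k : ℝ := ((Finset.univ.filter A).card : ℝ)
  have hq : 0 < q := by simp only [q]; exact_mod_cast Fintype.card_pos
  have hk : 0 ≤ k := Nat.cast_nonneg _
  have h1 : ((Finset.univ.filter fun ω : Fin n → Ω =>
      M ≤ ∑ w ∈ Finset.univ.filter fun w => A (ω w), a w).card : ℝ) * Real.exp M ≤
      ∑ ω : Fin n → Ω, ∏ w, if A (ω w) then Real.exp (a w) else 1 := by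
    rw [← nsmul_eq_mul, ← Finset.sum_const]
    refine le_trans (Finset.sum_le_sum fun ω hω => ?_)
      (Finset.sum_le_sum_of_subset_of_nonneg (Finset.filter_subset _ _) fun ω _ _ => ?_)
    · rw [← Finset.prod_filter, ← Real.exp_sum]
      exact Real.exp_le_exp.2 (Finset.mem_filter.1 hω).2
    · exact Finset.prod_nonneg fun w _ => by split_ifs <;> positivity
  -- Independence: the sum over all outcomes of a product over the nodes factorizes.
  have h2 : ∑ ω : Fin n → Ω, ∏ w, (if A (ω w) then Real.exp (a w) else 1) =
      ∏ w, ∑ r : Ω, if A r then Real.exp (a w) else 1 := by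
    rw [Finset.prod_univ_sum, Fintype.piFinset_univ]
  have h3 : ∀ w, (∑ r : Ω, if A r then Real.exp (a w) else 1) ≤
      q * Real.exp (2 * a w * k / q) := by
    intro w
    have e1 : (∑ r : Ω, if A r then Real.exp (a w) else 1) =
        q + k * (Real.exp (a w) - 1) := by
      rw [Finset.sum_ite, Finset.sum_const, Finset.sum_const, nsmul_eq_mul, nsmul_eq_mul]
      have := Finset.card_filter_add_card_filter_not (s := (Finset.univ : Finset Ω)) A
      have h' : k + ((Finset.univ.filter fun r => ¬ A r).card : ℝ) = q := by
        simp only [k, q]; exact_mod_cast this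
      rw [← h']; ring
    -- Valid because the weights lie in `[0, 1]`; this is the origin of the factor 2 in the
    -- exponent.
    have e2 : Real.exp (a w) - 1 ≤ 2 * a w := by
      have := Real.abs_exp_sub_one_le (x := a w) (by rw [abs_of_nonneg (ha0 w)]; exact ha1 w)
      rw [abs_of_nonneg (ha0 w)] at this
      exact (le_abs_self _).trans this
    rw [e1]
    calc q + k * (Real.exp (a w) - 1) ≤ q + k * (2 * a w) := by gcongr
      _ = q * (2 * a w * k / q + 1) := by field_simp; ring
      _ ≤ _ := mul_le_mul_of_nonneg_left (Real.add_one_le_exp _) hq.le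
  have h4 : ∏ w, (∑ r : Ω, if A r then Real.exp (a w) else 1) ≤ q ^ n * Real.exp (2 * m) := by
    calc ∏ w, (∑ r : Ω, if A r then Real.exp (a w) else 1)
        ≤ ∏ w : Fin n, (q * Real.exp (2 * a w * k / q)) :=
          Finset.prod_le_prod (fun w _ => Finset.sum_nonneg fun r _ => by
            split_ifs <;> positivity) fun w _ => h3 w
      _ = q ^ n * Real.exp (∑ w, 2 * a w * k / q) := by
          rw [Finset.prod_mul_distrib, ← Real.exp_sum, Finset.prod_const, Finset.card_univ,
            Fintype.card_fin]
      _ ≤ _ := by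
          refine mul_le_mul_of_nonneg_left (Real.exp_le_exp.2 ?_) (by positivity)
          rw [← Finset.sum_div, ← Finset.sum_mul, ← Finset.mul_sum, div_le_iff₀ hq]
          linarith
  rw [h2] at h1
  have h5 := h1.trans h4
  rw [Real.exp_sub, div_mul_eq_mul_div, le_div_iff₀ (Real.exp_pos _), mul_comm (Real.exp (2 * m))]
  exact h5

theorem le_prob_of_card_le {Ω : Type} [Fintype Ω] [Nonempty Ω] {E : Ω → Prop} (Bad : Finset Ω)
    {δ : ℝ} (hB : (Bad.card : ℝ) ≤ δ * Fintype.card Ω) (h : ∀ ω ∉ Bad, E ω) :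
    1 - δ ≤ prob E := by
  classical
  have hq : (0 : ℝ) < Fintype.card Ω := by exact_mod_cast Fintype.card_pos
  rw [prob, le_div_iff₀ hq]
  have h1 : Fintype.card Ω ≤ Bad.card + Nat.card {ω // E ω} := by
    rw [Nat.card_eq_fintype_card, Fintype.card_subtype, ← Finset.card_univ]
    refine le_trans (Finset.card_le_card fun ω _ => ?_) (Finset.card_union_le _ _)
    by_cases hω : ω ∈ Bad
    · exact Finset.mem_union_left _ hω
    · exact Finset.mem_union_right _ (Finset.mem_filter.2 ⟨Finset.mem_univ _, h ω hω⟩)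
  have h2 : (Fintype.card Ω : ℝ) ≤ Bad.card + Nat.card {ω // E ω} := by exact_mod_cast h1
  linarith

/-- Since `e ≥ 2`, the number `e ^ (clog 2 N)` is at least `N`, hence at least `n`. -/
theorem exp_neg_mul_clog_le {N n : ℕ} (hn : 0 < n) (hnN : n ≤ N) (k : ℕ) :
    Real.exp (-(k * Nat.clog 2 N : ℝ)) ≤ 1 / (n : ℝ) ^ k := by
  have h1 : (n : ℝ) ≤ 2 ^ Nat.clog 2 N := by
    exact_mod_cast hnN.trans (Nat.le_pow_clog (by norm_num) N)
  have h2 : (2 : ℝ) ≤ Real.exp 1 := by linarith [Real.add_one_le_exp 1]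
  have hn' : (0 : ℝ) < n := by exact_mod_cast hn
  rw [Real.exp_neg, ← one_div]
  refine one_div_le_one_div_of_le (by positivity) ?_
  calc (n : ℝ) ^ k ≤ (Real.exp 1 ^ Nat.clog 2 N) ^ k :=
        pow_le_pow_left₀ hn'.le (h1.trans (pow_le_pow_left₀ (by norm_num) h2 _)) k
    _ = _ := by rw [← Real.exp_nat_mul, ← Real.exp_nat_mul, mul_one]

namespace Network

variable {N n : ℕ} {p : SINRParams} {net : Network N n}

theorem card_closedNeighbourhood_le (w : Fin n) (Y : Finset (Fin n))
    (hY : ∀ v ∈ Y, v = w ∨ (net.commGraph p).Adj w v) : Y.card ≤ net.maxDeg p + 1 := by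
  classical
  have h1 : ((net.commGraph p).neighborFinset w).card ≤ net.maxDeg p := by
    rw [SimpleGraph.card_neighborFinset_eq_degree]
    unfold maxDeg
    convert SimpleGraph.degree_le_maxDegree (net.commGraph p) w
  have h2 : Y ⊆ insert w ((net.commGraph p).neighborFinset w) := fun v hv => by
    rw [Finset.mem_insert, SimpleGraph.mem_neighborFinset]
    exact hY v hv
  exact (Finset.card_le_card h2).trans ((Finset.card_insert_le _ _).trans (by omega))

theorem exists_leader {I : Set (Fin n)} (hI : Maximal (net.commGraph p).IsIndepSet I)
    (v : Fin n) : v ∈ I ∨ ∃ w ∈ I, (net.commGraph p).Adj v w := by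
  by_contra! h
  have hins : (net.commGraph p).IsIndepSet (insert v I) := by
    rw [SimpleGraph.isIndepSet_iff, Set.pairwise_insert]
    exact ⟨hI.1, fun w hw _ => ⟨h.2 w hw, fun e => h.2 w hw e.symm⟩⟩
  exact h.1 (hI.2 hins (Set.subset_insert v I) (Set.mem_insert v I))

/-- By maximality every node lies in the closed neighbourhood of a leader, which has at most `Δ + 1`
nodes. -/
theorem spread_univ {I : Set (Fin n)} (hI : Maximal (net.commGraph p).IsIndepSet I) :
    Spread p net (81 * (net.maxDeg p + 1 : ℕ)) Finset.univ := by
  classical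
  refine spread_of_leaders hI.1
    (fun w => Finset.univ.filter fun v => v = w ∨ (net.commGraph p).Adj w v) (fun v _ => ?_)
    fun w _ => card_closedNeighbourhood_le w _ fun v hv => (Finset.mem_filter.1 hv).2
  have hr := p.radius_pos
  rcases exists_leader hI v with hv | ⟨w, hw, hvw⟩
  · exact ⟨v, hv, by simp, by rw [dist_self]; positivity⟩
  · exact ⟨w, hw, by simp [hvw.symm], by linarith [dist_le_of_adj hvw.symm]⟩

theorem maxDeg_pos (hn : 2 ≤ n) (hc : (net.commGraph p).Connected) : 1 ≤ net.maxDeg p := by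
  classical
  have : Nontrivial (Fin n) := Fin.nontrivial_iff_two_le.2 hn
  obtain ⟨v, hv⟩ := hc.preconnected.exists_adj_of_nontrivial ⟨0, by omega⟩
  have h := card_closedNeighbourhood_le (p := p) (net := net) ⟨0, by omega⟩ {⟨0, by omega⟩, v}
    (by simp [hv])
  rw [Finset.card_pair hv.1] at h
  omega

theorem maxDeg_lt (hn : 2 ≤ n) : net.maxDeg p < n := by
  classical
  have : Nonempty (Fin n) := ⟨⟨0, by omega⟩⟩
  unfold maxDeg
  have := SimpleGraph.maxDegree_lt_card_verts (net.commGraph p)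
  rw [Fintype.card_fin] at this
  convert this

end Network

/-- With high probability, every class of nodes with a common random number can execute a selective
family with parameter `O(log N ^ 3)`. -/
theorem SINRParams.exists_selects_random (p : SINRParams) (d : ℕ) :
    ∃ c₁ : ℕ, 0 < c₁ ∧ ∀ {N n : ℕ} (net : Network N n) (I : Set (Fin n)) (R : ℕ)
      (F : List (Finset (Fin N))), 2 ≤ n → (net.commGraph p).Connected →
      Maximal (net.commGraph p).IsIndepSet I → R = net.maxDeg p →
      IsSSF F (c₁ * Nat.clog 2 N ^ 3) →
      ∃ Bad : Finset (Fin n → Fin R × Fin R),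
        (Bad.card : ℝ) ≤ 1 / (n : ℝ) ^ d * Fintype.card (Fin n → Fin R × Fin R) ∧
        ∀ ω ∉ Bad, ∀ g v u, (net.commGraph p).Adj v u →
          Network.Selects p net F (Finset.univ.filter fun w => (ω w).1 = g) v u ∧
          Network.Selects p net F (Finset.univ.filter fun w => (ω w).2 = g) v u := by
  -- Here `162 = 2 * 81`, because `Δ + 1 ≤ 2 * Δ`.
  set b : ℝ := lossConst p.α * 162
  have hb : 0 < b := mul_pos (lossConst_pos p.two_lt_α) (by norm_num)
  -- In the Chernoff exponent the part `2 * b` cancels twice the expectation; the remainder yields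
  -- the failure probability `n ^ (-(d + 3))`.
  set a : ℝ := 2 * b + (d + 3)
  have ha : 0 < a := by positivity
  obtain ⟨D₀, hD1, hD₀⟩ := exists_scale p.two_lt_α a p.tolerance_pos
  set L : ℝ := D₀ ^ 2
  have hL : 1 ≤ L := one_le_pow₀ hD1
  refine ⟨⌈a * L⌉₊ + 2, by omega, ?_⟩
  intro N n net I R F hn hc hI hR hF
  classical
  have hnN : n ≤ N := by simpa using Fintype.card_le_of_embedding net.name
  have hl : 1 ≤ Nat.clog 2 N := Nat.clog_pos (by norm_num) (by omega)
  have hl' : (1 : ℝ) ≤ Nat.clog 2 N := by exact_mod_cast hl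
  have hexp := exp_neg_mul_clog_le (by omega : 0 < n) hnN (d + 3)
  generalize Nat.clog 2 N = l at hl hl' hexp hF
  -- The disk is enlarged until the bound on its expected weight is of order `log N`, enough for
  -- concentration. As `M = a * D ^ 2` with `a` fixed, the interference from outside remains
  -- tolerable.
  set D : ℝ := D₀ * √l
  have hDD : D₀ ≤ D := le_mul_of_one_le_right (by linarith) (Real.one_le_sqrt.2 hl')
  have hD : 1 ≤ D := hD1.trans hDD
  have hD2 : D ^ 2 = L * l := by simp only [D, L, mul_pow, Real.sq_sqrt (by linarith : (0:ℝ) ≤ l)]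
  have hΔ := Network.maxDeg_pos hn hc
  have hΔn := Network.maxDeg_lt (p := p) (net := net) hn
  rw [← hR] at hΔ hΔn
  have hR1 : (1 : ℝ) ≤ R := by exact_mod_cast hΔ
  have hRpos : NeZero R := ⟨by omega⟩
  set A : Fin n → Fin n → ℝ := fun u w =>
    wt p.α (D * p.radius) (dist (net.pos w) (net.pos u))
  have hs : 0 < D * p.radius := mul_pos (by linarith) p.radius_pos
  have hA0 : ∀ u w, 0 ≤ A u w := fun u w => wt_nonneg hs
  have hA1 : ∀ u w, A u w ≤ 1 := fun u w => wt_le_one (by linarith [p.two_lt_α]) hs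
  -- The total weight is proportional to `R = Δ`; a class, into which a node falls with probability
  -- `1 / R`, has expected weight at most `b * D ^ 2`.
  have hA : ∀ u, ∑ w, A u w ≤ b * (L * l) * R := by
    intro u
    have h1 := (Network.spread_univ hI).sum_wt_le (by positivity) (net.pos u) hD
    have h2 : ((net.maxDeg p + 1 : ℕ) : ℝ) ≤ 2 * R := by
      rw [← hR]; push_cast; linarith
    rw [hD2] at h1
    calc ∑ w, A u w ≤ lossConst p.α * (81 * ((net.maxDeg p + 1 : ℕ) : ℝ) * (L * l)) := h1
      _ ≤ lossConst p.α * (81 * (2 * R) * (L * l)) := by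
          have := (lossConst_pos p.two_lt_α).le
          gcongr
      _ = _ := by simp only [b]; ring
  set M : ℝ := a * (L * l)
  have hδ : Real.exp (2 * (b * (L * l)) - M) ≤ 1 / (n : ℝ) ^ (d + 3) := by
    refine le_trans (Real.exp_le_exp.2 ?_) hexp
    simp only [M, a]
    push_cast
    have h1 : (l : ℝ) ≤ L * l := le_mul_of_one_le_left (by linarith) hL
    nlinarith [mul_le_mul_of_nonneg_left h1 (by positivity : (0 : ℝ) ≤ d + 3)]
  set Ω := Fin n → Fin R × Fin R
  set B₁ : Fin n × Fin R → Finset Ω := fun q => Finset.univ.filter fun ω =>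
    M ≤ ∑ w ∈ Finset.univ.filter fun w => (ω w).1 = q.2, A q.1 w
  set B₂ : Fin n × Fin R → Finset Ω := fun q => Finset.univ.filter fun ω =>
    M ≤ ∑ w ∈ Finset.univ.filter fun w => (ω w).2 = q.2, A q.1 w
  have hcard : (Fintype.card Ω : ℝ) = (Fintype.card (Fin R × Fin R) : ℝ) ^ n := by
    simp [Ω]
  have hB₁ : ∀ q, ((B₁ q).card : ℝ) ≤ 1 / (n : ℝ) ^ (d + 3) * Fintype.card Ω := by
    intro q
    have hc : (Finset.univ.filter fun r : Fin R × Fin R => r.1 = q.2).card = R := by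
      have : (Finset.univ.filter fun r : Fin R × Fin R => r.1 = q.2) =
          {q.2} ×ˢ Finset.univ := by ext ⟨x, y⟩; simp [eq_comm]
      rw [this]; simp
    rw [hcard]
    refine (card_large_sum_le (fun r : Fin R × Fin R => r.1 = q.2) (A q.1) (hA0 _) (hA1 _)
      (m := b * (L * l)) ?_).trans (mul_le_mul_of_nonneg_right hδ (by positivity))
    rw [hc, Fintype.card_prod, Fintype.card_fin, Nat.cast_mul, ← mul_assoc]
    exact mul_le_mul_of_nonneg_right (hA q.1) (by linarith)
  have hB₂ : ∀ q, ((B₂ q).card : ℝ) ≤ 1 / (n : ℝ) ^ (d + 3) * Fintype.card Ω := by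
    intro q
    have hc : (Finset.univ.filter fun r : Fin R × Fin R => r.2 = q.2).card = R := by
      have : (Finset.univ.filter fun r : Fin R × Fin R => r.2 = q.2) =
          Finset.univ ×ˢ {q.2} := by ext ⟨x, y⟩; simp [eq_comm]
      rw [this]; simp
    rw [hcard]
    refine (card_large_sum_le (fun r : Fin R × Fin R => r.2 = q.2) (A q.1) (hA0 _) (hA1 _)
      (m := b * (L * l)) ?_).trans (mul_le_mul_of_nonneg_right hδ (by positivity))
    rw [hc, Fintype.card_prod, Fintype.card_fin, Nat.cast_mul, ← mul_assoc]
    exact mul_le_mul_of_nonneg_right (hA q.1) (by linarith)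
  -- Union bound over receivers, classes and the two random numbers. There are `2 * n * R ≤ n ^ 3`
  -- events, which uses up the extra 3 in the exponent.
  refine ⟨Finset.univ.biUnion fun q => B₁ q ∪ B₂ q, ?_, ?_⟩
  · have hn0 : (2 : ℝ) ≤ n := by exact_mod_cast hn
    have h1 : ((Finset.univ.biUnion fun q => B₁ q ∪ B₂ q).card : ℝ) ≤
        ∑ q : Fin n × Fin R, 2 * (1 / (n : ℝ) ^ (d + 3) * Fintype.card Ω) := by
      refine le_trans (Nat.cast_le.2 Finset.card_biUnion_le) ?_
      rw [Nat.cast_sum]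
      refine Finset.sum_le_sum fun q _ => ?_
      refine le_trans (Nat.cast_le.2 (Finset.card_union_le _ _)) ?_
      rw [Nat.cast_add]
      linarith [hB₁ q, hB₂ q]
    refine h1.trans ?_
    rw [Finset.sum_const, Finset.card_univ, Fintype.card_prod, Fintype.card_fin,
      Fintype.card_fin, nsmul_eq_mul, Nat.cast_mul, ← mul_assoc, ← mul_assoc]
    refine mul_le_mul_of_nonneg_right ?_ (Nat.cast_nonneg _)
    have hRn : (R : ℝ) ≤ n := by exact_mod_cast hΔn.le
    rw [mul_one_div, div_le_div_iff₀ (by positivity) (by positivity), one_mul, pow_add]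
    have : (n : ℝ) * R * 2 ≤ n ^ 3 := by
      calc (n : ℝ) * R * 2 ≤ n * n * n := by gcongr
        _ = n ^ 3 := by ring
    calc (n : ℝ) * R * 2 * n ^ d ≤ n ^ 3 * n ^ d := by gcongr
      _ = _ := by ring
  · intro ω hω g v u hvu
    -- `M` is only linear in `l`, so the cube in the parameter of the family is more than needed.
    have hx : M + 2 ≤ (((⌈a * L⌉₊ + 2) * l ^ 3 : ℕ) : ℝ) := by
      push_cast
      have h1 := Nat.le_ceil (a * L)
      have h2 : (l : ℝ) ≤ (l : ℝ) ^ 3 := le_self_pow₀ hl' (by norm_num)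
      have h3 : (1 : ℝ) ≤ (l : ℝ) ^ 3 := hl'.trans h2
      have h4 : a * L * l ≤ (⌈a * L⌉₊ : ℝ) * l ^ 3 :=
        mul_le_mul h1 h2 (by linarith) (Nat.cast_nonneg _)
      simp only [M]
      linarith
    have hθ : M * D ^ (-p.α) ≤ p.tolerance := by
      have := hD₀ D hDD
      rwa [hD2] at this
    have hgood : ω ∉ B₁ (u, g) ∧ ω ∉ B₂ (u, g) := by
      constructor <;> intro h <;> refine hω (Finset.mem_biUnion.2 ⟨(u, g), Finset.mem_univ _, ?_⟩)
      · exact Finset.mem_union_left _ h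
      · exact Finset.mem_union_right _ h
    simp only [B₁, B₂, Finset.mem_filter, Finset.mem_univ, true_and, not_le] at hgood
    exact ⟨Network.selects_of_sum_wt_le hF hvu hD hgood.1.le hx hθ,
      Network.selects_of_sum_wt_le hF hvu hD hgood.2.le hx hθ⟩

/-! ### Lists of received items -/

theorem mem_heard {N len : ℕ} {γ : Type} {rcv : Fin len → Option (Msg N)}
    {f : ℕ → Msg N → Option γ} {x : γ} :
    x ∈ heard rcv f ↔ ∃ i m, rcv i = some m ∧ f i m = some x := by
  simp only [heard, List.mem_filterMap, List.mem_finRange, true_and, Option.bind_eq_some_iff]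

section FirstBy

variable {γ κ : Type} [DecidableEq κ] {key : γ → κ} {l : List γ}

theorem mem_of_mem_firstBy {x : γ} (h : x ∈ firstBy key l) : x ∈ l := by
  rw [firstBy, List.mem_reverse] at h
  exact List.mem_reverse.1 (List.pwFilter_subset _ h)

theorem exists_mem_firstBy {x : γ} (h : x ∈ l) : ∃ y ∈ firstBy key l, key y = key x := by
  by_contra! hcon
  have h1 := (List.forall_mem_pwFilter (R := fun a b => key a ≠ key b)
    (fun {a b c} hac => by
      by_contra! hh
      exact hac (hh.1.trans hh.2)) x l.reverse).1
    fun b hb => (hcon b (by rwa [firstBy, List.mem_reverse])).symm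
  exact h1 x (List.mem_reverse.2 h) rfl

theorem nodup_map_firstBy : ((firstBy key l).map key).Nodup := by
  rw [firstBy, List.map_reverse, List.nodup_reverse]
  exact List.Pairwise.map key (fun _ _ h => h) (List.pairwise_pwFilter l.reverse)

theorem nodup_firstBy : (firstBy key l).Nodup := nodup_map_firstBy.of_map key

theorem mem_firstBy_id [DecidableEq γ] {l : List γ} {x : γ} : x ∈ firstBy id l ↔ x ∈ l :=
  ⟨mem_of_mem_firstBy, fun h => by
    obtain ⟨y, hy, e⟩ := exists_mem_firstBy (key := id) h
    rwa [← show y = x from e]⟩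

end FirstBy

/-! ### Rounds of repeated executions -/

theorem fires_add {N : ℕ} {F : List (Finset (Fin N))} {v : Fin N} (k i : ℕ) :
    fires F v (k * F.length + i) ↔ fires F v i := by
  rw [fires, fires, Nat.add_comm, Nat.add_mul_mod_self_right]

theorem execution_div {len i : ℕ} (hi : i < len) (k : ℕ) : (k * len + i) / len = k := by
  rw [Nat.add_comm, Nat.add_mul_div_right _ _ (by omega), Nat.div_eq_of_lt hi, Nat.zero_add]

/-- Round `i` of block `j` of group `g` has the number `(g * b + j) * len + i`; the algorithm
recovers `g` and `j` from it by division. -/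
theorem group_div {len i b j : ℕ} (hi : i < len) (hj : j < b) (g : ℕ) :
    ((g * b + j) * len + i) / (b * len) = g := by
  rw [Nat.mul_comm b len, ← Nat.div_div_eq_div_mul, execution_div hi, execution_div hj]

theorem execution_lt {len i k m : ℕ} (hi : i < len) (hk : k < m) : k * len + i < m * len :=
  calc k * len + i < k * len + len := by omega
    _ = (k + 1) * len := by ring
    _ ≤ m * len := Nat.mul_le_mul_right _ hk

theorem group_lt {len i b j g R : ℕ} (hi : i < len) (hj : j < b) (hg : g < R) :
    (g * b + j) * len + i < b * len * R :=
  calc (g * b + j) * len + i < (R * b) * len := execution_lt hi (execution_lt hj hg)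
    _ = b * len * R := by ring

/-! ### Items received in a phase -/

section Reception

variable {N n : ℕ} {p : SINRParams} {net : Network N n} {γ σ : Type}

/-- The soundness half of every phase: it needs no selection, because only neighbours are ever
heard. -/
theorem exists_of_mem_heard {ph : Phase σ (Msg N)} {s : Fin n → σ} {u : Fin n}
    {f : ℕ → Msg N → Option γ} {x : γ}
    (h : x ∈ heard (fun i => net.receive p (fun v => ph.send (s v) i) u) f) :
    ∃ v i m, (net.commGraph p).Adj v u ∧ ph.send (s v) i = some m ∧ f i m = some x := by
  obtain ⟨i, m, hm, hx⟩ := mem_heard.1 h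
  obtain ⟨v, hv, hvu⟩ := Network.exists_of_receive_eq_some hm
  exact ⟨v, i, m, hvu, hv, hx⟩

/-- If a phase contains an execution of `F` by nodes of `X`, starting in round `k`, then what `v`
transmits in it is received. -/
theorem Network.Selects.exists_mem_heard {F : List (Finset (Fin N))} {X : Finset (Fin n)}
    {v u : Fin n} (h : Network.Selects p net F X v u) {ph : Phase σ (Msg N)} {s : Fin n → σ}
    {f : ℕ → Msg N → Option γ} {Q : γ → Prop} (k : ℕ)
    (hlen : ∀ i < F.length, k + i < ph.len)
    (hX : ∀ i (hi : i < F.length) w m, ph.send (s w) ⟨k + i, hlen i hi⟩ = some m →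
      w ∈ X ∧ fires F (net.name w) i)
    (hv : ∀ i (hi : i < F.length), fires F (net.name v) i →
      ∃ m x, ph.send (s v) ⟨k + i, hlen i hi⟩ = some m ∧ f (k + i) m = some x ∧ Q x) :
    ∃ x ∈ heard (fun i => net.receive p (fun v => ph.send (s v) i) u) f, Q x := by
  obtain ⟨i, hi, hfi, hT⟩ := h
  obtain ⟨m, x, hm, hx, hQ⟩ := hv i hi hfi
  have hX' : ∀ w ∈ Finset.univ.filter fun w => (ph.send (s w) ⟨k + i, hlen i hi⟩).isSome,
      w ∈ X ∧ fires F (net.name w) i := fun w hw => by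
    obtain ⟨m', hm'⟩ := Option.isSome_iff_exists.1 (Finset.mem_filter.1 hw).2
    exact hX i hi w m' hm'
  refine ⟨x, BareBones.mem_heard.2 ⟨⟨k + i, hlen i hi⟩, m, ?_, hx⟩, hQ⟩
  rw [← hm]
  refine Network.receive_eq (hT _ (fun w hw => (hX' w hw).1) (fun w hw => (hX' w hw).2) ?_)
  exact Finset.mem_filter.2 ⟨Finset.mem_univ _, by rw [hm]; rfl⟩

/-- The case of an item that does not depend on the round of reception. Items that contain the round
are only determined up to a property `Q`. -/
theorem Network.Selects.mem_heard {F : List (Finset (Fin N))} {X : Finset (Fin n)} {v u : Fin n}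
    (h : Network.Selects p net F X v u) {ph : Phase σ (Msg N)} {s : Fin n → σ}
    {f : ℕ → Msg N → Option γ} {x : γ} (k : ℕ)
    (hlen : ∀ i < F.length, k + i < ph.len)
    (hX : ∀ i (hi : i < F.length) w m, ph.send (s w) ⟨k + i, hlen i hi⟩ = some m →
      w ∈ X ∧ fires F (net.name w) i)
    (hv : ∀ i (hi : i < F.length), fires F (net.name v) i →
      ∃ m, ph.send (s v) ⟨k + i, hlen i hi⟩ = some m ∧ f (k + i) m = some x) :
    x ∈ heard (fun i => net.receive p (fun v => ph.send (s v) i) u) f := by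
  obtain ⟨_, hx, rfl⟩ := h.exists_mem_heard (Q := (· = x)) k hlen hX fun i hi hf => by
    obtain ⟨m, hm, hx⟩ := hv i hi hf
    exact ⟨m, x, hm, hx, rfl⟩
  exact hx

/-- A list of distinct names of nodes satisfying `P` is at most as long as the number of them. -/
theorem length_le_card_of_names {l : List (Fin N)} (hl : l.Nodup) (P : Fin n → Prop)
    [DecidablePred P] (h : ∀ x ∈ l, ∃ v, P v ∧ net.name v = x) :
    l.length ≤ (Finset.univ.filter P).card := by
  rw [← List.toFinset_card_of_nodup hl, ← Finset.card_map net.name]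
  refine Finset.card_le_card fun x hx => ?_
  obtain ⟨v, hv, e⟩ := h x (List.mem_toFinset.1 hx)
  exact Finset.mem_map.2 ⟨v, Finset.mem_filter.2 ⟨Finset.mem_univ _, hv⟩, e⟩

end Reception

/-! ### Exploration of the neighbourhood of the leaders -/

section Exploration

variable {N n : ℕ} {p : SINRParams} {net : Network N n} {I : Set (Fin n)} {t₁ t₂ : Fin n → ℕ}
  {s : Fin n → NodeState N} {F : List (Finset (Fin N))} {R : ℕ}

/-- Every node knows its name, whether it is a leader, and its random numbers. -/
structure Initialized (net : Network N n) (I : Set (Fin n)) (t₁ t₂ : Fin n → ℕ)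
    (s : Fin n → NodeState N) : Prop where
  name : ∀ v, (s v).name = net.name v
  leader : ∀ v, (s v).leader = true ↔ v ∈ I
  t₁ : ∀ v, (s v).t₁ = t₁ v
  t₂ : ∀ v, (s v).t₂ = t₂ v

/-- The phase does not change what the nodes know at the start. -/
def Phase.KeepsIdentity (ph : Phase (NodeState N) (Msg N)) : Prop :=
  ∀ s rcv, (ph.update s rcv).name = s.name ∧ (ph.update s rcv).leader = s.leader ∧
    (ph.update s rcv).t₁ = s.t₁ ∧ (ph.update s rcv).t₂ = s.t₂

theorem Initialized.exec (hs : Initialized net I t₁ t₂ s) {ph : Phase (NodeState N) (Msg N)}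
    (h : ph.KeepsIdentity) : Initialized net I t₁ t₂ (ph.exec p net s) where
  name v := (h _ _).1.trans (hs.name v)
  leader v := by rw [← hs.leader v]; exact iff_of_eq (congrArg (· = true) (h _ _).2.1)
  t₁ v := (h _ _).2.2.1.trans (hs.t₁ v)
  t₂ v := (h _ _).2.2.2.trans (hs.t₂ v)

theorem learnLeaders_keepsIdentity : (learnLeaders F).KeepsIdentity := fun s rcv => by
  simp only [learnLeaders]; split_ifs <;> simp

theorem exchangeLeaders_keepsIdentity : (exchangeLeaders F R).KeepsIdentity := fun s rcv => by
  simp [exchangeLeaders]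

theorem collectRoutes_keepsIdentity : (collectRoutes F R).KeepsIdentity := fun s rcv => by
  simp only [collectRoutes]; split_ifs <;> simp

theorem informFirst_keepsIdentity : (informFirst F).KeepsIdentity := fun s rcv => by
  simp [informFirst]

theorem informSecond_keepsIdentity : (informSecond F).KeepsIdentity := fun s rcv => by
  simp [informSecond]

theorem learnNeighbours_keepsIdentity : (learnNeighbours F).KeepsIdentity := fun s rcv => by
  simp only [learnNeighbours]; split_ifs <;> simp

theorem chooseMaster_keepsIdentity : (chooseMaster F).KeepsIdentity := fun s rcv => by
  simp only [chooseMaster]; split_ifs <;> simp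

theorem collectSlaves_keepsIdentity : (collectSlaves F R).KeepsIdentity := fun s rcv => by
  simp only [collectSlaves]; split_ifs <;> simp

theorem acknowledge_keepsIdentity : (acknowledge F R).KeepsIdentity := fun s rcv => by
  simp only [acknowledge]; split_ifs <;> simp

/-- Every node that is no leader knows the neighbouring leaders. -/
def OneHopKnown (p : SINRParams) (net : Network N n) (I : Set (Fin n))
    (s : Fin n → NodeState N) : Prop :=
  ∀ v ∉ I, (s v).oneHop.Nodup ∧
    ∀ x, x ∈ (s v).oneHop ↔ ∃ l ∈ I, (net.commGraph p).Adj v l ∧ net.name l = x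

theorem length_le_six_of_leaders (hI : (net.commGraph p).IsIndepSet I) {v : Fin n}
    {l : List (Fin N)} (hl : l.Nodup)
    (h : ∀ x ∈ l, ∃ w ∈ I, (net.commGraph p).Adj v w ∧ net.name w = x) : l.length ≤ 6 := by
  classical
  refine (length_le_card_of_names (net := net) hl (fun w => w ∈ I ∧ (net.commGraph p).Adj v w)
    fun x hx => ?_).trans (Network.card_adjacent_leaders_le hI v _ fun w hw =>
      (Finset.mem_filter.1 hw).2)
  obtain ⟨w, hw, hvw, e⟩ := h x hx
  exact ⟨w, ⟨hw, hvw⟩, e⟩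

/-- For `r = 2` and `r = 3` the bound is 25 and 49. Together with the bound 6 for adjacent leaders,
it shows that the truncations in the algorithm cut off nothing. -/
theorem length_le_of_leaders (hI : (net.commGraph p).IsIndepSet I) {v : Fin n} (r : ℕ)
    {l : List (Fin N)} (hl : l.Nodup)
    (h : ∀ x ∈ l, ∃ w ∈ I, dist (net.pos v) (net.pos w) ≤ r * p.radius ∧ net.name w = x) :
    l.length ≤ (2 * r + 1) ^ 2 := by
  classical
  refine (length_le_card_of_names (net := net) hl
    (fun w => w ∈ I ∧ dist (net.pos w) (net.pos v) ≤ r * p.radius) fun x hx => ?_).trans ?_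
  · obtain ⟨w, hw, hvw, e⟩ := h x hx
    exact ⟨w, ⟨hw, by rwa [dist_comm]⟩, e⟩
  · have := Network.card_leaders_le hI (net.pos v) (R := r) (Nat.cast_nonneg r)
      (Finset.univ.filter fun w => w ∈ I ∧ dist (net.pos w) (net.pos v) ≤ r * p.radius)
      fun w hw => (Finset.mem_filter.1 hw).2
    exact_mod_cast this

theorem learnLeaders_oneHopKnown (hs : Initialized net I t₁ t₂ s)
    (hI : (net.commGraph p).IsIndepSet I) {X : Finset (Fin n)} (hX : ∀ v ∈ I, v ∈ X)
    (hsel : ∀ v u, (net.commGraph p).Adj v u → Network.Selects p net F X v u) :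
    OneHopKnown p net I ((learnLeaders F).exec p net s) := by
  intro v hv
  have hl : ¬ (s v).leader = true := fun h => hv ((hs.leader v).1 h)
  set l := heard (fun i => net.receive p (fun v => (learnLeaders F).send (s v) i) v) helloName
    with hl_def
  have e : ((learnLeaders F).exec p net s v).oneHop = (firstBy id l).take 25 := by
    simp only [Phase.exec, learnLeaders, hl, if_false, Bool.false_eq_true, hl_def]
  have hmem : ∀ x, x ∈ firstBy id l ↔ ∃ w ∈ I, (net.commGraph p).Adj v w ∧ net.name w = x := by
    intro x
    rw [mem_firstBy_id]
    constructor
    · intro hx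
      obtain ⟨w, i, m, hwv, hm, hfx⟩ := exists_of_mem_heard hx
      simp only [learnLeaders, Option.ite_none_right_eq_some, Option.some.injEq] at hm
      obtain ⟨⟨hw, -⟩, rfl⟩ := hm
      simp only [helloName, Option.some.injEq, hs.name] at hfx
      exact ⟨w, (hs.leader w).1 hw, hwv.symm, hfx⟩
    · rintro ⟨w, hw, hvw, rfl⟩
      refine (hsel w v hvw.symm).mem_heard 0 (fun i hi => by simpa [learnLeaders] using hi) ?_ ?_
      · intro i hi w m hm
        simp only [learnLeaders, Option.ite_none_right_eq_some, hs.name, hs.leader,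
          Nat.zero_add] at hm
        exact ⟨hX w hm.1.1, hm.1.2⟩
      · intro i hi hf
        simp only [learnLeaders, hs.name, hs.leader, Nat.zero_add, hw, hf, and_self, if_true,
          Option.some.injEq, exists_eq_left', helloName]
  have hnd : (firstBy id l).Nodup := nodup_firstBy
  have hlen := length_le_six_of_leaders hI hnd fun x hx => (hmem x).1 hx
  -- At most six leaders are adjacent to `v`, so the truncation to 25 is vacuous.
  rw [e, List.take_of_length_le (by omega)]
  exact ⟨hnd, hmem⟩

/-- Every node that is no leader knows the leaders at distance two. -/
structure TwoHopKnown (p : SINRParams) (net : Network N n) (I : Set (Fin n))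
    (s : Fin n → NodeState N) : Prop where
  nodup : ∀ v ∉ I, ((s v).twoHop.map fun e => e.1).Nodup
  sound : ∀ v ∉ I, ∀ e ∈ (s v).twoHop, e.1 ∉ (s v).oneHop ∧ ∃ g ∉ I, ∃ l ∈ I,
    (net.commGraph p).Adj v g ∧ (net.commGraph p).Adj g l ∧ net.name g = e.2.1 ∧
      net.name l = e.1
  complete : ∀ v ∉ I, ∀ g ∉ I, ∀ l ∈ I, (net.commGraph p).Adj v g → (net.commGraph p).Adj g l →
    ¬ (net.commGraph p).Adj v l → ∃ e ∈ (s v).twoHop, e.1 = net.name l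

theorem OneHopKnown.exchangeLeaders (h : OneHopKnown p net I s) :
    OneHopKnown p net I ((exchangeLeaders F R).exec p net s) := h

theorem exchangeLeaders_twoHopKnown (hs : Initialized net I t₁ t₂ s)
    (hI : (net.commGraph p).IsIndepSet I) (h1 : OneHopKnown p net I s) (hR : ∀ v, t₁ v < R)
    (hsel : ∀ v u, (net.commGraph p).Adj v u →
      Network.Selects p net F (Finset.univ.filter fun w => t₁ w = t₁ v) v u) :
    TwoHopKnown p net I ((exchangeLeaders F R).exec p net s) := by
  have hs' : ∀ v (hv : v ∉ I), ¬ (s v).leader = true := fun v hv h => hv ((hs.leader v).1 h)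
  refine ⟨fun v hv => nodup_map_firstBy, fun v hv e he => ?_, fun v hv g hg l hl hvg hgl hvl => ?_⟩
  · obtain ⟨w, i, m, hwv, hm, hfx⟩ := exists_of_mem_heard (mem_of_mem_firstBy he)
    simp only [BareBones.exchangeLeaders, Option.ite_none_right_eq_some, Option.map_eq_some_iff,
      hs.name, hs.leader] at hm
    obtain ⟨⟨hw, -, -⟩, x, hx, rfl⟩ := hm
    simp only [Option.ite_none_left_eq_some, Option.some.injEq] at hfx
    obtain ⟨hxv, rfl⟩ := hfx
    obtain ⟨l, hl, hwl, e⟩ := ((h1 w hw).2 x).1 (List.mem_of_getElem? hx)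
    exact ⟨hxv, w, hw, l, hl, hwv.symm, hwl, rfl, e⟩
  · have hx : net.name l ∈ (s g).oneHop := ((h1 g hg).2 _).2 ⟨l, hl, hgl, rfl⟩
    -- The place of the leader on the list of `g` is the number of the block in which `g` announces
    -- it.
    obtain ⟨j, hj, hjx⟩ := List.getElem_of_mem hx
    have hlen := length_le_six_of_leaders hI (h1 g hg).1 fun x hx => ((h1 g hg).2 x).1 hx
    have hj25 : j < 25 := by omega
    have hxv : net.name l ∉ (s v).oneHop := fun hmem => by
      obtain ⟨l', -, hvl', e⟩ := ((h1 v hv).2 _).1 hmem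
      exact hvl (net.name.injective e ▸ hvl')
    have key : ∃ x ∈ heard (fun i => net.receive p
        (fun v => (BareBones.exchangeLeaders F R).send (s v) i) v)
        (fun i m => match m with
          | .near g u => if u ∈ (s v).oneHop then none else some (u, g, i)
          | _ => none), x.1 = net.name l := by
      refine (hsel g v hvg.symm).exists_mem_heard (ph := BareBones.exchangeLeaders F R)
        (Q := fun x : Fin N × Fin N × ℕ => x.1 = net.name l)
        ((t₁ g * 25 + j) * F.length) (fun i hi => group_lt hi hj25 (hR g)) ?_ ?_
      · intro i hi w m hm
        simp only [BareBones.exchangeLeaders, Option.ite_none_right_eq_some, group_div hi hj25,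
          fires_add, hs.name, hs.t₁] at hm
        simp [hm.1.2.2, hm.1.2.1]
      · intro i hi hf
        simp [BareBones.exchangeLeaders, group_div hi hj25, execution_div hi, fires_add, hs.name,
          hs.t₁, hs' g hg, hf, Nat.mul_add_mod_of_lt hj25, hj, hjx, hxv]
    obtain ⟨x, hx1, hx2⟩ := key
    -- An earlier report of the same leader through another node may have been kept, so only the
    -- leader in the entry is known.
    obtain ⟨y, hy, e⟩ := exists_mem_firstBy (key := fun e : Fin N × Fin N × ℕ => e.1) hx1
    exact ⟨y, hy, e.trans hx2⟩

end Exploration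

/-! ### Routes between leaders -/

section Routes

variable {N n : ℕ} {p : SINRParams} {net : Network N n} {I : Set (Fin n)} {t₁ t₂ : Fin n → ℕ}
  {s : Fin n → NodeState N} {F : List (Finset (Fin N))} {R : ℕ}

theorem OneHopKnown.length_le (h : OneHopKnown p net I s) (hI : (net.commGraph p).IsIndepSet I)
    {v : Fin n} (hv : v ∉ I) : (s v).oneHop.length ≤ 6 :=
  length_le_six_of_leaders hI (h v hv).1 fun x hx => ((h v hv).2 x).1 hx

/-- The two lists are disjoint and name distinct leaders within two radii, so the packing bound 25
applies to both together. -/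
theorem TwoHopKnown.length_add_le (h2 : TwoHopKnown p net I s) (h1 : OneHopKnown p net I s)
    (hI : (net.commGraph p).IsIndepSet I) {v : Fin n} (hv : v ∉ I) :
    (s v).oneHop.length + (s v).twoHop.length ≤ 25 := by
  have hnd : ((s v).oneHop ++ (s v).twoHop.map fun e => e.1).Nodup := by
    refine List.Nodup.append (h1 v hv).1 (h2.nodup v hv) fun x hx hx' => ?_
    obtain ⟨e, he, rfl⟩ := List.mem_map.1 hx'
    exact (h2.sound v hv e he).1 hx
  have := length_le_of_leaders (net := net) (p := p) hI (v := v) 2 hnd fun x hx => by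
    rcases List.mem_append.1 hx with hx | hx
    · obtain ⟨l, hl, hvl, e⟩ := ((h1 v hv).2 x).1 hx
      refine ⟨l, hl, ?_, e⟩
      have := Network.dist_le_of_adj hvl
      have := p.radius_pos
      push_cast; linarith
    · obtain ⟨e, he, rfl⟩ := List.mem_map.1 hx
      obtain ⟨-, g, -, l, hl, hvg, hgl, -, e'⟩ := h2.sound v hv e he
      exact ⟨l, hl, by exact_mod_cast Network.dist_le_two_of_adj hvg hgl, e'⟩
  simpa using this

theorem TwoHopKnown.known_eq (h2 : TwoHopKnown p net I s) (h1 : OneHopKnown p net I s)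
    (hI : (net.commGraph p).IsIndepSet I) {v : Fin n} (hv : v ∉ I) :
    (s v).known = (s v).oneHop.map (fun u => Msg.near (s v).name u) ++
      (s v).twoHop.map (fun e => Msg.far (s v).name e.1 e.2.1 e.2.2) := by
  have := h2.length_add_le h1 hI hv
  exact List.take_of_length_le (by simp; omega)

/-- `r` is a route from the leader `w` to the leader `l`, known to its first connector. -/
def IsRoute (p : SINRParams) (net : Network N n) (I : Set (Fin n)) (s : Fin n → NodeState N)
    (w l : Fin n) : Route N → Prop
  | .one g _ => ∃ a ∉ I, net.name a = g ∧ (net.commGraph p).Adj w a ∧ (net.commGraph p).Adj a l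
  | .two g₁ g₂ _ f => ∃ a ∉ I, ∃ b ∉ I, net.name a = g₁ ∧ net.name b = g₂ ∧
      (net.commGraph p).Adj w a ∧ (net.commGraph p).Adj a b ∧ (net.commGraph p).Adj b l ∧
      (net.name l, g₂, f) ∈ (s a).twoHop

/-- Every leader knows a route to each leader at distance at most three. -/
structure RoutesKnown (p : SINRParams) (net : Network N n) (I : Set (Fin n))
    (s : Fin n → NodeState N) : Prop where
  nodup : ∀ w ∈ I, ((s w).routes.map fun e => e.1).Nodup
  length_le : ∀ w ∈ I, (s w).routes.length ≤ 121
  sound : ∀ w ∈ I, ∀ e ∈ (s w).routes, ∃ l ∈ I, net.name l = e.1 ∧ IsRoute p net I s w l e.2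
  complete : ∀ w ∈ I, ∀ l ∈ I, w ≠ l → ∀ a ∉ I, (net.commGraph p).Adj w a →
    ((net.commGraph p).Adj a l ∨
      ∃ b ∉ I, (net.commGraph p).Adj a b ∧ (net.commGraph p).Adj b l) →
    ∃ e ∈ (s w).routes, e.1 = net.name l

theorem collectRoutes_oneHop (v : Fin n) :
    ((collectRoutes F R).exec p net s v).oneHop = (s v).oneHop := by
  simp only [Phase.exec, collectRoutes]; split_ifs <;> rfl

theorem collectRoutes_twoHop (v : Fin n) :
    ((collectRoutes F R).exec p net s v).twoHop = (s v).twoHop := by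
  simp only [Phase.exec, collectRoutes]; split_ifs <;> rfl

theorem collectRoutes_conns (v : Fin n) :
    ((collectRoutes F R).exec p net s v).conns = (s v).conns := by
  simp only [Phase.exec, collectRoutes]; split_ifs <;> rfl

theorem OneHopKnown.congr {s' : Fin n → NodeState N} (h : OneHopKnown p net I s)
    (h1 : ∀ v, (s' v).oneHop = (s v).oneHop) : OneHopKnown p net I s' := fun v hv => by
  rw [h1]; exact h v hv

theorem TwoHopKnown.congr {s' : Fin n → NodeState N} (h : TwoHopKnown p net I s)
    (h1 : ∀ v, (s' v).oneHop = (s v).oneHop) (h2 : ∀ v, (s' v).twoHop = (s v).twoHop) :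
    TwoHopKnown p net I s' where
  nodup v hv := by rw [h2]; exact h.nodup v hv
  sound v hv := by rw [h1, h2]; exact h.sound v hv
  complete v hv := by rw [h2]; exact h.complete v hv

theorem IsRoute.dist_le {w l : Fin n} {r : Route N} (h : IsRoute p net I s w l r) :
    dist (net.pos w) (net.pos l) ≤ 3 * p.radius := by
  have := p.radius_pos
  cases r with
  | one g f =>
    obtain ⟨a, -, -, hwa, hal⟩ := h
    linarith [Network.dist_le_two_of_adj hwa hal]
  | two g₁ g₂ f₁ f₂ =>
    obtain ⟨a, -, b, -, -, -, hwa, hab, hbl, -⟩ := h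
    exact Network.dist_le_three_of_adj hwa hab hbl

/-- A leader hears from each neighbour all leaders at one or two hops from that neighbour. The
leaders reported are within three radii, so at most 49 routes arise and the limit 121 is not
reached. -/
theorem collectRoutes_routesKnown (hs : Initialized net I t₁ t₂ s)
    (hI : (net.commGraph p).IsIndepSet I) (h1 : OneHopKnown p net I s)
    (h2 : TwoHopKnown p net I s) (hR : ∀ v, t₁ v < R)
    (hsel : ∀ v u, (net.commGraph p).Adj v u →
      Network.Selects p net F (Finset.univ.filter fun w => t₁ w = t₁ v) v u) :
    RoutesKnown p net I ((collectRoutes F R).exec p net s) := by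
  set f : Fin n → ℕ → Msg N → Option (Fin N × Route N) := fun w i m =>
    match m with
    | .near g u => if u = (s w).name then none else some (u, Route.one g i)
    | .far g₁ u g₂ f => if u = (s w).name then none else some (u, Route.two g₁ g₂ i f)
    | _ => none with hf
  set l : Fin n → List (Fin N × Route N) := fun w =>
    heard (fun i => net.receive p (fun v => (collectRoutes F R).send (s v) i) w) (f w) with hl
  have hr : ∀ w ∈ I, ((collectRoutes F R).exec p net s w).routes =
      (firstBy (fun e => e.1) (l w)).take 121 := fun w hw =>
    congrArg NodeState.routes (if_pos ((hs.leader w).2 hw))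
  have hsound : ∀ w ∈ I, ∀ e ∈ l w, ∃ l ∈ I, net.name l = e.1 ∧ IsRoute p net I s w l e.2 := by
    intro w hw e he
    obtain ⟨a, i, m, haw, hm, hfx⟩ := exists_of_mem_heard he
    simp only [collectRoutes, Option.ite_none_right_eq_some, hs.leader] at hm
    obtain ⟨⟨ha, -, -⟩, hm⟩ := hm
    have hm' := List.mem_of_getElem? hm
    rw [h2.known_eq h1 hI ha, List.mem_append, List.mem_map, List.mem_map] at hm'
    rcases hm' with ⟨x, hx, rfl⟩ | ⟨x, hx, rfl⟩
    · simp only [hf, Option.ite_none_left_eq_some, Option.some.injEq] at hfx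
      obtain ⟨-, rfl⟩ := hfx
      obtain ⟨l, hl, hal, e⟩ := ((h1 a ha).2 x).1 hx
      exact ⟨l, hl, e, a, ha, (hs.name a).symm, haw.symm, hal⟩
    · simp only [hf, Option.ite_none_left_eq_some, Option.some.injEq] at hfx
      obtain ⟨-, rfl⟩ := hfx
      obtain ⟨-, b, hb, l, hl, hab, hbl, e, e'⟩ := h2.sound a ha x hx
      exact ⟨l, hl, e', a, ha, b, hb, (hs.name a).symm, e, haw.symm, hab, hbl, by
        rw [e']; exact hx⟩
  have hlen : ∀ w ∈ I, (firstBy (fun e => e.1) (l w)).length ≤ 49 := by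
    intro w hw
    have := length_le_of_leaders (net := net) (p := p) hI (v := w) 3
      (nodup_map_firstBy (key := fun e : Fin N × Route N => e.1) (l := l w)) fun x hx => by
        obtain ⟨e, he, rfl⟩ := List.mem_map.1 hx
        obtain ⟨l, hl, e', hr⟩ := hsound w hw e (mem_of_mem_firstBy he)
        exact ⟨l, hl, by exact_mod_cast hr.dist_le, e'⟩
    simpa using this
  have hr' : ∀ w ∈ I, ((collectRoutes F R).exec p net s w).routes =
      firstBy (fun e => e.1) (l w) := fun w hw => by
    rw [hr w hw, List.take_of_length_le ((hlen w hw).trans (by norm_num))]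
  refine ⟨fun w hw => ?_, fun w hw => ?_, fun w hw e he => ?_, fun w hw k hk hwk a ha hwa hak => ?_⟩
  · rw [hr' w hw]; exact nodup_map_firstBy
  · rw [hr' w hw]; exact (hlen w hw).trans (by norm_num)
  · rw [hr' w hw] at he
    obtain ⟨l, hl, e', hr⟩ := hsound w hw e (mem_of_mem_firstBy he)
    refine ⟨l, hl, e', ?_⟩
    cases h : e.2 with
    | one g f => rw [h] at hr; exact hr
    | two g₁ g₂ f₁ f₂ =>
      rw [h] at hr
      simp only [IsRoute, collectRoutes_twoHop] at hr ⊢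
      exact hr
  · rw [hr' w hw]
    have hne : net.name k ≠ net.name w := fun e => hwk (net.name.injective e).symm
    -- The neighbour `a` announces `k` as an adjacent leader if it is one, and otherwise through its
    -- two-hop entry.
    obtain ⟨m, hm, hfm⟩ : ∃ m ∈ (s a).known, ∀ i, ∃ x, f w i m = some x ∧ x.1 = net.name k := by
      rw [h2.known_eq h1 hI ha]
      by_cases hadj : (net.commGraph p).Adj a k
      · exact ⟨_, List.mem_append_left _ (List.mem_map.2
          ⟨net.name k, ((h1 a ha).2 _).2 ⟨k, hk, hadj, rfl⟩, rfl⟩), fun i =>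
          ⟨(net.name k, Route.one (s a).name i), by simp [hf, hs.name, hwk.symm], rfl⟩⟩
      · obtain ⟨b, hb, hab, hbk⟩ := hak.resolve_left hadj
        obtain ⟨e, he, e'⟩ := h2.complete a ha b hb k hk hab hbk hadj
        exact ⟨_, List.mem_append_right _ (List.mem_map.2 ⟨e, he, rfl⟩), fun i =>
          ⟨(e.1, Route.two (s a).name e.2.1 i e.2.2), by simp [hf, hs.name, e', hwk.symm], e'⟩⟩
    obtain ⟨j, hj, hjm⟩ := List.getElem_of_mem hm
    have hj49 : j < 49 := by
      have : (s a).known.length ≤ 49 := List.length_take_le _ _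
      omega
    have key : ∃ x ∈ l w, x.1 = net.name k := by
      refine (hsel a w hwa.symm).exists_mem_heard (ph := collectRoutes F R)
        (Q := fun x : Fin N × Route N => x.1 = net.name k)
        ((t₁ a * 49 + j) * F.length) (fun i hi => group_lt hi hj49 (hR a)) ?_ ?_
      · intro i hi w m hm
        simp only [collectRoutes, Option.ite_none_right_eq_some, group_div hi hj49,
          fires_add, hs.name, hs.t₁] at hm
        simp [hm.1.2.2, hm.1.2.1]
      · intro i hi hfi
        obtain ⟨x, hx, hx'⟩ := hfm ((t₁ a * 49 + j) * F.length + i)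
        refine ⟨m, x, ?_, hx, hx'⟩
        simp [collectRoutes, group_div hi hj49, execution_div hi, fires_add, hs.name,
          hs.t₁, hs.leader, ha, hfi, Nat.mul_add_mod_of_lt hj49, hj, hjm]
    obtain ⟨x, hx1, hx2⟩ := key
    obtain ⟨y, hy, e⟩ := exists_mem_firstBy (key := fun e : Fin N × Route N => e.1) hx1
    exact ⟨y, hy, e.trans hx2⟩

/-- The first connector of a route. -/
def Route.first : Route N → Fin N
  | .one g _ => g
  | .two g _ _ _ => g

/-- The connectors of a route. -/
def Route.nodes : Route N → Finset (Fin N)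
  | .one g _ => {g}
  | .two g₁ g₂ _ _ => {g₁, g₂}

theorem Route.card_nodes_le (r : Route N) : r.nodes.card ≤ 2 := by
  cases r with
  | one g f => simp [nodes]
  | two g₁ g₂ f₁ f₂ => exact Finset.card_le_two

theorem IsRoute.adj_first {w l v : Fin n} {r : Route N} (h : IsRoute p net I s w l r)
    (hv : r.first = net.name v) : v ∉ I ∧ (net.commGraph p).Adj w v := by
  cases r with
  | one g f =>
    obtain ⟨a, ha, e, hwa, hal⟩ := h
    obtain rfl := net.name.injective (e.trans hv)
    exact ⟨ha, hwa⟩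
  | two g₁ g₂ f₁ f₂ =>
    obtain ⟨a, ha, b, -, e, -, hwa, -⟩ := h
    obtain rfl := net.name.injective (e.trans hv)
    exact ⟨ha, hwa⟩

/-- The first connectors of the chosen routes know their role. -/
structure FirstInformed (net : Network N n) (I : Set (Fin n))
    (s : Fin n → NodeState N) : Prop where
  conns : ∀ v, (s v).conns ≠ [] ↔ ∃ w ∈ I, ∃ e ∈ (s w).routes, e.2.first = net.name v
  nodup : ∀ v, (s v).relays.Nodup
  relays : ∀ v x, x ∈ (s v).relays ↔ ∃ w ∈ I, net.name w = x.2.1 ∧ ∃ e ∈ (s w).routes,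
    e.1 = x.1 ∧ ∃ f, e.2 = .two (net.name v) x.2.2.1 f x.2.2.2

theorem informFirst_firstInformed (hs : Initialized net I t₁ t₂ s) (h3 : RoutesKnown p net I s)
    (hc : ∀ v, (s v).conns = []) {X : Finset (Fin n)} (hX : ∀ v ∈ I, v ∈ X)
    (hsel : ∀ v u, (net.commGraph p).Adj v u → Network.Selects p net F X v u) :
    FirstInformed net I ((informFirst F).exec p net s) := by
  have hsend : ∀ w i m, (informFirst F).send (s w) i = some m → w ∈ I ∧
      fires F (net.name w) i ∧ ∃ e ∈ (s w).routes, m = .assign (net.name w) e.1 e.2 := by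
    intro w i m hm
    simp only [informFirst, Option.ite_none_right_eq_some, Option.map_eq_some_iff,
      hs.name, hs.leader] at hm
    obtain ⟨⟨hw, hf⟩, e, he, rfl⟩ := hm
    exact ⟨hw, hf, e, List.mem_of_getElem? he, rfl⟩
  -- Delivery of an assignment to its first connector, for an arbitrary extraction function: it is
  -- used both for the connector records and for the relays.
  have hdel : ∀ {γ : Type} (f : ℕ → Msg N → Option γ) (x : γ) (w : Fin n), w ∈ I →
      ∀ e ∈ (s w).routes, ∀ v, e.2.first = net.name v →
      (∀ i, f i (.assign (net.name w) e.1 e.2) = some x) →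
      x ∈ heard (fun i => net.receive p (fun v => (informFirst F).send (s v) i) v) f := by
    intro γ f x w hw e he v hev hf
    obtain ⟨l, -, -, hr⟩ := h3.sound w hw e he
    obtain ⟨j, hj, hje⟩ := List.getElem_of_mem he
    have hj' : j < 121 := hj.trans_le (h3.length_le w hw)
    refine (hsel w v (hr.adj_first hev).2).mem_heard (ph := informFirst F) (j * F.length)
      (fun i hi => execution_lt hi hj') ?_ ?_
    · intro i hi a m hm
      obtain ⟨ha, hfa, -⟩ := hsend a _ m hm
      exact ⟨hX a ha, (fires_add _ _).1 hfa⟩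
    · intro i hi hfi
      exact ⟨_, by simp [informFirst, execution_div hi, fires_add, hs.name, hs.leader, hw, hfi,
        hj, hje], hf _⟩
  have hroutes : ∀ v, ((informFirst F).exec p net s v).routes = (s v).routes := fun v => rfl
  refine ⟨fun v => ?_, fun v => nodup_firstBy, fun v x => ?_⟩
  · have e : ((informFirst F).exec p net s v).conns = (s v).conns ++ _ := rfl
    rw [e, hc, List.nil_append]
    constructor
    · intro hne
      obtain ⟨x, hx⟩ := List.exists_mem_of_ne_nil _ hne
      rw [mem_firstBy_id] at hx
      obtain ⟨w, i, m, hwv, hm, hfx⟩ := exists_of_mem_heard hx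
      obtain ⟨hw, -, e, he, rfl⟩ := hsend w i m hm
      refine ⟨w, hw, e, he, ?_⟩
      rcases e with ⟨u, g | ⟨g₁, g₂, f₁, f₂⟩⟩
      · simp only [Option.ite_none_right_eq_some] at hfx
        exact hfx.1.trans (hs.name v)
      · simp only [Option.ite_none_right_eq_some] at hfx
        exact hfx.1.trans (hs.name v)
    · rintro ⟨w, hw, e, he, hev⟩
      have h := hdel (fun _ m =>
        match m with
        | .assign w u (.one g f) => if g = (s v).name then some (u, w, none, f) else none
        | .assign w u (.two g₁ g₂ f₁ _) =>
            if g₁ = (s v).name then some (u, w, some g₂, f₁) else none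
        | _ => none)
      rcases e with ⟨u, ⟨g, f⟩ | ⟨g₁, g₂, f₁, f₂⟩⟩
      · exact List.ne_nil_of_mem (mem_firstBy_id.2
          (h (u, net.name w, none, f) w hw _ he v hev fun i => if_pos (hev.trans (hs.name v).symm)))
      · exact List.ne_nil_of_mem (mem_firstBy_id.2 (h (u, net.name w, some g₂, f₁) w hw _ he v hev
          fun i => if_pos (hev.trans (hs.name v).symm)))
  · have e : ((informFirst F).exec p net s v).relays = firstBy id _ := rfl
    rw [e, mem_firstBy_id]
    constructor
    · intro hx
      obtain ⟨w, i, m, hwv, hm, hfx⟩ := exists_of_mem_heard hx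
      obtain ⟨hw, -, e, he, rfl⟩ := hsend w i m hm
      refine ⟨w, hw, ?_⟩
      rcases e with ⟨u, g | ⟨g₁, g₂, f₁, f₂⟩⟩
      · simp at hfx
      · simp only [Option.ite_none_right_eq_some, Option.some.injEq] at hfx
        obtain ⟨e, rfl⟩ := hfx
        exact ⟨rfl, _, he, rfl, f₁, by rw [e, hs.name]⟩
    · rintro ⟨w, hw, e1, e, he, e2, f, e3⟩
      obtain ⟨u, w', g₂, f₂⟩ := x
      obtain ⟨u', r⟩ := e
      simp only at e1 e2 e3
      subst e1 e2 e3
      exact hdel _ _ w hw _ he v rfl fun i => if_pos (hs.name v).symm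

/-- A relay is determined by the leader that requested it, adjacent to `v`, and by the two-hop entry
of `v` that it uses. Hence 121 executions are enough to transmit all relays. -/
theorem FirstInformed.length_relays_le (h4 : FirstInformed net I s)
    (hI : (net.commGraph p).IsIndepSet I) (h1 : OneHopKnown p net I s)
    (h2 : TwoHopKnown p net I s) (h3 : RoutesKnown p net I s) (v : Fin n) :
    (s v).relays.length ≤ 121 := by
  have hmem : ∀ x ∈ (s v).relays, v ∉ I ∧ x.2.1 ∈ (s v).oneHop ∧
      (x.1, x.2.2.1, x.2.2.2) ∈ (s v).twoHop := by
    intro x hx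
    obtain ⟨w, hw, e, r, hr, e1, f, e2⟩ := (h4.relays v x).1 hx
    obtain ⟨l, hl, e3, h⟩ := h3.sound w hw r hr
    rw [e2] at h
    obtain ⟨a, ha, b, hb, ea, eb, hwa, hab, hbl, ht⟩ := h
    obtain rfl := net.name.injective ea
    refine ⟨ha, ((h1 a ha).2 _).2 ⟨w, hw, hwa.symm, e⟩, ?_⟩
    rw [← e1, ← e3]
    exact ht
  rcases (s v).relays.eq_nil_or_concat with h0 | ⟨L, x, hL⟩
  · simp [h0]
  · have hv : v ∉ I := (hmem x (by simp [hL])).1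
    have hcard := Finset.card_le_card_of_injOn (s := (s v).relays.toFinset)
      (t := (s v).oneHop.toFinset ×ˢ (s v).twoHop.toFinset)
      (fun x => (x.2.1, x.1, x.2.2.1, x.2.2.2)) (fun x hx => by
        have := hmem x (List.mem_toFinset.1 hx)
        simp [this.2.1, this.2.2]) (fun x _ y _ e => by
        obtain ⟨x1, x2, x3, x4⟩ := x
        obtain ⟨y1, y2, y3, y4⟩ := y
        simp only [Prod.mk.injEq] at e ⊢
        tauto)
    rw [List.toFinset_card_of_nodup (h4.nodup v), Finset.card_product] at hcard
    have ha := h1.length_le hI hv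
    have hb := h2.length_add_le h1 hI hv
    have ha' := List.toFinset_card_le (s v).oneHop
    have hb' := List.toFinset_card_le (s v).twoHop
    refine hcard.trans ((Nat.mul_le_mul ha' hb').trans ?_)
    generalize (s v).oneHop.length = a at ha hb
    generalize (s v).twoHop.length = b at hb
    -- With `a ≤ 6` and `a + b ≤ 25` the product is at most `6 * 19 = 114`; for `a = 7` the limit
    -- 121 could be exceeded.
    interval_cases a <;> omega

/-- A node has connector records iff it is a connector of a chosen route. -/
theorem informSecond_conns (hs : Initialized net I t₁ t₂ s)
    (hI : (net.commGraph p).IsIndepSet I) (h1 : OneHopKnown p net I s)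
    (h2 : TwoHopKnown p net I s) (h3 : RoutesKnown p net I s) (h4 : FirstInformed net I s)
    {X : Finset (Fin n)} (hX : ∀ v, (s v).conns ≠ [] → v ∈ X)
    (hsel : ∀ v u, (net.commGraph p).Adj v u → Network.Selects p net F X v u) (v : Fin n) :
    ((informSecond F).exec p net s v).conns ≠ [] ↔
      ∃ w ∈ I, ∃ e ∈ (s w).routes, net.name v ∈ e.2.nodes := by
  -- Every sender of this phase is already a connector, hence belongs to `X`, for which selection is
  -- assumed.
  have hrelay : ∀ a, ∀ x ∈ (s a).relays, (s a).conns ≠ [] := by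
    intro a x hx
    obtain ⟨w, hw, -, e, he, -, f, e2⟩ := (h4.relays a x).1 hx
    exact (h4.conns a).2 ⟨w, hw, e, he, by rw [e2]; rfl⟩
  have hsend : ∀ a i m, (informSecond F).send (s a) i = some m →
      fires F (net.name a) i ∧ ∃ x ∈ (s a).relays,
        m = .relay (net.name a) x.2.2.1 x.1 x.2.1 x.2.2.2 := by
    intro a i m hm
    simp only [informSecond, Option.ite_none_right_eq_some, Option.map_eq_some_iff,
      hs.name] at hm
    obtain ⟨hf, e, he, rfl⟩ := hm
    exact ⟨hf, e, List.mem_of_getElem? he, rfl⟩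
  have e : ((informSecond F).exec p net s v).conns = (s v).conns ++ _ := rfl
  rw [e, Ne, List.append_eq_nil_iff, not_and_or]
  constructor
  · rintro (hne | hne)
    · obtain ⟨w, hw, e, he, hev⟩ := (h4.conns v).1 hne
      refine ⟨w, hw, e, he, ?_⟩
      rcases e with ⟨u, g | ⟨g₁, g₂, f₁, f₂⟩⟩
      · exact Finset.mem_singleton.2 hev.symm
      · exact Finset.mem_insert.2 (Or.inl hev.symm)
    · obtain ⟨x, hx⟩ := List.exists_mem_of_ne_nil _ hne
      rw [mem_firstBy_id] at hx
      obtain ⟨a, i, m, hav, hm, hfx⟩ := exists_of_mem_heard hx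
      obtain ⟨-, y, hy, rfl⟩ := hsend a i m hm
      simp only [Option.ite_none_right_eq_some] at hfx
      obtain ⟨w, hw, -, e, he, -, f, e2⟩ := (h4.relays a y).1 hy
      refine ⟨w, hw, e, he, ?_⟩
      rw [e2, ← hs.name v, ← hfx.1]
      exact Finset.mem_insert_of_mem (Finset.mem_singleton_self _)
  · rintro ⟨w, hw, ⟨u, r⟩, he, hv⟩
    cases r with
    | one g f => exact Or.inl ((h4.conns v).2 ⟨w, hw, _, he, (Finset.mem_singleton.1 hv).symm⟩)
    | two g₁ g₂ f₁ f₂ =>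
      rcases Finset.mem_insert.1 hv with h | h
      · exact Or.inl ((h4.conns v).2 ⟨w, hw, _, he, h.symm⟩)
      · right
        obtain rfl := (Finset.mem_singleton.1 h).symm
        obtain ⟨l, hl, -, a, -, b, -, rfl, eb, hwa, hab, hbl, -⟩ := h3.sound w hw _ he
        obtain rfl := net.name.injective eb
        have hx : (u, net.name w, net.name b, f₂) ∈ (s a).relays :=
          (h4.relays a _).2 ⟨w, hw, rfl, _, he, rfl, f₁, rfl⟩
        obtain ⟨j, hj, hjx⟩ := List.getElem_of_mem hx
        have hj' : j < 121 := hj.trans_le (h4.length_relays_le hI h1 h2 h3 a)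
        refine List.ne_nil_of_mem (a := (u, net.name w, some (net.name a), f₂))
          (mem_firstBy_id.2 ?_)
        refine (hsel a b hab).mem_heard (ph := informSecond F) (j * F.length)
          (fun i hi => execution_lt hi hj') ?_ ?_
        · intro i hi c m hm
          obtain ⟨hfc, y, hy, -⟩ := hsend c _ m hm
          exact ⟨hX c (hrelay c y hy), (fires_add _ _).1 hfc⟩
        · intro i hi hfi
          exact ⟨.relay (net.name a) (net.name b) u (net.name w) f₂, by
            simp [informSecond, execution_div hi, fires_add, hs.name, hfi, hj, hjx],
            if_pos (hs.name b).symm⟩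

end Routes

/-! ### Association of the other nodes with the backbone -/

section Association

variable {N n : ℕ} {p : SINRParams} {net : Network N n} {I : Set (Fin n)} {t₁ t₂ : Fin n → ℕ}
  {s : Fin n → NodeState N} {F : List (Finset (Fin N))} {R Δ : ℕ} {H : Finset (Fin n)}

/-- The phase does not change the backbone. -/
def Phase.KeepsBackbone (ph : Phase (NodeState N) (Msg N)) : Prop :=
  ∀ s rcv, (ph.update s rcv).inBackbone ↔ s.inBackbone

theorem learnNeighbours_keepsBackbone : (learnNeighbours F).KeepsBackbone := fun s rcv => by
  simp only [learnNeighbours]; split_ifs <;> rfl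

theorem chooseMaster_keepsBackbone : (chooseMaster F).KeepsBackbone := fun s rcv => by
  simp only [chooseMaster]; split_ifs <;> rfl

theorem collectSlaves_keepsBackbone : (collectSlaves F R).KeepsBackbone := fun s rcv => by
  simp only [collectSlaves]; split_ifs <;> rfl

theorem acknowledge_keepsBackbone : (acknowledge F Δ).KeepsBackbone := fun s rcv => by
  simp only [acknowledge]; split_ifs <;> rfl

theorem Phase.KeepsBackbone.exec {ph : Phase (NodeState N) (Msg N)} (h : ph.KeepsBackbone)
    (hH : ∀ v, (s v).inBackbone ↔ v ∈ H) (v : Fin n) :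
    (ph.exec p net s v).inBackbone ↔ v ∈ H := (h _ _).trans (hH v)

/-- The phases `learnNeighbours` and `chooseMaster` transmit identically, so this statement serves
both, by definitional equality. -/
theorem mem_heard_helloName (hs : Initialized net I t₁ t₂ s) (hH : ∀ v, (s v).inBackbone ↔ v ∈ H)
    (hsel : ∀ v u, (net.commGraph p).Adj v u → Network.Selects p net F H v u) (u : Fin n)
    (x : Fin N) :
    x ∈ heard (fun i => net.receive p (fun v => (chooseMaster F).send (s v) i) u) helloName ↔
      ∃ v ∈ H, (net.commGraph p).Adj u v ∧ net.name v = x := by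
  constructor
  · intro hx
    obtain ⟨w, i, m, hwv, hm, hfx⟩ := exists_of_mem_heard hx
    simp only [chooseMaster, Option.ite_none_right_eq_some, Option.some.injEq] at hm
    obtain ⟨⟨hw, -⟩, rfl⟩ := hm
    simp only [helloName, Option.some.injEq, hs.name] at hfx
    exact ⟨w, (hH w).1 hw, hwv.symm, hfx⟩
  · rintro ⟨w, hw, hvw, rfl⟩
    refine (hsel w u hvw.symm).mem_heard (ph := chooseMaster F) 0
      (fun i hi => by simpa [chooseMaster] using hi) ?_ ?_
    · intro i hi w m hm
      simp only [chooseMaster, Option.ite_none_right_eq_some, hs.name, hH, Nat.zero_add] at hm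
      exact hm.1
    · intro i hi hf
      simp only [chooseMaster, hs.name, hH, Nat.zero_add, hw, hf, and_self, if_true,
        Option.some.injEq, exists_eq_left', helloName]

/-- The backbone nodes know their neighbours in the backbone. -/
def NeighboursKnown (p : SINRParams) (net : Network N n) (H : Finset (Fin n))
    (s : Fin n → NodeState N) : Prop :=
  ∀ v ∈ H, ∀ x, x ∈ (s v).nbrs ↔ ∃ u ∈ H, (net.commGraph p).Adj v u ∧ net.name u = x

theorem learnNeighbours_neighboursKnown (hs : Initialized net I t₁ t₂ s)
    (hH : ∀ v, (s v).inBackbone ↔ v ∈ H)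
    (hsel : ∀ v u, (net.commGraph p).Adj v u → Network.Selects p net F H v u) :
    NeighboursKnown p net H ((learnNeighbours F).exec p net s) := by
  intro v hv x
  have e : ((learnNeighbours F).exec p net s v).nbrs = firstBy id (heard (fun i =>
      net.receive p (fun v => (chooseMaster F).send (s v) i) v) helloName) :=
    congrArg NodeState.nbrs (if_pos ((hH v).2 hv))
  rw [e, mem_firstBy_id]
  exact mem_heard_helloName hs hH hsel v x

theorem chooseMaster_neighboursKnown (hs : Initialized net I t₁ t₂ s)
    (hH : ∀ v, (s v).inBackbone ↔ v ∈ H) (h5 : NeighboursKnown p net H s)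
    (hsel : ∀ v u, (net.commGraph p).Adj v u → Network.Selects p net F H v u) :
    NeighboursKnown p net H ((chooseMaster F).exec p net s) := by
  intro v hv x
  have e : ((chooseMaster F).exec p net s v).nbrs = (s v).nbrs.filter fun y => y ∈ heard (fun i =>
      net.receive p (fun v => (chooseMaster F).send (s v) i) v) helloName :=
    congrArg NodeState.nbrs (if_pos ((hH v).2 hv))
  rw [e, List.mem_filter, decide_eq_true_iff, mem_heard_helloName hs hH hsel v x, h5 v hv x,
    and_self]

/-- `lead v` is the leader associated with a node `v` outside the backbone. -/
def MastersKnown (p : SINRParams) (net : Network N n) (H : Finset (Fin n)) (lead : Fin n → Fin n)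
    (s : Fin n → NodeState N) : Prop :=
  ∀ v ∉ H, lead v ∈ H ∧ (net.commGraph p).Adj v (lead v) ∧
    (s v).master = some (net.name (lead v))

theorem chooseMaster_mastersKnown (hs : Initialized net I t₁ t₂ s)
    (hH : ∀ v, (s v).inBackbone ↔ v ∈ H) (hdom : ∀ v ∉ H, ∃ u ∈ H, (net.commGraph p).Adj v u)
    (hsel : ∀ v u, (net.commGraph p).Adj v u → Network.Selects p net F H v u) :
    ∃ lead, MastersKnown p net H lead ((chooseMaster F).exec p net s) := by
  have h : ∀ v, ∃ u, v ∉ H → u ∈ H ∧ (net.commGraph p).Adj v u ∧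
      ((chooseMaster F).exec p net s v).master = some (net.name u) := by
    intro v
    by_cases hv : v ∈ H
    · exact ⟨v, fun h => absurd hv h⟩
    have e : ((chooseMaster F).exec p net s v).master = (heard (fun i =>
        net.receive p (fun v => (chooseMaster F).send (s v) i) v) helloName).min? :=
      congrArg NodeState.master (if_neg fun h => hv ((hH v).1 h))
    obtain ⟨u, hu, hvu⟩ := hdom v hv
    obtain ⟨x, hx⟩ := Option.isSome_iff_exists.1 (List.isSome_min?_of_mem
      ((mem_heard_helloName hs hH hsel v _).2 ⟨u, hu, hvu, rfl⟩))
    obtain ⟨m, hm, hvm, rfl⟩ := (mem_heard_helloName hs hH hsel v x).1 (List.min?_mem hx)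
    exact ⟨m, fun _ => ⟨hm, hvm, e.trans hx⟩⟩
  choose lead hlead using h
  exact ⟨lead, hlead⟩

/-- Every backbone node knows the nodes associated with it. -/
structure SlavesKnown (net : Network N n) (H : Finset (Fin n)) (lead : Fin n → Fin n)
    (s : Fin n → NodeState N) : Prop where
  nodup : ∀ h ∈ H, (s h).slaves.Nodup
  mem : ∀ h ∈ H, ∀ x, x ∈ (s h).slaves ↔ ∃ v ∉ H, lead v = h ∧ net.name v = x

theorem collectSlaves_nbrs (v : Fin n) :
    ((collectSlaves F R).exec p net s v).nbrs = (s v).nbrs := by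
  simp only [Phase.exec, collectSlaves]; split_ifs <;> rfl

theorem collectSlaves_master (v : Fin n) :
    ((collectSlaves F R).exec p net s v).master = (s v).master := by
  simp only [Phase.exec, collectSlaves]; split_ifs <;> rfl

theorem acknowledge_nbrs (v : Fin n) :
    ((acknowledge F Δ).exec p net s v).nbrs = (s v).nbrs := by
  simp only [Phase.exec, acknowledge]; split_ifs <;> rfl

theorem acknowledge_master (v : Fin n) :
    ((acknowledge F Δ).exec p net s v).master = (s v).master := by
  simp only [Phase.exec, acknowledge]; split_ifs <;> rfl

theorem collectSlaves_slavesKnown (hs : Initialized net I t₁ t₂ s)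
    (hH : ∀ v, (s v).inBackbone ↔ v ∈ H) {lead : Fin n → Fin n}
    (h6 : MastersKnown p net H lead s) (hR : ∀ v, t₂ v < R)
    (hsel : ∀ v u, (net.commGraph p).Adj v u →
      Network.Selects p net F (Finset.univ.filter fun w => t₂ w = t₂ v) v u) :
    SlavesKnown net H lead ((collectSlaves F R).exec p net s) := by
  have e : ∀ h ∈ H, ((collectSlaves F R).exec p net s h).slaves =
      (heard (fun i => net.receive p (fun v => (collectSlaves F R).send (s v) i) h) fun _ m =>
          match m with
          | .slave v m => if m = (s h).name then some v else none
          | _ => none).toFinset.sort := fun h hh =>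
    congrArg NodeState.slaves (if_pos ((hH h).2 hh))
  refine ⟨fun h hh => by rw [e h hh]; exact Finset.sort_nodup _ _, fun h hh x => ?_⟩
  rw [e h hh, Finset.mem_sort, List.mem_toFinset]
  constructor
  · intro hx
    obtain ⟨w, i, m, hwv, hm, hfx⟩ := exists_of_mem_heard hx
    simp only [collectSlaves, Option.ite_none_right_eq_some, Option.map_eq_some_iff, hH,
      hs.name] at hm
    obtain ⟨⟨hw, -, -⟩, y, hy, rfl⟩ := hm
    simp only [Option.ite_none_right_eq_some, Option.some.injEq, hs.name] at hfx
    obtain ⟨rfl, rfl⟩ := hfx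
    refine ⟨w, hw, ?_, rfl⟩
    rw [(h6 w hw).2.2, Option.some.injEq] at hy
    exact net.name.injective hy
  · rintro ⟨w, hw, rfl, rfl⟩
    have hlt : ∀ {i}, i < F.length → t₂ w * F.length + i < F.length * R := fun hi => by
      rw [Nat.mul_comm F.length]; exact execution_lt hi (hR w)
    refine (hsel w _ (h6 w hw).2.1).mem_heard (ph := collectSlaves F R)
      (t₂ w * F.length) (fun i hi => hlt hi) ?_ ?_
    · intro i hi a m hm
      simp only [collectSlaves, Option.ite_none_right_eq_some, execution_div hi,
        fires_add, hs.name, hs.t₂] at hm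
      simp [hm.1.2.2, hm.1.2.1]
    · intro i hi hf
      exact ⟨.slave (net.name w) (net.name (lead w)), by
        simp [collectSlaves, execution_div hi, fires_add, hs.name, hs.t₂, hH, hw, hf,
          (h6 w hw).2.2], if_pos (hs.name _).symm⟩

/-- The slaves of `h` are distinct neighbours of `h`, so `Δ` executions are enough to acknowledge
them all. -/
theorem SlavesKnown.length_le {lead : Fin n → Fin n} (h7 : SlavesKnown net H lead s)
    (h6 : MastersKnown p net H lead s) {h : Fin n} (hh : h ∈ H) :
    (s h).slaves.length ≤ net.maxDeg p := by
  classical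
  refine (length_le_card_of_names (net := net) (h7.nodup h hh)
    (fun v => (net.commGraph p).Adj h v) fun x hx => ?_).trans ?_
  · obtain ⟨v, hv, rfl, e⟩ := (h7.mem h hh x).1 hx
    exact ⟨v, (h6 v hv).2.1.symm, e⟩
  · have := Network.card_closedNeighbourhood_le (p := p) (net := net) h
      (insert h (Finset.univ.filter fun v => (net.commGraph p).Adj h v)) (by simp)
    rw [Finset.card_insert_of_notMem (by simp)] at this
    omega

/-- A node occurs on the list of its master only, and there only once. So all acknowledgements
addressed to it are heard in the same execution, and taking the first one loses nothing. -/
theorem acknowledge_position (hs : Initialized net I t₁ t₂ s)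
    (hH : ∀ v, (s v).inBackbone ↔ v ∈ H) {lead : Fin n → Fin n}
    (h6 : MastersKnown p net H lead s) (h7 : SlavesKnown net H lead s)
    (hΔ : ∀ h ∈ H, (s h).slaves.length ≤ Δ)
    (hsel : ∀ v u, (net.commGraph p).Adj v u → Network.Selects p net F H v u) :
    ∀ v ∉ H, ∃ j < Δ, ((acknowledge F Δ).exec p net s v).position = some j ∧
      (s (lead v)).slaves[j]? = some (net.name v) := by
  intro v hv
  obtain ⟨hl, hvl, hm⟩ := h6 v hv
  obtain ⟨j, hj, hjv⟩ := List.getElem_of_mem ((h7.mem _ hl _).2 ⟨v, hv, rfl, rfl⟩)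
  have hjΔ : j < Δ := hj.trans_le (hΔ _ hl)
  refine ⟨j, hjΔ, ?_, by rw [List.getElem?_eq_getElem hj, hjv]⟩
  have e : ((acknowledge F Δ).exec p net s v).position = (heard (fun i =>
      net.receive p (fun v => (acknowledge F Δ).send (s v) i) v) fun i m =>
        match m with
        | .ack w => if w = (s v).name then some (i / F.length) else none
        | _ => none).head? :=
    congrArg NodeState.position (if_neg fun h => hv ((hH v).1 h))
  rw [e]
  have hmem : j ∈ heard (fun i =>
      net.receive p (fun v => (acknowledge F Δ).send (s v) i) v) fun i m =>
        match m with
        | .ack w => if w = (s v).name then some (i / F.length) else none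
        | _ => none := by
    refine (hsel _ v hvl.symm).exists_mem_heard (ph := acknowledge F Δ) (Q := (· = j))
      (j * F.length) (fun i hi => execution_lt hi hjΔ) ?_ ?_ |>.elim fun x hx => hx.2 ▸ hx.1
    · intro i hi a m hm
      simp only [acknowledge, Option.ite_none_right_eq_some, fires_add, hs.name, hH] at hm
      exact hm.1
    · intro i hi hf
      exact ⟨.ack (net.name v), j, by
        simp [acknowledge, execution_div hi, fires_add, hs.name, hH, hl, hf, hj, hjv],
        by simp [execution_div hi, hs.name], rfl⟩
  have hall : ∀ x ∈ heard (fun i =>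
      net.receive p (fun v => (acknowledge F Δ).send (s v) i) v) (fun i m =>
        match m with
        | .ack w => if w = (s v).name then some (i / F.length) else none
        | _ => none), x = j := by
    intro x hx
    obtain ⟨w, i, m, hwv, hm, hfx⟩ := exists_of_mem_heard hx
    simp only [acknowledge, Option.ite_none_right_eq_some, Option.map_eq_some_iff, hH] at hm
    obtain ⟨⟨hw, -⟩, y, hy, rfl⟩ := hm
    simp only [Option.ite_none_right_eq_some, Option.some.injEq, hs.name] at hfx
    obtain ⟨rfl, rfl⟩ := hfx
    obtain ⟨v', hv', rfl, e'⟩ := (h7.mem w hw _).1 (List.mem_of_getElem? hy)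
    obtain rfl := net.name.injective e'
    obtain ⟨hi', hy'⟩ := List.getElem?_eq_some_iff.1 hy
    exact (List.Nodup.getElem_inj_iff (h7.nodup _ hw)).1 (hy'.trans hjv.symm)
  generalize heard _ _ = L at hmem hall
  cases L with
  | nil => simp at hmem
  | cons a L => rw [List.head?_cons, hall a List.mem_cons_self]

/-- The outcome of the second stage. -/
theorem association (hs : Initialized net I t₁ t₂ s)
    (hH : ∀ v, (s v).inBackbone ↔ v ∈ H) (hdom : ∀ v ∉ H, ∃ u ∈ H, (net.commGraph p).Adj v u)
    (hsel₀ : ∀ v u, (net.commGraph p).Adj v u → Network.Selects p net F H v u)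
    {F₁ : List (Finset (Fin N))} (hR : ∀ v, t₂ v < R)
    (hsel₁ : ∀ v u, (net.commGraph p).Adj v u →
      Network.Selects p net F₁ (Finset.univ.filter fun w => t₂ w = t₂ v) v u) :
    ∃ s', s' = run p net [learnNeighbours F, chooseMaster F, collectSlaves F₁ R,
        acknowledge F (net.maxDeg p)] s ∧
      Initialized net I t₁ t₂ s' ∧ (∀ v, (s' v).inBackbone ↔ v ∈ H) ∧
      NeighboursKnown p net H s' ∧ ∃ lead, MastersKnown p net H lead s' ∧
        (∀ v ∉ H, ∃ j < net.maxDeg p, (s' v).position = some j) ∧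
        ∀ v ∉ H, ∀ w ∉ H, lead v = lead w → (s' v).position = (s' w).position → v = w := by
  refine ⟨_, rfl, ?_⟩
  simp only [run]
  have hs1 := hs.exec (p := p) (learnNeighbours_keepsIdentity (F := F))
  have hH1 := (learnNeighbours_keepsBackbone (F := F)).exec (p := p) (net := net) hH
  have hn1 := learnNeighbours_neighboursKnown hs hH hsel₀
  set s1 := (learnNeighbours F).exec p net s
  have hs2 := hs1.exec (p := p) (chooseMaster_keepsIdentity (F := F))
  have hH2 := (chooseMaster_keepsBackbone (F := F)).exec (p := p) (net := net) hH1
  have hn2 := chooseMaster_neighboursKnown hs1 hH1 hn1 hsel₀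
  obtain ⟨lead, hm2⟩ := chooseMaster_mastersKnown hs1 hH1 hdom hsel₀
  set s2 := (chooseMaster F).exec p net s1
  have hs3 := hs2.exec (p := p) (collectSlaves_keepsIdentity (F := F₁) (R := R))
  have hH3 := (collectSlaves_keepsBackbone (F := F₁) (R := R)).exec (p := p) (net := net) hH2
  have hn3 : NeighboursKnown p net H ((collectSlaves F₁ R).exec p net s2) := fun v hv => by
    rw [collectSlaves_nbrs]; exact hn2 v hv
  have hm3 : MastersKnown p net H lead ((collectSlaves F₁ R).exec p net s2) := fun v hv => by
    rw [collectSlaves_master]; exact hm2 v hv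
  have hl3 := collectSlaves_slavesKnown hs2 hH2 hm2 hR hsel₁
  set s3 := (collectSlaves F₁ R).exec p net s2
  have hpos := acknowledge_position hs3 hH3 hm3 hl3 (fun h hh => hl3.length_le hm3 hh) hsel₀
  refine ⟨hs3.exec acknowledge_keepsIdentity, acknowledge_keepsBackbone.exec hH3,
    fun v hv => by rw [acknowledge_nbrs]; exact hn3 v hv, lead,
    fun v hv => by rw [acknowledge_master]; exact hm3 v hv, fun v hv => ?_,
    fun v hv w hw hvw hp => ?_⟩
  · obtain ⟨j, hj, e, -⟩ := hpos v hv
    exact ⟨j, hj, e⟩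
  · obtain ⟨j, -, e, e'⟩ := hpos v hv
    obtain ⟨k, -, f, f'⟩ := hpos w hw
    rw [e, f, Option.some.injEq] at hp
    rw [hp, hvw, f', Option.some.injEq] at e'
    exact (net.name.injective e').symm

end Association

/-! ### The backbone as a subgraph -/

section Backbone

variable {N n : ℕ} {p : SINRParams} {net : Network N n} {I : Set (Fin n)} {t₁ t₂ : Fin n → ℕ}
  {s : Fin n → NodeState N} {F : List (Finset (Fin N))} {R : ℕ} {H : Finset (Fin n)}

/-- `H` consists of the leaders and of boundedly many nodes near each leader, and it connects the
leaders at distance at most three. -/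
structure JoinsLeaders (p : SINRParams) (net : Network N n) (I : Set (Fin n))
    (H : Finset (Fin n)) (Y : Fin n → Finset (Fin n)) : Prop where
  leaders : ∀ v ∈ I, v ∈ H
  card_le : ∀ w ∈ I, (Y w).card ≤ 243
  near : ∀ v ∈ H, ∃ w ∈ I, v ∈ Y w ∧ dist (net.pos w) (net.pos v) ≤ 2 * p.radius
  joins : ∀ w ∈ I, ∀ l ∈ I, w ≠ l → ∀ a, (net.commGraph p).Adj w a →
    ((net.commGraph p).Adj a l ∨ ∃ b, (net.commGraph p).Adj a b ∧ (net.commGraph p).Adj b l) →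
    ∃ a ∈ H, (net.commGraph p).Adj w a ∧ ((net.commGraph p).Adj a l ∨
      ∃ b ∈ H, (net.commGraph p).Adj a b ∧ (net.commGraph p).Adj b l)

variable {Y : Fin n → Finset (Fin n)}

theorem JoinsLeaders.spread (h : JoinsLeaders p net I H Y)
    (hI : (net.commGraph p).IsIndepSet I) : Network.Spread p net (81 * (243 : ℕ)) H := by
  refine Network.spread_of_leaders hI Y (fun v hv => ?_) h.card_le
  obtain ⟨w, hw, hvw, hd⟩ := h.near v hv
  exact ⟨w, hw, hvw, by linarith [p.radius_pos]⟩

/-- Nodes outside `H` with distinct leaders in `H` grow as slowly as `H` does. -/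
theorem JoinsLeaders.spread_of_injOn (h : JoinsLeaders p net I H Y)
    (hI : (net.commGraph p).IsIndepSet I) {X : Finset (Fin n)} {lead : Fin n → Fin n}
    (hl : ∀ v ∈ X, lead v ∈ H ∧ (net.commGraph p).Adj v (lead v)) (hinj : Set.InjOn lead X) :
    Network.Spread p net (81 * (243 : ℕ)) X := by
  classical
  refine Network.spread_of_leaders hI (fun w => X.filter fun v => lead v ∈ Y w) (fun v hv => ?_)
    fun w hw => ?_
  · obtain ⟨hlH, hvl⟩ := hl v hv
    obtain ⟨w, hw, hvw, hd⟩ := h.near _ hlH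
    refine ⟨w, hw, Finset.mem_filter.2 ⟨hv, hvw⟩, ?_⟩
    -- The backbone lies within two radii of the leaders charged, and an associated node is one
    -- radius further: this is why `Network.spread_of_leaders` allows three radii.
    linarith [dist_triangle (net.pos w) (net.pos (lead v)) (net.pos v),
      Network.dist_le_of_adj hvl.symm]
  · refine le_trans (Finset.card_le_card_of_injOn lead (fun v hv => (Finset.mem_filter.1 hv).2)
      (hinj.mono fun v hv => (Finset.mem_filter.1 hv).1)) (h.card_le w hw)

/-- The neighbours lie in a disk of one radius, so the growth constant `81 * 243 = 19683` is itself
the bound. -/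
theorem JoinsLeaders.degree_le (h : JoinsLeaders p net I H Y)
    (hI : (net.commGraph p).IsIndepSet I) (v : Fin n) :
    {u | u ∈ H ∧ (net.commGraph p).Adj v u}.ncard ≤ 19683 := by
  classical
  have h1 := h.spread hI (net.pos v) 1 le_rfl
  have h2 : {u | u ∈ H ∧ (net.commGraph p).Adj v u}.ncard ≤
      (H.filter fun w => dist (net.pos w) (net.pos v) ≤ 1 * p.radius).card := by
    rw [← Set.ncard_coe_finset]
    refine Set.ncard_le_ncard (fun u hu => ?_) (Finset.finite_toSet _)
    exact Finset.mem_coe.2 (Finset.mem_filter.2 ⟨hu.1, by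
      rw [one_mul]; exact Network.dist_le_of_adj hu.2.symm⟩)
  have h3 : ((H.filter fun w => dist (net.pos w) (net.pos v) ≤ 1 * p.radius).card : ℝ) ≤
      (19683 : ℕ) := h1.trans (by norm_num)
  exact h2.trans (by exact_mod_cast h3)

/-- A node of `S` accounts for at most seven leaders, itself and six neighbours, and every leader is
accounted for. With 243 backbone nodes per leader the factor is `7 * 243 = 1701`. -/
theorem JoinsLeaders.card_le_mul (h : JoinsLeaders p net I H Y)
    (hI : (net.commGraph p).IsIndepSet I) {S : Finset (Fin n)} (hS : IsCDS (net.commGraph p) S) :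
    H.card ≤ 19683 * S.card := by
  classical
  set J : Finset (Fin n) := Finset.univ.filter (· ∈ I)
  have hJ : ∀ w, w ∈ J ↔ w ∈ I := fun w => by simp [J]
  have h1 : H.card ≤ J.card * 243 := by
    refine (Finset.card_le_card fun v hv => ?_).trans (Finset.card_biUnion_le_card_mul J Y 243
      fun w hw => h.card_le w ((hJ w).1 hw))
    obtain ⟨w, hw, hvw, -⟩ := h.near v hv
    exact Finset.mem_biUnion.2 ⟨w, (hJ w).2 hw, hvw⟩
  have h2 : J.card ≤ S.card * 7 := by
    refine (Finset.card_le_card fun v hv => ?_).trans (Finset.card_biUnion_le_card_mul S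
      (fun x => insert x (J.filter fun w => (net.commGraph p).Adj x w)) 7 fun x _ => ?_)
    · rw [Finset.mem_biUnion]
      by_cases hvS : v ∈ S
      · exact ⟨v, hvS, Finset.mem_insert_self _ _⟩
      · obtain ⟨u, hu, hvu⟩ := hS.2 v hvS
        exact ⟨u, hu, Finset.mem_insert_of_mem (Finset.mem_filter.2 ⟨hv, hvu.symm⟩)⟩
    · have := Network.card_adjacent_leaders_le hI x
        (J.filter fun w => (net.commGraph p).Adj x w) fun w hw =>
          ⟨(hJ w).1 (Finset.mem_filter.1 hw).1, (Finset.mem_filter.1 hw).2⟩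
      exact (Finset.card_insert_le _ _).trans (by omega)
  omega

/-- Leaders dominating two equal or adjacent nodes are at most three hops apart. They are not
adjacent, by independence, so if distinct they are joined through one or two intermediate nodes, and
`joins` supplies such nodes in `H`. -/
theorem JoinsLeaders.exists_walk_near (h : JoinsLeaders p net I H Y)
    (hI : (net.commGraph p).IsIndepSet I) {w l : Fin n} (hw : w ∈ I) (hl : l ∈ I)
    {u u' : Fin n} (hwu : w = u ∨ (net.commGraph p).Adj w u)
    (huu : u = u' ∨ (net.commGraph p).Adj u u') (hul : u' = l ∨ (net.commGraph p).Adj u' l) :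
    ∃ q : ((net.commGraph p).induce (H : Set (Fin n))).Walk ⟨w, h.leaders w hw⟩
      ⟨l, h.leaders l hl⟩, q.length ≤ 3 := by
  by_cases hwl : w = l
  · subst hwl
    exact ⟨.nil, by simp⟩
  have hind : ¬ (net.commGraph p).Adj w l := hI hw hl hwl
  obtain ⟨a, ha⟩ : ∃ a, (net.commGraph p).Adj w a ∧ ((net.commGraph p).Adj a l ∨
      ∃ b, (net.commGraph p).Adj a b ∧ (net.commGraph p).Adj b l) := by
    rcases hwu with rfl | hwu
    · rcases huu with rfl | huu
      · rcases hul with rfl | hul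
        · exact absurd rfl hwl
        · exact absurd hul hind
      · rcases hul with rfl | hul
        · exact absurd huu hind
        · exact ⟨u', huu, Or.inl hul⟩
    · rcases huu with rfl | huu
      · rcases hul with rfl | hul
        · exact absurd hwu hind
        · exact ⟨u, hwu, Or.inl hul⟩
      · rcases hul with rfl | hul
        · exact ⟨u, hwu, Or.inl huu⟩
        · exact ⟨u, hwu, Or.inr ⟨u', huu, hul⟩⟩
  obtain ⟨a, haH, hwa, hal | ⟨b, hbH, hab, hbl⟩⟩ := h.joins w hw l hl hwl a ha.1 ha.2
  · have e1 : ((net.commGraph p).induce (H : Set (Fin n))).Adj ⟨w, h.leaders w hw⟩ ⟨a, haH⟩ := hwa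
    have e2 : ((net.commGraph p).induce (H : Set (Fin n))).Adj ⟨a, haH⟩ ⟨l, h.leaders l hl⟩ := hal
    exact ⟨.cons e1 (.cons e2 .nil), by simp⟩
  · have e1 : ((net.commGraph p).induce (H : Set (Fin n))).Adj ⟨w, h.leaders w hw⟩ ⟨a, haH⟩ := hwa
    have e2 : ((net.commGraph p).induce (H : Set (Fin n))).Adj ⟨a, haH⟩ ⟨b, hbH⟩ := hab
    have e3 : ((net.commGraph p).induce (H : Set (Fin n))).Adj ⟨b, hbH⟩ ⟨l, h.leaders l hl⟩ := hbl
    exact ⟨.cons e1 (.cons e2 (.cons e3 .nil)), by simp⟩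

/-- Every vertex of the walk is replaced by a leader dominating it. Each edge costs three edges of
the backbone, and the change of leader at the last vertex costs three more. -/
theorem JoinsLeaders.exists_walk_leaders (h : JoinsLeaders p net I H Y)
    (hI : Maximal (net.commGraph p).IsIndepSet I) {u v : Fin n}
    (q : (net.commGraph p).Walk u v) {w l : Fin n} (hw : w ∈ I) (hl : l ∈ I)
    (hwu : w = u ∨ (net.commGraph p).Adj w u) (hvl : v = l ∨ (net.commGraph p).Adj v l) :
    ∃ q' : ((net.commGraph p).induce (H : Set (Fin n))).Walk ⟨w, h.leaders w hw⟩
      ⟨l, h.leaders l hl⟩, q'.length ≤ 3 * q.length + 3 := by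
  induction q generalizing w with
  | nil =>
    obtain ⟨q', hq'⟩ := h.exists_walk_near hI.1 hw hl hwu (Or.inl rfl) hvl
    exact ⟨q', by simpa using hq'⟩
  | @cons u u' v huu q ih =>
    obtain ⟨w', hw', hu'w'⟩ : ∃ w' ∈ I, u' = w' ∨ (net.commGraph p).Adj u' w' := by
      rcases Network.exists_leader hI u' with hu' | ⟨w', hw', hadj⟩
      · exact ⟨u', hu', Or.inl rfl⟩
      · exact ⟨w', hw', Or.inr hadj⟩
    obtain ⟨q₁, hq₁⟩ := h.exists_walk_near hI.1 hw hw' hwu (Or.inr huu) hu'w'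
    obtain ⟨q₂, hq₂⟩ := ih hw' (hu'w'.imp Eq.symm SimpleGraph.Adj.symm) hvl
    refine ⟨q₁.append q₂, ?_⟩
    rw [SimpleGraph.Walk.length_append, SimpleGraph.Walk.length_cons]
    omega

theorem JoinsLeaders.exists_walk (h : JoinsLeaders p net I H Y)
    (hI : Maximal (net.commGraph p).IsIndepSet I) (hc : (net.commGraph p).Connected)
    (x y : (H : Set (Fin n))) :
    ∃ q : ((net.commGraph p).induce (H : Set (Fin n))).Walk x y,
      q.length ≤ 3 * (net.commGraph p).dist x y + 5 := by
  have hlead : ∀ x : (H : Set (Fin n)), ∃ w, ∃ hw : w ∈ I,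
      (w = x ∨ (net.commGraph p).Adj w x) ∧
      ∃ q : ((net.commGraph p).induce (H : Set (Fin n))).Walk x ⟨w, h.leaders w hw⟩,
        q.length ≤ 1 := by
    rintro ⟨x, hx⟩
    rcases Network.exists_leader hI x with hxI | ⟨w, hw, hxw⟩
    · exact ⟨x, hxI, Or.inl rfl, .nil, by simp⟩
    · have e : ((net.commGraph p).induce (H : Set (Fin n))).Adj ⟨x, hx⟩ ⟨w, h.leaders w hw⟩ := hxw
      exact ⟨w, hw, Or.inr hxw.symm, .cons e .nil, by simp⟩
  obtain ⟨w, hw, hwx, q₁, hq₁⟩ := hlead x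
  obtain ⟨l, hl, hly, q₂, hq₂⟩ := hlead y
  obtain ⟨q, hq⟩ := hc.exists_walk_length_eq_dist (x : Fin n) y
  obtain ⟨q', hq'⟩ := h.exists_walk_leaders hI q hw hl hwx
    (hly.imp Eq.symm SimpleGraph.Adj.symm)
  refine ⟨(q₁.append q').append q₂.reverse, ?_⟩
  rw [SimpleGraph.Walk.length_append, SimpleGraph.Walk.length_append,
    SimpleGraph.Walk.length_reverse]
  omega

theorem JoinsLeaders.dominates (h : JoinsLeaders p net I H Y)
    (hI : Maximal (net.commGraph p).IsIndepSet I) (v : Fin n) (hv : v ∉ H) :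
    ∃ u ∈ H, (net.commGraph p).Adj v u := by
  rcases Network.exists_leader hI v with hvI | ⟨w, hw, hvw⟩
  · exact absurd (h.leaders v hvI) hv
  · exact ⟨w, h.leaders w hw, hvw⟩

theorem JoinsLeaders.isBackbone (h : JoinsLeaders p net I H Y)
    (hI : Maximal (net.commGraph p).IsIndepSet I) (hn : 2 ≤ n)
    (hc : (net.commGraph p).Connected) {lead : Fin n → Fin n}
    (hlead : ∀ v ∉ H, lead v ∈ H ∧ (net.commGraph p).Adj v (lead v)) :
    IsBackbone (net.commGraph p) H lead 19683 := by
  have : Nontrivial (Fin n) := Fin.nontrivial_iff_two_le.2 hn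
  have hne : Nonempty (H : Set (Fin n)) := by
    by_cases h0 : (⟨0, by omega⟩ : Fin n) ∈ H
    · exact ⟨⟨_, h0⟩⟩
    · exact ⟨⟨_, (h.dominates hI _ h0).choose_spec.1⟩⟩
  have hconn : ((net.commGraph p).induce (H : Set (Fin n))).Connected :=
    ⟨fun x y => ⟨(h.exists_walk hI hc x y).choose⟩⟩
  refine ⟨⟨hconn, h.dominates hI⟩, h.degree_le hI.1, fun S hS => h.card_le_mul hI.1 hS, ?_, hlead⟩
  -- With at least two nodes the diameter is at least 1, so the additive 5 is absorbed: `3 * diam +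
  -- 5 ≤ 8 * diam`.
  have hd := SimpleGraph.connected_iff_diam_ne_zero.1 hc
  obtain ⟨x, y, hxy⟩ := ((net.commGraph p).induce (H : Set (Fin n))).exists_dist_eq_diam
  obtain ⟨q, hq⟩ := h.exists_walk hI hc x y
  have h1 := SimpleGraph.dist_le q
  have h2 : (net.commGraph p).dist x y ≤ (net.commGraph p).diam :=
    SimpleGraph.dist_le_diam (SimpleGraph.connected_iff_ediam_ne_top.1 hc)
  omega

theorem run_append (A B : List (Phase (NodeState N) (Msg N))) (s : Fin n → NodeState N) :
    run p net (A ++ B) s = run p net B (run p net A s) := by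
  induction A generalizing s with
  | nil => rfl
  | cons ph A ih => exact ih _

/-- The outcome of the first stage, up to the neighbours in the backbone. -/
theorem exploration (hs : Initialized net I t₁ t₂ s) (hc : ∀ v, (s v).conns = [])
    (hI : (net.commGraph p).IsIndepSet I)
    (hsel₀ : ∀ X, Network.Spread p net (81 * (243 : ℕ)) X → ∀ v u, (net.commGraph p).Adj v u →
      Network.Selects p net F X v u)
    {F₁ : List (Finset (Fin N))} (hR : ∀ v, t₁ v < R)
    (hsel₁ : ∀ v u, (net.commGraph p).Adj v u →
      Network.Selects p net F₁ (Finset.univ.filter fun w => t₁ w = t₁ v) v u) :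
    ∃ s', s' = run p net [learnLeaders F, exchangeLeaders F₁ R, collectRoutes F₁ R,
        informFirst F, informSecond F] s ∧ Initialized net I t₁ t₂ s' ∧
      ∃ H Y, JoinsLeaders p net I H Y ∧ ∀ v, (s' v).inBackbone ↔ v ∈ H := by
  classical
  refine ⟨_, rfl, ?_⟩
  simp only [run]
  have hJ : Network.Spread p net (81 * (243 : ℕ)) (Finset.univ.filter (· ∈ I)) :=
    Network.spread_of_leaders hI (fun w => {w}) (fun v hv =>
      ⟨v, (Finset.mem_filter.1 hv).2, by simp, by
        rw [dist_self]; linarith [p.radius_pos]⟩) fun w _ => by simp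
  have hs1 := hs.exec (p := p) (learnLeaders_keepsIdentity (F := F))
  have ho1 := learnLeaders_oneHopKnown hs hI (X := Finset.univ.filter (· ∈ I)) (by simp)
    (hsel₀ _ hJ)
  have hc1 : ∀ v, ((learnLeaders F).exec p net s v).conns = [] := fun v => by
    rw [← hc v]; simp only [Phase.exec, learnLeaders]; split_ifs <;> rfl
  set s1 := (learnLeaders F).exec p net s
  have hs2 := hs1.exec (p := p) (exchangeLeaders_keepsIdentity (F := F₁) (R := R))
  have ht2 := exchangeLeaders_twoHopKnown hs1 hI ho1 hR hsel₁
  have ho2 := ho1.exchangeLeaders (F := F₁) (R := R)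
  have hc2 : ∀ v, ((exchangeLeaders F₁ R).exec p net s1 v).conns = [] := hc1
  set s2 := (exchangeLeaders F₁ R).exec p net s1
  have hs3 := hs2.exec (p := p) (collectRoutes_keepsIdentity (F := F₁) (R := R))
  have hr3 := collectRoutes_routesKnown hs2 hI ho2 ht2 hR hsel₁
  have ho3 := ho2.congr (s' := (collectRoutes F₁ R).exec p net s2) collectRoutes_oneHop
  have ht3 := ht2.congr (s' := (collectRoutes F₁ R).exec p net s2) collectRoutes_oneHop
    collectRoutes_twoHop
  have hc3 : ∀ v, ((collectRoutes F₁ R).exec p net s2 v).conns = [] := fun v => by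
    rw [collectRoutes_conns, hc2]
  set s3 := (collectRoutes F₁ R).exec p net s2
  -- The backbone is defined from the chosen routes, before any connector is informed. Its growth is
  -- thus known in advance, and selection applies to the very phases that inform the connectors,
  -- whose senders all lie in `H`.
  set H : Finset (Fin n) := Finset.univ.filter fun v => v ∈ I ∨
    ∃ w ∈ I, ∃ e ∈ (s3 w).routes, net.name v ∈ e.2.nodes with hH_def
  have hHmem : ∀ v, v ∈ H ↔ v ∈ I ∨ ∃ w ∈ I, ∃ e ∈ (s3 w).routes, net.name v ∈ e.2.nodes :=
    fun v => by simp [H]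
  set Y : Fin n → Finset (Fin n) := fun w => Finset.univ.filter fun v =>
    net.name v ∈ insert (net.name w) ((s3 w).routes.toFinset.biUnion fun e => e.2.nodes)
  have hY : JoinsLeaders p net I H Y := by
    refine ⟨fun v hv => (hHmem v).2 (Or.inl hv), fun w hw => ?_, fun v hv => ?_,
      fun w hw l hl hwl a hwa hal => ?_⟩
    -- The count is `243 = 1 + 121 * 2`: the leader itself and two connectors for each of its
    -- routes.
    · have h1 : (Y w).card ≤ (insert (net.name w)
          ((s3 w).routes.toFinset.biUnion fun e => e.2.nodes)).card := by
        rw [← Finset.card_map net.name]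
        refine Finset.card_le_card fun x hx => ?_
        obtain ⟨v, hv, rfl⟩ := Finset.mem_map.1 hx
        exact (Finset.mem_filter.1 hv).2
      have h2 := Finset.card_insert_le (net.name w)
        ((s3 w).routes.toFinset.biUnion fun e => e.2.nodes)
      have h3 := Finset.card_biUnion_le_card_mul (s3 w).routes.toFinset (fun e => e.2.nodes) 2
        fun e _ => e.2.card_nodes_le
      have h4 := List.toFinset_card_le (s3 w).routes
      have h5 := hr3.length_le w hw
      omega
    · rcases (hHmem v).1 hv with hvI | ⟨w, hw, e, he, hve⟩
      · exact ⟨v, hvI, by simp [Y], by rw [dist_self]; linarith [p.radius_pos]⟩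
      · refine ⟨w, hw, Finset.mem_filter.2 ⟨Finset.mem_univ _, Finset.mem_insert_of_mem
          (Finset.mem_biUnion.2 ⟨e, List.mem_toFinset.2 he, hve⟩)⟩, ?_⟩
        obtain ⟨l, -, -, hr⟩ := hr3.sound w hw e he
        rcases e with ⟨u, ⟨g, f⟩ | ⟨g₁, g₂, f₁, f₂⟩⟩
        · obtain ⟨a, -, ea, hwa, -⟩ := hr
          obtain rfl := net.name.injective (ea.trans (Finset.mem_singleton.1 hve).symm)
          linarith [Network.dist_le_of_adj hwa, p.radius_pos]
        · obtain ⟨a, -, b, -, ea, eb, hwa, hab, -⟩ := hr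
          rcases Finset.mem_insert.1 hve with e | e
          · obtain rfl := net.name.injective (ea.trans e.symm)
            linarith [Network.dist_le_of_adj hwa, p.radius_pos]
          · obtain rfl := net.name.injective (eb.trans (Finset.mem_singleton.1 e).symm)
            exact Network.dist_le_two_of_adj hwa hab
    -- Intermediate nodes next to a leader are not leaders, so they do take part in the exchange
    -- phases.
    · have hnot : ∀ {x y}, x ∈ I → (net.commGraph p).Adj x y → y ∉ I := fun hx hxy hy =>
        hI hx hy hxy.1 hxy
      obtain ⟨e, he, hel⟩ := hr3.complete w hw l hl hwl a (hnot hw hwa) hwa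
        (hal.imp_right fun ⟨b, hab, hbl⟩ => ⟨b, hnot hl hbl.symm, hab, hbl⟩)
      obtain ⟨l', hl', el, hr⟩ := hr3.sound w hw e he
      obtain rfl := net.name.injective (el.trans hel)
      rcases e with ⟨u, ⟨g, f⟩ | ⟨g₁, g₂, f₁, f₂⟩⟩
      · obtain ⟨a, -, ea, hwa, hal⟩ := hr
        exact ⟨a, (hHmem a).2 (Or.inr ⟨w, hw, _, he, Finset.mem_singleton.2 ea⟩), hwa,
          Or.inl hal⟩
      · obtain ⟨a, -, b, -, ea, eb, hwa, hab, hbl, -⟩ := hr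
        exact ⟨a, (hHmem a).2 (Or.inr ⟨w, hw, _, he, Finset.mem_insert.2 (Or.inl ea)⟩), hwa,
          Or.inr ⟨b, (hHmem b).2 (Or.inr ⟨w, hw, _, he, Finset.mem_insert_of_mem
            (Finset.mem_singleton.2 eb)⟩), hab, hbl⟩⟩
  have hselH := hsel₀ H (hY.spread hI)
  have hs4 := hs3.exec (p := p) (informFirst_keepsIdentity (F := F))
  have hf4 := informFirst_firstInformed hs3 hr3 hc3 hY.leaders hselH
  have ho4 : OneHopKnown p net I ((informFirst F).exec p net s3) := ho3.congr fun _ => rfl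
  have ht4 : TwoHopKnown p net I ((informFirst F).exec p net s3) :=
    ht3.congr (fun _ => rfl) fun _ => rfl
  have hr4 : RoutesKnown p net I ((informFirst F).exec p net s3) := by
    refine ⟨hr3.nodup, hr3.length_le, fun w hw e he => ?_, hr3.complete⟩
    obtain ⟨l, hl, el, hr⟩ := hr3.sound w hw e he
    refine ⟨l, hl, el, ?_⟩
    cases h : e.2 <;> (rw [h] at hr; exact hr)
  have hroutes : ∀ v, ((informFirst F).exec p net s3 v).routes = (s3 v).routes := fun _ => rfl
  set s4 := (informFirst F).exec p net s3
  have hs5 := hs4.exec (p := p) (informSecond_keepsIdentity (F := F))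
  refine ⟨hs5, H, Y, hY, fun v => ?_⟩
  rw [NodeState.inBackbone, hs5.leader, informSecond_conns hs4 hI ho4 ht4 hr4 hf4 (X := H)
    (fun v hv => ?_) hselH, hHmem]
  · simp only [hroutes]
  · obtain ⟨w, hw, e, he, hev⟩ := (hf4.conns v).1 hv
    refine (hHmem v).2 (Or.inr ⟨w, hw, e, he, ?_⟩)
    rcases e with ⟨u, ⟨g, f⟩ | ⟨g₁, g₂, f₁, f₂⟩⟩
    · exact Finset.mem_singleton.2 hev.symm
    · exact Finset.mem_insert.2 (Or.inl hev.symm)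

end Backbone

/-! ### Size of messages -/

section Messages

variable {N n : ℕ} {p : SINRParams} {net : Network N n} {F : List (Finset (Fin N))} {R Δ M : ℕ}

/-- All round numbers in a route are less than `M`. -/
def Route.Below (M : ℕ) : Route N → Prop
  | .one _ f => f < M
  | .two _ _ f₁ f₂ => f₁ < M ∧ f₂ < M

/-- All round numbers in a message are less than `M`. -/
def Msg.Below (M : ℕ) : Msg N → Prop
  | .far _ _ _ f => f < M
  | .assign _ _ r => r.Below M
  | .relay _ _ _ _ f => f < M
  | _ => True

theorem Msg.Below.bits_le {m : Msg N} (h : m.Below M) :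
    m.bits ≤ 4 + 4 * Nat.clog 2 N + 2 * Nat.size M := by
  have hs : ∀ {f}, f < M → Nat.size f ≤ Nat.size M := fun hf => Nat.size_le_size hf.le
  rcases m with _ | _ | ⟨_, _, _, f⟩ | ⟨_, _, ⟨_, f⟩ | ⟨_, _, f₁, f₂⟩⟩ | ⟨_, _, _, _, f⟩ | _ | _
  case assign.two => have := hs h.1; have := hs h.2; simp only [bits]; omega
  case far => have := hs h; simp only [bits]; omega
  case relay => have := hs h; simp only [bits]; omega
  case assign.one =>
    have : Nat.size f ≤ Nat.size M := hs h
    simp only [bits]; omega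
  all_goals simp only [bits]; omega

/-- All round numbers recorded for later transmission are less than `M`. -/
structure NodeState.Below (M : ℕ) (s : NodeState N) : Prop where
  twoHop : ∀ e ∈ s.twoHop, e.2.2 < M
  routes : ∀ e ∈ s.routes, e.2.Below M
  relays : ∀ x ∈ s.relays, x.2.2.2 < M

/-- The phase preserves the bound `M` on all round numbers in states and messages. -/
structure Phase.KeepsBelow (M : ℕ) (ph : Phase (NodeState N) (Msg N)) : Prop where
  send : ∀ s i m, s.Below M → ph.send s i = some m → m.Below M
  update : ∀ s rcv, s.Below M → (∀ i m, rcv i = some m → m.Below M) → (ph.update s rcv).Below M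

/-- Received messages were sent by other nodes and so obey the same bound. The invariant holds for
every outcome of the random choices, even if selection fails. -/
theorem allSent_of_keepsBelow {Q : Msg N → Prop} (hQ : ∀ m, m.Below M → Q m)
    (A : List (Phase (NodeState N) (Msg N))) (hA : ∀ ph ∈ A, ph.KeepsBelow M)
    (s : Fin n → NodeState N) (hs : ∀ v, (s v).Below M) : AllSent p net Q A s := by
  induction A generalizing s with
  | nil => trivial
  | cons ph A ih =>
    have hph := hA ph List.mem_cons_self
    refine ⟨fun v i m hm => hQ m (hph.send _ i m (hs v) hm),
      ih (fun q hq => hA q (List.mem_cons_of_mem _ hq)) _ fun v => hph.update _ _ (hs v) ?_⟩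
    intro i m hm
    obtain ⟨w, hw, -⟩ := Network.exists_of_receive_eq_some hm
    exact hph.send _ i m (hs w) hw

theorem learnLeaders_keepsBelow : (learnLeaders F).KeepsBelow M where
  send s i m hs h := by
    simp only [learnLeaders, Option.ite_none_right_eq_some, Option.some.injEq] at h
    rw [← h.2]; trivial
  update s rcv hs h := by
    simp only [learnLeaders]
    split_ifs
    · exact hs
    · exact ⟨hs.1, hs.2, hs.3⟩

theorem exchangeLeaders_keepsBelow (hM : 25 * F.length * R ≤ M) :
    (exchangeLeaders F R).KeepsBelow M where
  send s i m hs h := by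
    simp only [exchangeLeaders, Option.ite_none_right_eq_some, Option.map_eq_some_iff] at h
    obtain ⟨-, _, -, rfl⟩ := h
    trivial
  update s rcv hs h := by
    refine ⟨fun e he => ?_, hs.2, hs.3⟩
    obtain ⟨i, m, -, hx⟩ := mem_heard.1 (mem_of_mem_firstBy he)
    have hi : (i : ℕ) < M := i.2.trans_le hM
    cases m <;> simp only [reduceCtorEq, Option.ite_none_left_eq_some, Option.some.injEq] at hx
    rw [← hx.2]
    exact hi

theorem collectRoutes_keepsBelow (hM : 49 * F.length * R ≤ M) :
    (collectRoutes F R).KeepsBelow M where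
  send s i m hs h := by
    simp only [collectRoutes, Option.ite_none_right_eq_some] at h
    have hm := List.mem_of_mem_take (List.mem_of_getElem? h.2)
    rw [List.mem_append, List.mem_map, List.mem_map] at hm
    rcases hm with ⟨u, -, rfl⟩ | ⟨e, he, rfl⟩
    · trivial
    · exact hs.twoHop e he
  update s rcv hs h := by
    simp only [collectRoutes]
    split_ifs
    · refine ⟨hs.1, fun e he => ?_, hs.3⟩
      obtain ⟨i, m, hm, hx⟩ := mem_heard.1 (mem_of_mem_firstBy (List.mem_of_mem_take he))
      have hi : (i : ℕ) < M := i.2.trans_le hM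
      have hmM := h i m hm
      cases m <;> simp only [reduceCtorEq, Option.ite_none_left_eq_some, Option.some.injEq] at hx
      · rw [← hx.2]; exact hi
      · rw [← hx.2]; exact ⟨hi, hmM⟩
    · exact hs

theorem informFirst_keepsBelow : (informFirst F).KeepsBelow M where
  send s i m hs h := by
    simp only [informFirst, Option.ite_none_right_eq_some, Option.map_eq_some_iff] at h
    obtain ⟨-, e, he, rfl⟩ := h
    exact hs.routes e (List.mem_of_getElem? he)
  update s rcv hs h := by
    refine ⟨hs.1, hs.2, fun x hx => ?_⟩
    obtain ⟨i, m, hm, hx⟩ := mem_heard.1 (mem_of_mem_firstBy hx)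
    have hmM := h i m hm
    rcases m with _ | _ | _ | ⟨_, _, _ | _⟩ | _ | _ | _ <;>
      simp only [reduceCtorEq, Option.ite_none_right_eq_some, Option.some.injEq] at hx
    rw [← hx.2]
    exact hmM.2

theorem informSecond_keepsBelow : (informSecond F).KeepsBelow M where
  send s i m hs h := by
    simp only [informSecond, Option.ite_none_right_eq_some, Option.map_eq_some_iff] at h
    obtain ⟨-, e, he, rfl⟩ := h
    exact hs.relays e (List.mem_of_getElem? he)
  update s rcv hs h := ⟨hs.1, hs.2, hs.3⟩

theorem learnNeighbours_keepsBelow : (learnNeighbours F).KeepsBelow M where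
  send s i m hs h := by
    simp only [learnNeighbours, Option.ite_none_right_eq_some, Option.some.injEq] at h
    rw [← h.2]; trivial
  update s rcv hs h := by
    simp only [learnNeighbours]
    split_ifs
    · exact ⟨hs.1, hs.2, hs.3⟩
    · exact hs

theorem chooseMaster_keepsBelow : (chooseMaster F).KeepsBelow M where
  send s i m hs h := by
    simp only [chooseMaster, Option.ite_none_right_eq_some, Option.some.injEq] at h
    rw [← h.2]; trivial
  update s rcv hs h := by
    simp only [chooseMaster]
    split_ifs <;> exact ⟨hs.1, hs.2, hs.3⟩

theorem collectSlaves_keepsBelow : (collectSlaves F R).KeepsBelow M where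
  send s i m hs h := by
    simp only [collectSlaves, Option.ite_none_right_eq_some, Option.map_eq_some_iff] at h
    obtain ⟨-, _, -, rfl⟩ := h
    trivial
  update s rcv hs h := by
    simp only [collectSlaves]
    split_ifs
    · exact ⟨hs.1, hs.2, hs.3⟩
    · exact hs

theorem acknowledge_keepsBelow : (acknowledge F Δ).KeepsBelow M where
  send s i m hs h := by
    simp only [acknowledge, Option.ite_none_right_eq_some, Option.map_eq_some_iff] at h
    obtain ⟨-, _, -, rfl⟩ := h
    trivial
  update s rcv hs h := by
    simp only [acknowledge]
    split_ifs
    · exact hs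
    · exact ⟨hs.1, hs.2, hs.3⟩

theorem connectBB_keepsBelow (c : Consts) (hM : 49 * (c.F₁ N).length * (c.κ * Δ) ≤ M) :
    ∀ ph ∈ connectBB c N Δ, ph.KeepsBelow M := by
  have hM' : 25 * (c.F₁ N).length * (c.κ * Δ) ≤ M :=
    le_trans (Nat.mul_le_mul_right _ (Nat.mul_le_mul_right _ (by norm_num))) hM
  simp only [connectBB, List.forall_mem_cons]
  exact ⟨learnLeaders_keepsBelow, exchangeLeaders_keepsBelow hM', collectRoutes_keepsBelow hM,
    informFirst_keepsBelow, informSecond_keepsBelow, learnNeighbours_keepsBelow,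
    chooseMaster_keepsBelow, collectSlaves_keepsBelow, acknowledge_keepsBelow, by simp⟩

end Messages

/-! ### Quantitative bounds -/

section Bounds

variable {N n : ℕ} {c : Consts} {Δ : ℕ}

/-- `F₀` is executed `3 + 2 * 121 + Δ` times and `F₁` is executed `(25 + 49 + 1) * Δ` times. The
power 7 comes from the quadratic length bound applied to a parameter of order `log N ^ 3`, with one
more logarithm. -/
theorem rounds_connectBB_le (hN : 2 ≤ N) (hΔ : 1 ≤ Δ) (h₀ : 0 < c.c₀) (h₁ : 0 < c.c₁)
    (hκ : c.κ = 1) : rounds (connectBB c N Δ) ≤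
      (1476 * c.c₀ ^ 2 + 450 * c.c₁ ^ 2) * Δ * Nat.clog 2 N ^ 7 := by
  have hl : 1 ≤ Nat.clog 2 N := Nat.clog_pos (by norm_num) hN
  have h0 : (c.F₀ N).length ≤ _ := length_ssf_le h₀ hN
  have h1 : (c.F₁ N).length ≤ _ := length_ssf_le (Nat.mul_pos h₁ (pow_pos hl 3)) hN
  have e : rounds (connectBB c N Δ) =
      (245 + Δ) * (c.F₀ N).length + 75 * (Δ * (c.F₁ N).length) := by
    simp only [rounds, connectBB, List.map_cons, List.map_nil, List.sum_cons, List.sum_nil,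
      learnLeaders, exchangeLeaders, collectRoutes, informFirst, informSecond, learnNeighbours,
      chooseMaster, collectSlaves, acknowledge, hκ]
    ring
  rw [e]
  generalize Nat.clog 2 N = l at *
  calc (245 + Δ) * (c.F₀ N).length + 75 * (Δ * (c.F₁ N).length)
      ≤ (246 * Δ) * (6 * c.c₀ ^ 2 * l) + 75 * (Δ * (6 * (c.c₁ * l ^ 3) ^ 2 * l)) := by
        gcongr; omega
    _ ≤ (246 * Δ) * (6 * c.c₀ ^ 2 * l ^ 7) + 75 * (Δ * (6 * (c.c₁ * l ^ 3) ^ 2 * l)) := by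
        have : l ≤ l ^ 7 := Nat.le_self_pow (by norm_num) l
        gcongr
    _ = _ := by ring

/-- Round numbers are polynomial in `N`: the seven logarithmic factors are each bounded by `2 ^ l`,
and `Δ ≤ N ≤ 2 ^ l`. -/
theorem size_rounds_le (hN : 2 ≤ N) (hΔ : Δ ≤ N) (h₁ : 0 < c.c₁) (hκ : c.κ = 1) :
    Nat.size (49 * (c.F₁ N).length * (c.κ * Δ)) ≤
      Nat.size (294 * c.c₁ ^ 2) + 8 * Nat.clog 2 N := by
  have hl : 1 ≤ Nat.clog 2 N := Nat.clog_pos (by norm_num) hN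
  have hNl : N ≤ 2 ^ Nat.clog 2 N := Nat.le_pow_clog (by norm_num) N
  have h1 : (c.F₁ N).length ≤ _ := length_ssf_le (Nat.mul_pos h₁ (pow_pos hl 3)) hN
  rw [Nat.size_le]
  generalize Nat.clog 2 N = l at *
  have hl2 : l ≤ 2 ^ l := Nat.lt_two_pow_self.le
  calc 49 * (c.F₁ N).length * (c.κ * Δ)
      ≤ 49 * (6 * (c.c₁ * l ^ 3) ^ 2 * l) * (1 * 2 ^ l) := by rw [hκ]; gcongr; omega
    _ = 294 * c.c₁ ^ 2 * (l ^ 7 * 2 ^ l) := by ring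
    _ ≤ 294 * c.c₁ ^ 2 * ((2 ^ l) ^ 7 * 2 ^ l) := by gcongr
    _ = 294 * c.c₁ ^ 2 * 2 ^ (8 * l) := by ring
    _ < 2 ^ Nat.size (294 * c.c₁ ^ 2) * 2 ^ (8 * l) :=
        Nat.mul_lt_mul_of_pos_right (Nat.lt_size_self _) (by positivity)
    _ = _ := by rw [← pow_add]

end Bounds

/-! ### Correctness of the outcome -/

section Outcome

variable {N n : ℕ} {p : SINRParams} {net : Network N n} {I : Set (Fin n)} {t₁ t₂ : Fin n → ℕ}
  {s : Fin n → NodeState N} {R : ℕ} {F₀ F₁ : List (Finset (Fin N))}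

/-- If the selective families work, then the algorithm computes a backbone and its protocols. -/
theorem computesBackbone_run (hs : Initialized net I t₁ t₂ s) (hc : ∀ v, (s v).conns = [])
    (hn : 2 ≤ n) (hconn : (net.commGraph p).Connected)
    (hI : Maximal (net.commGraph p).IsIndepSet I) (hR₁ : ∀ v, t₁ v < R) (hR₂ : ∀ v, t₂ v < R)
    (hsel₀ : ∀ X, Network.Spread p net (81 * (243 : ℕ)) X → ∀ v u, (net.commGraph p).Adj v u →
      Network.Selects p net F₀ X v u)
    (hsel₁ : ∀ v u, (net.commGraph p).Adj v u →
      Network.Selects p net F₁ (Finset.univ.filter fun w => t₁ w = t₁ v) v u)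
    (hsel₂ : ∀ v u, (net.commGraph p).Adj v u →
      Network.Selects p net F₁ (Finset.univ.filter fun w => t₂ w = t₂ v) v u) :
    ComputesBackbone p net I 19683 F₀ (run p net ([learnLeaders F₀, exchangeLeaders F₁ R,
      collectRoutes F₁ R, informFirst F₀, informSecond F₀] ++ [learnNeighbours F₀,
      chooseMaster F₀, collectSlaves F₁ R, acknowledge F₀ (net.maxDeg p)]) s) := by
  obtain ⟨s₁, e₁, hs₁, H, Y, hY, hH₁⟩ := exploration hs hc hI.1 hsel₀ hR₁ hsel₁
  have hselH := hsel₀ H (hY.spread hI.1)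
  obtain ⟨s₂, e₂, hs₂, hH₂, hnb, lead, hlead, hpos, hinj⟩ :=
    association hs₁ hH₁ (hY.dominates hI) hselH hR₂ hsel₂
  rw [run_append, ← e₁, ← e₂]
  have hHe : backboneNodes s₂ = H := by
    ext v
    simp only [backboneNodes, Finset.mem_filter, Finset.mem_univ, true_and, hH₂]
  -- The receiver may lie inside or outside `H`, so this covers both halves of the inter-cluster
  -- protocol.
  have hinter : ∀ v ∈ H, ∀ u, (net.commGraph p).Adj v u →
      Delivers p net (interSchedule F₀ s₂) F₀.length v u := by
    intro v hv u hvu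
    obtain ⟨i, hi, hf, hT⟩ := hselH v u hvu
    have hmem : ∀ w, w ∈ interSchedule F₀ s₂ i ↔ w ∈ H ∧ fires F₀ (net.name w) i := fun w => by
      simp only [interSchedule, Finset.mem_filter, Finset.mem_univ, true_and, hH₂, hs₂.name]
    exact ⟨i, hi, hT _ (fun w hw => ((hmem w).1 hw).1) (fun w hw => ((hmem w).1 hw).2)
      ((hmem v).2 ⟨hv, hf⟩)⟩
  refine ⟨lead, ?_, ?_⟩
  · intro v hv
    rw [hHe]
    exact hY.leaders v hv
  rw [hHe]
  refine ⟨hY.isBackbone hI hn hconn fun v hv => ⟨(hlead v hv).1, (hlead v hv).2.1⟩,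
    fun v hv => (hlead v hv).2.2, hnb,
    ⟨fun v hv u _ hvu => hinter v hv u hvu,
      fun u hu => hinter _ (hlead u hu).1 u (hlead u hu).2.1.symm⟩, fun v hv => ?_⟩
  obtain ⟨j, hj, hvj⟩ := hpos v hv
  -- The nodes sharing the slot `j` have pairwise distinct leaders, as a list has one entry per
  -- place; so their growth is that of the backbone and the constant parameter suffices.
  set X : Finset (Fin n) := Finset.univ.filter fun w => w ∉ H ∧ (s₂ w).position = some j
  have hX : ∀ w, w ∈ X ↔ w ∉ H ∧ (s₂ w).position = some j := fun w => by simp [X]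
  have hXs : Network.Spread p net (81 * (243 : ℕ)) X :=
    hY.spread_of_injOn hI.1 (lead := lead)
      (fun w hw => ⟨(hlead w ((hX w).1 hw).1).1, (hlead w ((hX w).1 hw).1).2.1⟩)
      fun w hw w' hw' e => by
        have h := (hX w).1 hw
        have h' := (hX w').1 hw'
        exact hinj w h.1 w' h'.1 e (h.2.trans h'.2.symm)
  obtain ⟨i, hi, hf, hT⟩ := hsel₀ X hXs v (lead v) (hlead v hv).2.1
  have hmem : ∀ w, w ∈ intraSchedule F₀ s₂ (j * F₀.length + i) ↔
      w ∈ X ∧ fires F₀ (net.name w) i := fun w => by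
    simp only [intraSchedule, Finset.mem_filter, Finset.mem_univ, true_and, hH₂, hs₂.name,
      execution_div hi, fires_add, hX, and_assoc]
  exact ⟨j * F₀.length + i, execution_lt hi hj, hT _ (fun w hw => ((hmem w).1 hw).1)
    (fun w hw => ((hmem w).1 hw).2) ((hmem v).2 ⟨(hX v).2 ⟨hv, hvj⟩, hf⟩)⟩

end Outcome

end BareBones

/-! ### Choice of the constants and assembly of the theorem -/

theorem mainTheorem3 :
    ∃ B : ℕ, ∀ p : BareBones.SINRParams, ∃ (c₀ : ℕ) (A : ℝ),
      ∀ d : ℕ, ∃ (c : BareBones.Consts) (C : ℝ), c.c₀ = c₀ ∧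
      ∀ (N n : ℕ) (net : BareBones.Network N n), 2 ≤ n → (net.commGraph p).Connected →
      ∀ I : Set (Fin n), Maximal (net.commGraph p).IsIndepSet I →
        -- running time
        (BareBones.rounds (BareBones.connectBB c N (net.maxDeg p)) : ℝ) ≤
          C * net.maxDeg p * Real.log N ^ 7 ∧
        -- lengths of the inter-cluster and of the intra-cluster protocol
        ((c.F₀ N).length : ℝ) ≤ A * Real.log N ∧
        ((net.maxDeg p * (c.F₀ N).length : ℕ) : ℝ) ≤ A * net.maxDeg p * Real.log N ∧
        -- size of messages
        (∀ ω : BareBones.Seeds c n (net.maxDeg p),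
          BareBones.AllSent p net (fun m => (m.bits : ℝ) ≤ C * Real.log N)
            (BareBones.connectBB c N (net.maxDeg p)) (BareBones.initialStates net I ω)) ∧
        -- correctness with high probability
        1 - 1 / (n : ℝ) ^ d ≤ BareBones.prob fun ω : BareBones.Seeds c n (net.maxDeg p) =>
          BareBones.ComputesBackbone p net I B (c.F₀ N) (BareBones.finalStates p net I c ω) := by
  open BareBones in
  refine ⟨19683, fun p => ?_⟩
  obtain ⟨c₀, hc₀, hsel₀⟩ := p.exists_selects_of_spread
    (K := 81 * (243 : ℕ)) (by positivity)
  refine ⟨c₀, 18 * c₀ ^ 2, fun d => ?_⟩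
  obtain ⟨c₁, hc₁, hsel₁⟩ := p.exists_selects_random d
  -- The choice `κ = 1` suffices: the classes need only be as many as `Δ`, and `c₁` absorbs the
  -- rest. Only `c₁` depends on `d`.
  set c : Consts := ⟨c₀, c₁, 1⟩ with hc_def
  -- The factor `2187 = 3 ^ 7` converts `clog 2 N ^ 7` into `Real.log N ^ 7`.
  set C₁ : ℝ := 2187 * (1476 * c₀ ^ 2 + 450 * c₁ ^ 2)
  -- A message has at most `4 + 4 * l + 2 * (size + 8 * l)` bits, where `l = clog 2 N ≥ 1`; hence
  -- the 24.
  set C₂ : ℝ := 3 * (24 + 2 * Nat.size (294 * c₁ ^ 2))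
  have hC₁ : 0 ≤ C₁ := by positivity
  have hC₂ : 0 ≤ C₂ := by positivity
  refine ⟨c, C₁ + C₂, rfl, fun N n net hn hconn I hI => ?_⟩
  have hnN : n ≤ N := by simpa using Fintype.card_le_of_embedding net.name
  have hN : 2 ≤ N := hn.trans hnN
  have hΔ := Network.maxDeg_pos hn hconn
  have hΔn := Network.maxDeg_lt (p := p) (net := net) hn
  have hlog := clog_two_le_log hN
  have hlog0 : 0 ≤ Real.log N := Real.log_natCast_nonneg N
  have hl : 1 ≤ Nat.clog 2 N := Nat.clog_pos (by norm_num) hN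
  have hF₀ : ((c.F₀ N).length : ℝ) ≤ 18 * c₀ ^ 2 * Real.log N := by
    have h : ((c.F₀ N).length : ℝ) ≤ ((6 * c₀ ^ 2 * Nat.clog 2 N : ℕ) : ℝ) :=
      Nat.cast_le.2 (length_ssf_le hc₀ hN)
    push_cast at h
    nlinarith [sq_nonneg (c₀ : ℝ)]
  refine ⟨?_, hF₀, ?_, fun ω => ?_, ?_⟩
  · have h : (rounds (connectBB c N (net.maxDeg p)) : ℝ) ≤
        (((1476 * c₀ ^ 2 + 450 * c₁ ^ 2) * net.maxDeg p * Nat.clog 2 N ^ 7 : ℕ) : ℝ) :=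
      Nat.cast_le.2 (rounds_connectBB_le (c := c) hN hΔ hc₀ hc₁ rfl)
    push_cast at h
    calc _ ≤ _ := h
      _ ≤ (1476 * c₀ ^ 2 + 450 * c₁ ^ 2 : ℝ) * net.maxDeg p * (3 * Real.log N) ^ 7 := by gcongr
      _ = C₁ * net.maxDeg p * Real.log N ^ 7 := by simp only [C₁]; ring
      _ ≤ _ := by gcongr; linarith
  · push_cast
    calc (net.maxDeg p : ℝ) * (c.F₀ N).length ≤ net.maxDeg p * (18 * c₀ ^ 2 * Real.log N) := by
          gcongr
      _ = _ := by ring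
  -- Recorded round numbers arise only in `exchangeLeaders` and `collectRoutes`; `M` is the length
  -- of the longer of these two phases.
  · refine allSent_of_keepsBelow (M := 49 * (c.F₁ N).length * (c.κ * net.maxDeg p))
      (fun m hm => ?_) _ (connectBB_keepsBelow c le_rfl) _ fun v => ?_
    · have h1 := hm.bits_le
      have h2 := size_rounds_le (c := c) hN (hΔn.le.trans hnN) hc₁ rfl
      have h3 : m.bits ≤ 4 + 4 * Nat.clog 2 N +
          2 * (Nat.size (294 * c₁ ^ 2) + 8 * Nat.clog 2 N) :=
        h1.trans (by gcongr)
      have h4 : m.bits ≤ (24 + 2 * Nat.size (294 * c₁ ^ 2)) * Nat.clog 2 N := by nlinarith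
      have h5 : (m.bits : ℝ) ≤
          (((24 + 2 * Nat.size (294 * c₁ ^ 2)) * Nat.clog 2 N : ℕ) : ℝ) := Nat.cast_le.2 h4
      push_cast at h5
      calc _ ≤ _ := h5
        _ ≤ (24 + 2 * Nat.size (294 * c₁ ^ 2) : ℝ) * (3 * Real.log N) := by gcongr
        _ = C₂ * Real.log N := by simp only [C₂]; ring
        _ ≤ _ := by gcongr; linarith
    · exact ⟨by simp [initialStates], by simp [initialStates], by simp [initialStates]⟩
  · have hR : c.κ * net.maxDeg p = net.maxDeg p := one_mul _
    obtain ⟨Bad, hBad, hgood⟩ := hsel₁ net I (c.κ * net.maxDeg p) (c.F₁ N) hn hconn hI hR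
      (ssf_isSSF _ _)
    have : NeZero (c.κ * net.maxDeg p) := ⟨by omega⟩
    refine le_prob_of_card_le Bad hBad fun ω hω => ?_
    have hs : Initialized net I (fun v => ((ω v).1 : ℕ)) (fun v => ((ω v).2 : ℕ))
        (initialStates net I ω) :=
      ⟨fun _ => rfl, fun v => by simp [initialStates], fun _ => rfl, fun _ => rfl⟩
    refine computesBackbone_run hs (fun _ => rfl) hn hconn hI (fun v => (ω v).1.2)
      (fun v => (ω v).2.2) (fun X hX v u hvu => hsel₀ net _ (ssf_isSSF _ _) X hX v u hvu)
      (fun v u hvu => ?_) fun v u hvu => ?_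
    · simpa only [Fin.val_inj] using (hgood ω hω (ω v).1 v u hvu).1
    · simpa only [Fin.val_inj] using (hgood ω hω (ω v).2 v u hvu).2
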